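/- **Theorem 5.4.** Let $n\ge 1$, $\alpha>0$, $b_1>b_2>0$, $f_1(u)=\pm|u|^{b_1}u$, $f_2(u)=\pm|u|^{b_2}u$ (any choice of the two signs; $u$ real- or complex-valued). Consider the Cauchy problem $$u_t+(-\Delta)^\alpha u=f_1(u)+P f_2(u)\quad\text{on }(0,\infty)\times\mathbb R^n,\qquad u(0)=\varphi ,$$ where either $P=\beta\cdot\nabla$ with $\beta\in\mathbb R^n$, $d=1$ and $2\alpha>1$ (problem (5.2)), or $P=\nabla^2=\Delta$, $d=2$ and $\alpha>1$ (problem (5.3)). Put $r_d=\frac{nb_1}{2\alpha-d}$, assume $r\ge r_d>1$, and let $(q,p,r)$ be a generalized admissible triplet, i.e. $\frac1q=\frac n{2\alpha}\left(\frac1r-\frac1p\right)$, $1<r\le p<\infty$, and $p<\frac{nr}{n-2\alpha r}$ if $n>2\alpha r$. For $T>0$ let $Y([0,T))=C([0,T);L^r(\mathbb R^n))\cap\mathcal C_q([0,T);L^p(\mathbb R^n))$, where $\mathcal C_q([0,T);L^p)$ consists of the $u\in C((0,T);L^p)$ with $\sup_{0<t<T}t^{1/q}\|u(t)\|_{L^p}<\infty$.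 A mild solution on $[0,T)$ with datum $\varphi\in L^r(\mathbb R^n)$ is a $u\in Y([0,T))$ with $u(0)=\varphi$ and $$u(t)=S_\alpha(t)\varphi+\int_0^tS_\alpha(t-\tau)\big[f_1(u(\tau))+Pf_2(u(\tau))\big]\,d\tau\qquad(0<t<T),$$ where $S_\alpha(t)=e^{-t(-\Delta)^\alpha}$ is convolution with $K_t(x)=(2\pi)^{-n}\int e^{ix\cdot\xi}e^{-t|\xi|^{2\alpha}}d\xi$, $S_\alpha(t)Pg=(PK_t)*g$, and the integral is a Bochner integral in $L^r$; so that the nonlinear terms make sense, it is also required that $u\in L^\infty_{loc}((0,T);L^m)$ for some $m\in[b_1+1,\infty]$ (automatic if $p\ge b_1+1$). (i) For every $\varphi\in L^r(\mathbb R^n)$ there are a $T>0$ and a unique mild solution on $[0,T)$ with datum $\varphi$. If $r>r_d$, then $T$ can be chosen depending on $\varphi$ only through (an upper bound of) $\|\varphi\|_{L^r}$. Moreover, for every $T>0$ two mild solutions on $[0,T)$ with the same datum coincide. Consequently, for every $\varphi$, either there is a $u$ that is a mild solution on $[0,T)$ for every $T>0$, or there is a solution with a finite maximal existence interval $[0,T^*)$: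 it is a mild solution on $[0,T)$ for every $T<T^*$ and does not extend to a mild solution on $[0,T)$ for any $T>T^*$. (ii) Let $r>r_d$ and let $[0,T^*)$, $T^*<\infty$, be the maximal existence interval of a solution $u$. Then $$\|u(s)\|_{L^r}\ge\frac C{(T^*-s)^{\frac1{b_1}-\frac d{2b_1\alpha}-\frac n{2r\alpha}}}\qquad(0\le s<T^*)$$ with a constant $C>0$ that depends only on the equation, on $(q,p,r)$ and on an upper bound for $T^*$. Consequently $\lim_{t\to T^*,\,t<T^*}\|u(t)\|_{L^r}=\infty$. -/

import Mathlib

open MeasureTheory Set Filter Topology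
open scoped ENNReal FourierTransform

/-- The kernel `K_t` of the semigroup `S_α(t) = exp(-t (-Δ)^α)` on `ℝⁿ`: the inverse Fourier
transform of the symbol `exp(-t |ξ|^{2α})`. (Mathlib's transform is
`𝓕⁻ g x = ∫ exp(2π i ⟪x, ξ⟫) g(ξ) dξ`, so the frequency is `2π ξ`; thus
`K_t(x) = (2π)^{-n} ∫ exp(i ⟪x, η⟫) exp(-t |η|^{2α}) dη`. It is real valued, the symbol being
even.) -/
noncomputable def dissipativeKernel (n : ℕ) (α t : ℝ) (x : EuclideanSpace ℝ (Fin n)) : ℝ :=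
  (𝓕⁻ (fun ξ : EuclideanSpace ℝ (Fin n) =>
    ((Real.exp (-(t * (2 * Real.pi * ‖ξ‖) ^ (2 * α))) : ℝ) : ℂ)) x).re

/-- Convolution of a real kernel with a scalar function on `ℝⁿ`. -/
noncomputable def kernelConv {𝕜 : Type*} [RCLike 𝕜] {n : ℕ}
    (k : EuclideanSpace ℝ (Fin n) → ℝ) (g : EuclideanSpace ℝ (Fin n) → 𝕜) :
    EuclideanSpace ℝ (Fin n) → 𝕜 :=
  convolution k g (ContinuousLinearMap.lsmul ℝ ℝ) volume

/-- The differential operator in front of the second nonlinearity: `β · ∇` or `∇² = Δ`. -/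
inductive HigherOrderTerm (n : ℕ) : Type
  | convection (β : EuclideanSpace ℝ (Fin n)) : HigherOrderTerm n
  | laplacian : HigherOrderTerm n

/-- The order `d` of the operator: `1` for `β · ∇` and `2` for `∇²`. -/
def HigherOrderTerm.order {n : ℕ} : HigherOrderTerm n → ℝ
  | .convection _ => 1
  | .laplacian => 2

/-- The operator applied to a (smooth) function on `ℝⁿ`. -/
noncomputable def HigherOrderTerm.apply {n : ℕ} (P : HigherOrderTerm n)
    (k : EuclideanSpace ℝ (Fin n) → ℝ) : EuclideanSpace ℝ (Fin n) → ℝ :=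
  match P with
  | .convection β => fun x => lineDeriv ℝ k x β
  | .laplacian => fun x => Laplacian.laplacian k x

/-- The power nonlinearity `ε |z|^b z` (used with `ε = 1` or `ε = -1`). -/
noncomputable def powerNonlinearity {𝕜 : Type*} [RCLike 𝕜] (ε b : ℝ) (z : 𝕜) : 𝕜 :=
  (ε * ‖z‖ ^ b) • z

/-- `(q, p, r)` is a generalized admissible triplet:
`1/q = n/(2α) (1/r - 1/p)`, `1 < r ≤ p`, `p < nr/(n - 2αr)` if `n > 2αr`, and `p < ∞` otherwise.
Here `q = ∞` exactly when `p = r`. -/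
structure GeneralizedAdmissible (n : ℕ) (α : ℝ) (q p r : ℝ≥0∞) : Prop where
  one_lt : 1 < r
  le : r ≤ p
  lt_top : p < ∞
  lt_bound : 2 * α * r.toReal < n → p.toReal < n * r.toReal / (n - 2 * α * r.toReal)
  inv_eq : q⁻¹ = ENNReal.ofReal (n / (2 * α) * (1 / r.toReal - 1 / p.toReal))

/-- The time-weighted space `𝒞_σ([0,T); B)`: continuity on `(0,T)` and
`sup_{0 < t < T} t^{1/σ} ‖f(t)‖ < ∞`. -/
def TimeWeighted {B : Type*} [NormedAddCommGroup B] (σ : ℝ≥0∞) (T : ℝ) (f : ℝ → B) : Prop :=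
  ContinuousOn f (Ioo 0 T) ∧ ∃ M : ℝ, ∀ t ∈ Ioo 0 T, t ^ (σ⁻¹).toReal * ‖f t‖ ≤ M

/-- The space `Y([0,T)) = C([0,T); L^r) ∩ 𝒞_q([0,T); L^p)`. -/
def MemY {𝕜 : Type*} [RCLike 𝕜] {n : ℕ} (q p : ℝ≥0∞) {r : ℝ≥0∞} [Fact (1 ≤ p)] [Fact (1 ≤ r)]
    (T : ℝ) (u : ℝ → Lp 𝕜 r (volume : Measure (EuclideanSpace ℝ (Fin n)))) : Prop :=
  ContinuousOn u (Ico 0 T) ∧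
    ∃ v : ℝ → Lp 𝕜 p (volume : Measure (EuclideanSpace ℝ (Fin n))),
      (∀ t ∈ Ioo 0 T, v t =ᵐ[volume] u t) ∧ TimeWeighted q T v

/-- The integrand `S_α(s) [f₁(w) + P f₂(w)]` of Duhamel's formula, `f_j(w) = ε_j |w|^{b_j} w`,
where `S_α(s) P g = (P K_s) ∗ g`. -/
noncomputable def duhamelIntegrand {𝕜 : Type*} [RCLike 𝕜] {n : ℕ} (α b₁ b₂ ε₁ ε₂ : ℝ)
    (P : HigherOrderTerm n) (s : ℝ) (w : EuclideanSpace ℝ (Fin n) → 𝕜) :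
    EuclideanSpace ℝ (Fin n) → 𝕜 := fun x =>
  kernelConv (dissipativeKernel n α s) (fun y => powerNonlinearity ε₁ b₁ (w y)) x +
    kernelConv (P.apply (dissipativeKernel n α s)) (fun y => powerNonlinearity ε₂ b₂ (w y)) x

/-- `u` is a mild solution in `Y([0,T))`, with datum `φ`, of
`u_t + (-Δ)^α u = f₁(u) + P f₂(u)`. -/
structure IsMildSolution {𝕜 : Type*} [RCLike 𝕜] {n : ℕ} (α b₁ b₂ ε₁ ε₂ : ℝ)
    (P : HigherOrderTerm n) (q p : ℝ≥0∞) {r : ℝ≥0∞} [Fact (1 ≤ p)] [Fact (1 ≤ r)]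
    (φ : Lp 𝕜 r (volume : Measure (EuclideanSpace ℝ (Fin n)))) (T : ℝ)
    (u : ℝ → Lp 𝕜 r (volume : Measure (EuclideanSpace ℝ (Fin n)))) : Prop where
  memY : MemY q p T u
  /-- The nonlinear terms make sense: `u ∈ L^∞_loc((0,T); L^m)` for some `m ≥ b₁ + 1`, that is,
  `f₁(u)` is locally bounded in time with values in a Lebesgue space `L^s`, `s ≥ 1`.
  If `b₁ + 1 ≤ p`, this follows from `memY` (with `m = p`). -/
  nonlinearity : ∃ m : ℝ≥0∞, ENNReal.ofReal (b₁ + 1) ≤ m ∧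
    ∀ a b : ℝ, 0 < a → b < T → ∃ M : NNReal, ∀ t ∈ Icc a b, eLpNorm (u t) m volume ≤ M
  initial : u 0 = φ
  /-- `u(t) = S_α(t) φ + ∫₀ᵗ S_α(t - τ) [f₁(u(τ)) + P f₂(u(τ))] dτ` in `L^r`, with a
  (convergent) Bochner integral. -/
  duhamel : ∀ t ∈ Ioo 0 T,
    ∃ G : ℝ → Lp 𝕜 r (volume : Measure (EuclideanSpace ℝ (Fin n))),
      (∀ τ ∈ Ioo 0 t, G τ =ᵐ[volume] duhamelIntegrand α b₁ b₂ ε₁ ε₂ P (t - τ) (u τ)) ∧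
      IntegrableOn G (Ioo 0 t) volume ∧
      u t =ᵐ[volume] fun x =>
        kernelConv (dissipativeKernel n α t) φ x + (∫ τ in Ioo 0 t, G τ) x

/-- `[0, Tₘ)`, with `0 < Tₘ < ∞`, is the maximal existence interval of the solution `u`: `u` is a
mild solution in `Y([0,T))` for every `T < Tₘ`, and it cannot be extended to a mild solution in
`Y([0,T))` for any `T > Tₘ`. -/
def IsMaximalSolution {𝕜 : Type*} [RCLike 𝕜] {n : ℕ} (α b₁ b₂ ε₁ ε₂ : ℝ)
    (P : HigherOrderTerm n) (q p : ℝ≥0∞) {r : ℝ≥0∞} [Fact (1 ≤ p)] [Fact (1 ≤ r)]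
    (φ : Lp 𝕜 r (volume : Measure (EuclideanSpace ℝ (Fin n)))) (Tₘ : ℝ)
    (u : ℝ → Lp 𝕜 r (volume : Measure (EuclideanSpace ℝ (Fin n)))) : Prop :=
  0 < Tₘ ∧ (∀ T, 0 < T → T < Tₘ → IsMildSolution α b₁ b₂ ε₁ ε₂ P q p φ T u) ∧
    ¬ ∃ T > Tₘ, ∃ v : ℝ → Lp 𝕜 r (volume : Measure (EuclideanSpace ℝ (Fin n))),
      IsMildSolution α b₁ b₂ ε₁ ε₂ P q p φ T v ∧ EqOn v u (Ico 0 Tₘ)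

/-! The integral equation is solved by contraction in a Kato-type space. At time t a curve is
measured by its L^r norm and by t^σ times its L^M norm, with σ = n/(2α)·(1/r − 1/M) (`katoExponent`)
and an auxiliary M above r, b₁ + 1 and p, so close to their maximum that σ < 1.

By scaling, S_α(t)P maps L^s to L^e with norm at most a constant times t^(−d/(2α) − n/(2α)(1/s −
1/e)). Hölder's inequality for |u|^b u, with interpolation between L^r and L^M, bounds a Duhamel
integrand by (t−τ)^(−a) τ^(−c) with a, c < 1 (`exists_exponents`). The intermediate exponents cancel
on integration: up to a constant, a term of order d and power b contributes t^(1 − d/(2α) −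
nb/(2αr)) K^b for curves of size K, and `duhamelFactor` is the sum of the two contributions. Since r
≥ r_d means d·r + n·b₁ ≤ 2αr, both powers of t are strictly positive: the f₁ term carries no
derivative, and b₂ < b₁. Both terms are thus subcritical even at r = r_d, and a solution with datum
of norm at most R lives on (0,T) as soon as C·`duhamelFactor`(T,R) ≤ 1.

Uniqueness meets the obstacle that a mild solution in Y comes with no weighted L^M bound near t = 0.
Its L^r norm is bounded there, however, so the existence theorem restarted from u(s), for every
small s > 0, produces a solution with a Kato bound independent of s. After time s > 0 the curve u is
bounded in L^M₀, M₀ = max(r, b₁+1), so the two agree by short-time uniqueness and stepping. Taking s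
= t/2 yields the missing bound for u(t) (`IsDuhamel.exists_katoBound`), and then any two solutions
agree.

Restarting and gluing rest on splitting the Duhamel integral at time s. They give maximal solutions,
and also the blow-up rate: a value u(s) too small for the remaining time Tₘ − s could be continued
past Tₘ.

The kernel estimates need 𝓕⁻(p(ξ) exp(−c|ξ|^(2α))) to be integrable, although the symbol need not be
smooth at 0. With λ = |ξ|², exp(−cλ^α) is a superposition over μ of truncated powers (μ − λ)₊^N.
Each is compactly supported and as smooth as desired for large N, so its transform is integrable;
dilation preserves the L¹ norm of the transform, so the superposition converges in L¹. -/

/-! ### Integrability of kernels with stretched-exponential symbols -/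

/-- Superposition of dilates preserves integrability of the inverse Fourier transform. -/
theorem integrable_fourierInv_superposition {V : Type*} [NormedAddCommGroup V]
    [InnerProductSpace ℝ V] [FiniteDimensional ℝ V] [MeasurableSpace V] [BorelSpace V]
    {F : V → ℂ} (hFc : Continuous F) (hF : Integrable F) (hF' : Integrable (𝓕⁻ F))
    {w : ℝ → ℝ} (hw : IntegrableOn w (Ioi 0))
    (hw' : IntegrableOn (fun μ => w μ * √μ ^ (Module.finrank ℝ V)) (Ioi 0)) :
    Integrable (fun ξ : V => ∫ μ in Ioi (0:ℝ), w μ • F ((√μ)⁻¹ • ξ)) ∧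
    Integrable (𝓕⁻ (fun ξ : V => ∫ μ in Ioi (0:ℝ), w μ • F ((√μ)⁻¹ • ξ))) := by
  set n := Module.finrank ℝ V
  have hmeas1 : AEStronglyMeasurable (fun z : V × ℝ => w z.2 • F ((√z.2)⁻¹ • z.1))
      (volume.prod (volume.restrict (Ioi (0:ℝ)))) := by
    refine AEStronglyMeasurable.smul (f := fun z : V × ℝ => w z.2)
      (g := fun z : V × ℝ => F ((√z.2)⁻¹ • z.1)) ?_ ?_
    · exact hw.1.comp_snd
    · refine (hFc.stronglyMeasurable.comp_measurable ?_).aestronglyMeasurable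
      fun_prop
  have hpos : ∀ᵐ μ ∂(volume.restrict (Ioi (0:ℝ))), (0:ℝ) < μ := ae_restrict_mem measurableSet_Ioi
  have hscale : ∀ μ : ℝ, 0 < μ → ∀ G : V → ℝ, ∫ ξ, G ((√μ)⁻¹ • ξ) = √μ ^ n * ∫ ξ, G ξ := by
    intro μ hμ G
    rw [Measure.integral_comp_smul]
    have : 0 < √μ := Real.sqrt_pos.2 hμ
    rw [inv_pow, inv_inv, abs_of_pos (by positivity), smul_eq_mul]
  have hprod1 : Integrable (fun z : V × ℝ => w z.2 • F ((√z.2)⁻¹ • z.1))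
      (volume.prod (volume.restrict (Ioi (0:ℝ)))) := by
    rw [integrable_prod_iff' hmeas1]
    constructor
    · filter_upwards [hpos] with μ hμ
      have : (√μ)⁻¹ ≠ 0 := (inv_pos.2 (Real.sqrt_pos.2 hμ)).ne'
      exact (hF.comp_smul this).smul (w μ)
    · refine (((hw'.norm).mul_const (∫ ξ, ‖F ξ‖))).congr ?_
      filter_upwards [hpos] with μ hμ
      simp only [norm_smul, norm_mul]
      rw [integral_const_mul, hscale μ hμ (fun ξ => ‖F ξ‖)]
      rw [Real.norm_of_nonneg (show 0 ≤ √μ ^ n by positivity)]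
      ring
  have hF'c : Continuous (𝓕⁻ F) := by
    have h : (𝓕⁻ F) = fun x => 𝓕 F (-x) := by
      ext x; exact Real.fourierInv_eq_fourier_neg F x
    rw [h]
    have : Continuous (𝓕 F) :=
      VectorFourier.fourierIntegral_continuous Real.continuous_fourierChar
        (by exact continuous_inner) hF
    exact this.comp continuous_neg
  -- The inverse transform of ξ ↦ F(ξ/√μ) is √μ^n (𝓕⁻F)(√μ x). Its L¹ norm does not depend on μ, so
  -- integrability of w alone controls the superposition on this side.
  have hmeas2 : AEStronglyMeasurable
      (fun z : V × ℝ => (w z.2 * √z.2 ^ n) • (𝓕⁻ F) (√z.2 • z.1))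
      (volume.prod (volume.restrict (Ioi (0:ℝ)))) := by
    refine AEStronglyMeasurable.smul (f := fun z : V × ℝ => w z.2 * √z.2 ^ n)
      (g := fun z : V × ℝ => (𝓕⁻ F) (√z.2 • z.1)) ?_ ?_
    · exact hw'.1.comp_snd
    · refine (hF'c.stronglyMeasurable.comp_measurable ?_).aestronglyMeasurable
      fun_prop
  have hprod2 : Integrable (fun z : V × ℝ => (w z.2 * √z.2 ^ n) • (𝓕⁻ F) (√z.2 • z.1))
      (volume.prod (volume.restrict (Ioi (0:ℝ)))) := by
    rw [integrable_prod_iff' hmeas2]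
    constructor
    · filter_upwards [hpos] with μ hμ
      have : √μ ≠ 0 := (Real.sqrt_pos.2 hμ).ne'
      exact (hF'.comp_smul this).smul (w μ * √μ ^ n)
    · refine (((hw.norm).mul_const (∫ ξ, ‖(𝓕⁻ F) ξ‖))).congr ?_
      filter_upwards [hpos] with μ hμ
      have h0 : 0 < √μ := Real.sqrt_pos.2 hμ
      simp only [norm_smul, norm_mul]
      have h2 := Measure.integral_comp_smul (volume : Measure V)
          (fun ξ : V => ‖(𝓕⁻ F : V → ℂ) ξ‖) (√μ)
      rw [integral_const_mul, h2]
      rw [Real.norm_of_nonneg (show 0 ≤ √μ ^ n by positivity), abs_of_pos (by positivity),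
        smul_eq_mul]
      field_simp
      rfl
  refine ⟨hprod1.integral_prod_left, hprod2.integral_prod_left.congr (ae_of_all _ fun x => ?_)⟩
  rw [Real.fourierInv_eq]
  have h1 : ∀ ξ : V, (Real.fourierChar (inner ℝ ξ x)) • (∫ μ in Ioi (0:ℝ), w μ • F ((√μ)⁻¹ • ξ))
      = ∫ μ in Ioi (0:ℝ), (Real.fourierChar (inner ℝ ξ x)) • (w μ • F ((√μ)⁻¹ • ξ)) := by
    intro ξ
    simp_rw [Circle.smul_def]
    rw [integral_smul]
  simp_rw [h1]
  rw [integral_integral_swap]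
  · refine (setIntegral_congr_fun measurableSet_Ioi fun μ hμ => ?_)
    have h0 : 0 < √μ := Real.sqrt_pos.2 hμ
    rw [Real.fourierInv_eq]
    have h2 := Measure.integral_comp_smul (volume : Measure V)
      (fun ξ => (Real.fourierChar (inner ℝ ξ (√μ • x))) • F ξ) (√μ)⁻¹
    rw [inv_pow, inv_inv, abs_of_pos (by positivity)] at h2
    rw [mul_smul, ← h2, ← integral_smul]
    refine integral_congr_ae (ae_of_all _ fun ξ => ?_)
    beta_reduce
    rw [inner_smul_left, inner_smul_right]
    simp only [conj_trivial]
    rw [← mul_assoc, inv_mul_cancel₀ h0.ne', one_mul, smul_comm]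
  · refine hprod1.mono ?_ (ae_of_all _ fun z => ?_)
    · have hc : Continuous fun z : V × ℝ => Real.fourierChar (inner ℝ z.1 x) :=
        Real.continuous_fourierChar.comp (by fun_prop)
      exact hc.aestronglyMeasurable.smul hmeas1
    · simp only [Function.uncurry]
      rw [Circle.norm_smul]

/-- The Fourier transform of a compactly supported function with sufficiently many continuous
derivatives is integrable. -/
theorem integrable_fourierInv_of_contDiff {V : Type*} [NormedAddCommGroup V]
    [InnerProductSpace ℝ V] [FiniteDimensional ℝ V] [MeasurableSpace V] [BorelSpace V]
    {F : V → ℂ} (hF : ContDiff ℝ ((Module.finrank ℝ V + 1 : ℕ) : ℕ∞) F)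
    (hs : HasCompactSupport F) : Integrable (𝓕⁻ F) := by
  set n := Module.finrank ℝ V
  have hint : ∀ (k j : ℕ), (k : ℕ∞) ≤ 0 → (j : ℕ∞) ≤ ((n + 1 : ℕ) : ℕ∞) →
      Integrable (fun v => ‖v‖ ^ k * ‖iteratedFDeriv ℝ j F v‖) := by
    intro k j _ hj
    have hc : Continuous (iteratedFDeriv ℝ j F) :=
      hF.continuous_iteratedFDeriv (by exact_mod_cast hj)
    refine Continuous.integrable_of_hasCompactSupport (by fun_prop) ?_
    exact (hs.iteratedFDeriv j).norm.mul_left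
  -- Decay of order n + 1, one more than the dimension, is enough for integrability.
  have hb : ∃ C : ℝ, ∀ w : V, (1 + ‖w‖) ^ (n + 1) * ‖𝓕 F w‖ ≤ C := by
    have h0 := fun w : V => Real.pow_mul_norm_iteratedFDeriv_fourier_le (K := 0) hF hint
      (k := 0) (n := 0) le_rfl (by simp) w
    have h1 := fun w : V => Real.pow_mul_norm_iteratedFDeriv_fourier_le (K := 0) hF hint
      (k := 0) (n := n + 1) le_rfl le_rfl w
    obtain ⟨C0, hC0⟩ : ∃ C, ∀ w : V, ‖𝓕 F w‖ ≤ C := ⟨_, fun w => by simpa using h0 w⟩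
    obtain ⟨C1, hC1⟩ : ∃ C, ∀ w : V, ‖w‖ ^ (n + 1) * ‖𝓕 F w‖ ≤ C :=
      ⟨_, fun w => by simpa only [norm_iteratedFDeriv_zero] using h1 w⟩
    refine ⟨2 ^ n * (C0 + C1), fun w => ?_⟩
    have h2 : (1 + ‖w‖) ^ (n + 1) ≤ 2 ^ n * (1 ^ (n + 1) + ‖w‖ ^ (n + 1)) :=
      add_pow_le zero_le_one (norm_nonneg w) (n + 1)
    calc (1 + ‖w‖) ^ (n + 1) * ‖𝓕 F w‖ ≤ 2 ^ n * (1 ^ (n + 1) + ‖w‖ ^ (n + 1)) * ‖𝓕 F w‖ := by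
          gcongr
      _ = 2 ^ n * (‖𝓕 F w‖ + ‖w‖ ^ (n + 1) * ‖𝓕 F w‖) := by ring
      _ ≤ 2 ^ n * (C0 + C1) := by gcongr <;> [exact hC0 w; exact hC1 w]
  obtain ⟨C, hC⟩ := hb
  have hF1 : Integrable F := hF.continuous.integrable_of_hasCompactSupport hs
  have hcont : Continuous (𝓕 F) :=
    VectorFourier.fourierIntegral_continuous Real.continuous_fourierChar
        (by exact continuous_inner) hF1
  have h3 : Integrable (𝓕 F) := by
    refine ((integrable_one_add_norm (μ := (volume : Measure V)) (r := ((n + 1 : ℕ) : ℝ))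
      (by push_cast; exact lt_add_one _)).const_mul C).mono' hcont.aestronglyMeasurable
      (ae_of_all _ fun w => ?_)
    have hw : 0 < (1 + ‖w‖) ^ (n + 1) := by positivity
    rw [Real.rpow_neg (by positivity), Real.rpow_natCast, ← div_eq_mul_inv, le_div_iff₀ hw,
      mul_comm]
    exact hC w
  have h4 : (𝓕⁻ F) = fun x => 𝓕 F (-x) := by
    ext x; exact Real.fourierInv_eq_fourier_neg F x
  rw [h4]
  exact h3.comp_neg

/-- Induction on m, the derivative of the power m + 2 being m + 2 times the power m + 1. At the
origin it exists because the function is bounded by |y|^(m+2). -/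
theorem contDiff_max_zero_pow (m : ℕ) : ContDiff ℝ m (fun y : ℝ => max y 0 ^ (m + 1)) := by
  induction m with
  | zero => simpa using (continuous_id.max continuous_const)
  | succ m ih =>
    have hd : ∀ y : ℝ, HasDerivAt (fun y : ℝ => max y 0 ^ (m + 2))
        ((m + 2 : ℕ) * max y 0 ^ (m + 1)) y := by
      intro y
      rcases lt_trichotomy y 0 with hy | hy | hy
      · rw [max_eq_right hy.le]
        refine (hasDerivAt_const y (0:ℝ)).congr_of_eventuallyEq ?_ |>.congr_deriv (by simp)
        filter_upwards [Iio_mem_nhds hy] with z hz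
        rw [max_eq_right (le_of_lt hz)]; simp
      · subst hy
        simp only [max_self, ne_eq, Nat.add_eq_zero_iff, one_ne_zero, and_false,
          not_false_eq_true, zero_pow, mul_zero]
        rw [hasDerivAt_iff_isLittleO_nhds_zero]
        simp only [zero_add, max_self, ne_eq, Nat.add_eq_zero_iff, OfNat.ofNat_ne_zero, and_false,
          not_false_eq_true, zero_pow, sub_zero, smul_zero]
        refine (Asymptotics.IsBigO.of_bound 1 ?_).trans_isLittleO
          (Asymptotics.isLittleO_pow_id (n := m + 2) (by omega))
        refine Filter.Eventually.of_forall fun z => ?_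
        rw [one_mul, norm_pow, norm_pow]
        gcongr
        rw [Real.norm_eq_abs, Real.norm_eq_abs, abs_of_nonneg (le_max_right _ _)]
        exact max_le (le_abs_self z) (abs_nonneg z)
      · rw [max_eq_left hy.le]
        refine (hasDerivAt_pow (m + 2) y).congr_of_eventuallyEq ?_ |>.congr_deriv (by simp)
        filter_upwards [Ioi_mem_nhds hy] with z hz
        rw [max_eq_left (le_of_lt hz)]
    have : ((m + 1 : ℕ) : WithTop ℕ∞) = (m : WithTop ℕ∞) + 1 := by push_cast; rfl
    rw [this, contDiff_succ_iff_deriv]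
    refine ⟨fun y => (hd y).differentiableAt, by simp, ?_⟩
    have : deriv (fun y : ℝ => max y 0 ^ (m + 1 + 1)) = fun y => ((m + 2 : ℕ):ℝ) * max y 0
        ^ (m + 1) := by
      ext y; exact (hd y).deriv
    rw [this]
    exact contDiff_const.mul ih

/-- The span of the functions `μ ^ a * exp (-c * μ ^ α)` with `a ≥ a₀`. -/
def powExpSpan (c α a₀ : ℝ) : Submodule ℝ (ℝ → ℝ) :=
  Submodule.span ℝ {g | ∃ a, a₀ ≤ a ∧ g = fun μ : ℝ => μ ^ a * Real.exp (-c * μ ^ α)}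

/-- Only the singularity at 0 matters, and `a₀` bounds it; the exponential absorbs every power at
infinity. -/
theorem powExpSpan_integrableOn {c α a₀ : ℝ} (hc : 0 < c) (hα : 0 < α) {g : ℝ → ℝ}
    (hg : g ∈ powExpSpan c α a₀) {s : ℝ} (hs : -1 < s + a₀) :
    IntegrableOn (fun μ => μ ^ s * g μ) (Ioi 0) := by
  induction hg using Submodule.span_induction with
  | mem x hx =>
    obtain ⟨a, ha, rfl⟩ := hx
    refine (integrableOn_rpow_mul_exp_neg_mul_rpow (s := s + a) (p := α) (b := c)
      (by linarith) hα hc).congr_fun (fun μ hμ => ?_) measurableSet_Ioi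
    simp only
    rw [Real.rpow_add hμ, mul_assoc]
  | zero => simp
  | add x y _ _ hx hy => exact (hx.add hy).congr (ae_of_all _ fun μ => by simp [mul_add])
  | smul r x _ hx =>
    refine Integrable.congr (hx.const_mul r) (ae_of_all _ fun μ => ?_)
    simp; ring

theorem powExpSpan_tendsto {c α a₀ : ℝ} (hc : 0 < c) (hα : 0 < α) {g : ℝ → ℝ}
    (hg : g ∈ powExpSpan c α a₀) (s : ℝ) :
    Tendsto (fun μ => μ ^ s * g μ) atTop (𝓝 0) := by
  induction hg using Submodule.span_induction with
  | mem x hx =>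
    obtain ⟨a, ha, rfl⟩ := hx
    have h := (tendsto_rpow_mul_exp_neg_mul_atTop_nhds_zero ((s + a) / α) c hc).comp
      (tendsto_rpow_atTop hα)
    refine h.congr' ?_
    filter_upwards [eventually_gt_atTop 0] with μ hμ
    simp only [Function.comp]
    rw [← Real.rpow_mul hμ.le, mul_div_cancel₀ _ hα.ne', Real.rpow_add hμ, mul_assoc]
  | zero => simp
  | add x y _ _ hx hy => simpa [mul_add] using hx.add hy
  | smul r x _ hx =>
    have := hx.const_mul r
    rw [mul_zero] at this
    refine this.congr fun μ => ?_
    simp; ring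

/-- Differentiation lowers the threshold `a₀` by exactly one: as α > 0, the term from the
exponential is less singular than the one from the power. -/
theorem powExpSpan_hasDerivAt {c α a₀ : ℝ} (hα : 0 < α) {g : ℝ → ℝ}
    (hg : g ∈ powExpSpan c α a₀) :
    ∃ g' ∈ powExpSpan c α (a₀ - 1), ∀ μ > 0, HasDerivAt g (g' μ) μ := by
  induction hg using Submodule.span_induction with
  | mem x hx =>
    obtain ⟨a, ha, rfl⟩ := hx
    refine ⟨a • (fun μ : ℝ => μ ^ (a - 1) * Real.exp (-c * μ ^ α)) +
      (-c * α) • (fun μ : ℝ => μ ^ (a + α - 1) * Real.exp (-c * μ ^ α)), ?_, ?_⟩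
    · refine Submodule.add_mem _ (Submodule.smul_mem _ _
        (Submodule.subset_span ⟨a - 1, by linarith, rfl⟩))
        (Submodule.smul_mem _ _ (Submodule.subset_span ⟨a + α - 1, by linarith, rfl⟩))
    · intro μ hμ
      have h1 := Real.hasDerivAt_rpow_const (x := μ) (p := a) (Or.inl hμ.ne')
      have h2 := ((Real.hasDerivAt_rpow_const (x := μ) (p := α) (Or.inl hμ.ne')).const_mul (-c)).exp
      refine (h1.mul h2).congr_deriv ?_
      simp only [Pi.add_apply, Pi.smul_apply, smul_eq_mul]
      rw [show a + α - 1 = a + (α - 1) by ring, Real.rpow_add hμ a]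
      ring
  | zero => exact ⟨0, Submodule.zero_mem _, fun μ _ => hasDerivAt_const μ 0⟩
  | add x y _ _ hx hy =>
    obtain ⟨x', hx', h1⟩ := hx
    obtain ⟨y', hy', h2⟩ := hy
    exact ⟨x' + y', Submodule.add_mem _ hx' hy', fun μ hμ => (h1 μ hμ).add (h2 μ hμ)⟩
  | smul r x _ hx =>
    obtain ⟨x', hx', h1⟩ := hx
    exact ⟨r • x', Submodule.smul_mem _ _ hx', fun μ hμ => (h1 μ hμ).const_smul r⟩

/-- `exp (-c λ ^ α)` is a superposition of truncated powers `(μ - λ)₊ ^ N`. -/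
theorem exists_powExpSpan_integral_eq {c α : ℝ} (hc : 0 < c) (hα : 0 < α) (N : ℕ) :
    ∃ g ∈ powExpSpan c α (α - 1 - N), ∀ l > 0,
      ∫ μ in Ioi l, (μ - l) ^ N * g μ = Real.exp (-c * l ^ α) := by
  have hI : ∀ (N : ℕ) (g : ℝ → ℝ), g ∈ powExpSpan c α (α - 1 - N) → ∀ l > 0,
      IntegrableOn (fun μ => (μ - l) ^ N * g μ) (Ioi l) := by
    intro N g hg l hl
    have h := (powExpSpan_integrableOn hc hα hg (s := N) (by linarith)).mono_set
      (Ioi_subset_Ioi hl.le)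
    obtain ⟨g', -, hd⟩ := powExpSpan_hasDerivAt hα hg
    have hcont : ContinuousOn g (Ioi l) := fun μ hμ =>
      (hd μ (hl.trans hμ)).continuousAt.continuousWithinAt
    have hp : ContinuousOn (fun μ : ℝ => (μ - l) ^ N) (Ioi l) := by fun_prop
    exact h.norm.mono' ((hp.mul hcont).aestronglyMeasurable measurableSet_Ioi) (by
        filter_upwards [ae_restrict_mem measurableSet_Ioi] with μ hμ
        change ‖(μ - l) ^ N * g μ‖ ≤ ‖μ ^ (N : ℝ) * g μ‖
        rw [norm_mul, norm_mul, Real.rpow_natCast, norm_pow, norm_pow]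
        have : l < μ := hμ
        gcongr
        rw [Real.norm_of_nonneg (by linarith), Real.norm_of_nonneg (by linarith)]
        linarith)
  induction N with
  | zero =>
    -- For N = 0 the density is minus the derivative of exp(−cμ^α).
    refine ⟨(c * α) • (fun μ : ℝ => μ ^ (α - 1) * Real.exp (-c * μ ^ α)),
      Submodule.smul_mem _ _ (Submodule.subset_span ⟨α - 1, by simp, rfl⟩), fun l hl => ?_⟩
    have hg : (c * α) • (fun μ : ℝ => μ ^ (α - 1) * Real.exp (-c * μ ^ α)) ∈
      powExpSpan c α (α - 1 - (0:ℕ)) :=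
      Submodule.smul_mem _ _ (Submodule.subset_span ⟨α - 1, by simp, rfl⟩)
    have hd : ∀ μ > 0, HasDerivAt (fun μ : ℝ => - Real.exp (-c * μ ^ α))
        ((μ - l) ^ 0 * ((c * α) • (fun μ : ℝ => μ ^ (α - 1) * Real.exp (-c * μ ^ α))) μ) μ := by
      intro μ hμ
      have h2 := ((Real.hasDerivAt_rpow_const (x := μ) (p := α) (Or.inl hμ.ne')).const_mul (-c)).exp
      refine h2.neg.congr_deriv ?_
      simp; ring
    rw [integral_Ioi_of_hasDerivAt_of_tendsto (hd l hl).continuousAt.continuousWithinAt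
      (fun μ hμ => hd μ (hl.trans hμ)) (by simpa using hI 0 _ hg l hl) (m := 0)]
    · ring
    · have hm : (fun μ : ℝ => μ ^ (0:ℝ) * Real.exp (-c * μ ^ α)) ∈ powExpSpan c α 0 :=
        Submodule.subset_span ⟨0, le_rfl, rfl⟩
      have := (powExpSpan_tendsto hc hα hm 0).neg
      simpa using this
  | succ N ih =>
    obtain ⟨g, hg, hrep⟩ := ih
    obtain ⟨g', hg', hd⟩ := powExpSpan_hasDerivAt hα hg
    have hg'2 : g' ∈ powExpSpan c α (α - 1 - (N + 1 : ℕ)) := by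
      convert hg' using 2; push_cast; ring
    -- Integration by parts raises the power by one at the price of differentiating the density. The
    -- boundary terms vanish: (μ − l)^(N+1) is zero at l, and g decays faster than any power.
    refine ⟨(-((N : ℝ) + 1)⁻¹) • g', Submodule.smul_mem _ _ hg'2, fun l hl => ?_⟩
    have hcont := fun μ hμ => (hd μ hμ).continuousAt
    have hD : ∀ μ > 0, HasDerivAt (fun μ => (μ - l) ^ (N + 1) * g μ)
        (((N : ℝ) + 1) * ((μ - l) ^ N * g μ) + (μ - l) ^ (N + 1) * g' μ) μ := by
      intro μ hμ
      refine ((((hasDerivAt_id μ).sub_const l).pow (N + 1)).mul (hd μ hμ)).congr_deriv ?_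
      simp; ring
    have i1 := (hI N g hg l hl).const_mul ((N : ℝ) + 1)
    have i2 := hI (N + 1) g' hg'2 l hl
    have htend : Tendsto (fun μ => (μ - l) ^ (N + 1) * g μ) atTop (𝓝 0) := by
      have h := (powExpSpan_tendsto hc hα hg ((N + 1 : ℕ) : ℝ)).norm
      rw [norm_zero] at h
      refine squeeze_zero_norm' ?_ h
      filter_upwards [eventually_gt_atTop l] with μ hμ
      rw [norm_mul, norm_mul, Real.rpow_natCast, norm_pow, norm_pow]
      gcongr
      rw [Real.norm_of_nonneg (by linarith), Real.norm_of_nonneg (by linarith)]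
      linarith
    have := integral_Ioi_of_hasDerivAt_of_tendsto (hD l hl).continuousAt.continuousWithinAt
      (fun μ hμ => hD μ (hl.trans hμ)) (i1.add i2) htend
    rw [integral_add i1 i2, integral_const_mul, hrep l hl] at this
    have h3 : ∫ μ in Ioi l, (μ - l) ^ (N + 1) * ((-((N : ℝ) + 1)⁻¹) • g') μ =
        (-((N : ℝ) + 1)⁻¹) * ∫ μ in Ioi l, (μ - l) ^ (N + 1) * g' μ := by
      rw [← integral_const_mul]
      refine integral_congr_ae (ae_of_all _ fun μ => ?_)
      simp; ring
    rw [h3]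
    have h4 : (N : ℝ) + 1 ≠ 0 := by positivity
    simp only [sub_self, ne_eq, Nat.add_eq_zero_iff, one_ne_zero, and_false, not_false_eq_true,
      zero_pow, zero_mul] at this
    rw [neg_mul, ← mul_neg, inv_mul_eq_iff_eq_mul₀ h4]
    linarith

/-- The inverse Fourier transform of `p(ξ) exp (-c |ξ|^{2α})`, `p` smooth and homogeneous, is
integrable. -/
theorem integrable_fourierInv_homogeneous_mul_exp {V : Type*} [NormedAddCommGroup V]
    [InnerProductSpace ℝ V] [FiniteDimensional ℝ V] [MeasurableSpace V] [BorelSpace V]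
    [Nontrivial V] {p : V → ℂ} (hp : ContDiff ℝ ⊤ p) (d : ℕ)
    (hpd : ∀ s > (0:ℝ), ∀ ξ, p (s • ξ) = s ^ d • p ξ) {c α : ℝ} (hc : 0 < c) (hα : 0 < α) :
    Integrable (fun ξ : V => p ξ * (Real.exp (-c * ‖ξ‖ ^ (2 * α)) : ℂ)) ∧
    Integrable (𝓕⁻ (fun ξ : V => p ξ * (Real.exp (-c * ‖ξ‖ ^ (2 * α)) : ℂ))) := by
  set n := Module.finrank ℝ V with hn
  -- The power n + 2 of the positive part is of class C^(n+1), the regularity that makes the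
  -- transform integrable.
  set N := n + 2 with hN
  obtain ⟨g, hg, hrep⟩ := exists_powExpSpan_integral_eq hc hα N
  set F : V → ℂ := fun ξ => p ξ * ((max (1 - ‖ξ‖ ^ 2) 0 ^ N : ℝ) : ℂ) with hF
  have hFs : HasCompactSupport F := by
    refine HasCompactSupport.of_support_subset_isCompact (isCompact_closedBall (0 : V) 1) ?_
    intro ξ hξ
    by_contra hcon
    simp only [Metric.mem_closedBall, dist_zero_right, not_le] at hcon
    apply hξ
    simp only [hF]
    rw [max_eq_right (by nlinarith)]
    simp [hN]
  have hFd : ContDiff ℝ ((n + 1 : ℕ) : ℕ∞) F := by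
    refine (hp.of_le (by exact_mod_cast le_top)).mul ?_
    refine Complex.ofRealCLM.contDiff.comp ?_
    have h1 : ContDiff ℝ ((n + 1 : ℕ) : ℕ∞) (fun ξ : V => 1 - ‖ξ‖ ^ 2) :=
      contDiff_const.sub (contDiff_norm_sq ℝ)
    exact (contDiff_max_zero_pow (n + 1)).comp h1
  have hFi : Integrable F := hFd.continuous.integrable_of_hasCompactSupport hFs
  -- The factor μ^N turns (1 − λ/μ)₊^N into (μ − λ)₊^N, and √μ^d undoes the homogeneity factor of
  -- p(ξ/√μ).
  set w : ℝ → ℝ := fun μ => μ ^ N * g μ * √μ ^ d with hw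
  -- The factor μ^N offsets the singularity μ^(α−1−N) allowed for g, leaving an exponent at least α
  -- − 1 > −1 at the origin.
  have hwi : ∀ j : ℕ, IntegrableOn (fun μ => w μ * √μ ^ j) (Ioi 0) := by
    intro j
    refine (powExpSpan_integrableOn hc hα hg (s := N + d / 2 + j / 2) ?_).congr_fun
      (fun μ hμ => ?_) measurableSet_Ioi
    · have : (0:ℝ) ≤ d / 2 + j / 2 := by positivity
      linarith
    · have hμ' : (0:ℝ) < μ := hμ
      simp only [hw]
      rw [Real.rpow_add hμ, Real.rpow_add hμ, Real.rpow_natCast, Real.sqrt_eq_rpow,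
        ← Real.rpow_natCast (μ ^ (1/2 : ℝ)) d, ← Real.rpow_natCast (μ ^ (1/2 : ℝ)) j,
        ← Real.rpow_mul hμ'.le, ← Real.rpow_mul hμ'.le]
      ring_nf
  obtain ⟨h1, h2⟩ := integrable_fourierInv_superposition hFd.continuous hFi
    (integrable_fourierInv_of_contDiff hFd hFs) (by simpa using hwi 0) (hwi n)
  -- The representation formula holds for λ = |ξ|² > 0 only; discarding ξ = 0 does not affect the
  -- inverse transform.
  have hae : (fun ξ : V => ∫ μ in Ioi (0:ℝ), w μ • F ((√μ)⁻¹ • ξ)) =ᵐ[volume]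
      (fun ξ : V => p ξ * (Real.exp (-c * ‖ξ‖ ^ (2 * α)) : ℂ)) := by
    filter_upwards [Measure.ae_ne volume (0:V)] with ξ hξ
    have hξ' : 0 < ‖ξ‖ := norm_pos_iff.2 hξ
    have h3 := hrep (‖ξ‖ ^ 2) (by positivity)
    rw [← Real.rpow_natCast ‖ξ‖ 2, ← Real.rpow_mul hξ'.le] at h3
    push_cast at h3
    rw [← h3]
    have h4 : ∀ μ ∈ Ioi (0:ℝ), w μ • F ((√μ)⁻¹ • ξ) =
        p ξ * (((Ioi (‖ξ‖ ^ 2)).indicator (fun μ => (μ - ‖ξ‖ ^ 2) ^ N * g μ) μ : ℝ) : ℂ) := by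
      intro μ hμ
      have hμ' : (0:ℝ) < μ := hμ
      have hs : 0 < √μ := Real.sqrt_pos.2 hμ
      simp only [hF, hw]
      rw [hpd _ (inv_pos.2 hs), norm_smul, norm_inv, Real.norm_of_nonneg hs.le, mul_pow,
        inv_pow √μ 2, Real.sq_sqrt hμ'.le]
      have h5 : (Ioi (‖ξ‖ ^ 2)).indicator (fun μ => (μ - ‖ξ‖ ^ 2) ^ N * g μ) μ =
          μ ^ N * g μ * max (1 - μ⁻¹ * ‖ξ‖ ^ 2) 0 ^ N := by
        by_cases hm : ‖ξ‖ ^ 2 < μ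
        · rw [indicator_of_mem (by exact hm), max_eq_left]
          · have : μ - ‖ξ‖ ^ 2 = μ * (1 - μ⁻¹ * ‖ξ‖ ^ 2) := by field_simp
            rw [this, mul_pow]; ring
          · rw [sub_nonneg, inv_mul_le_iff₀ hμ']; linarith
        · rw [indicator_of_notMem (by exact hm), max_eq_right]
          · simp [hN]
          · rw [sub_nonpos, le_inv_mul_iff₀ hμ']; linarith
      rw [h5]
      simp only [Complex.real_smul]
      push_cast
      have h6 : ((√μ : ℝ) : ℂ) ≠ 0 := by exact_mod_cast hs.ne'
      have h8 : ((√μ : ℝ) : ℂ) ^ d * ((√μ : ℝ) : ℂ)⁻¹ ^ d = 1 := by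
        rw [← mul_pow, mul_inv_cancel₀ h6, one_pow]
      linear_combination (((μ : ℂ) ^ N * (g μ : ℂ) * p ξ *
        ((max (1 - μ⁻¹ * ‖ξ‖ ^ 2) 0 : ℝ) : ℂ) ^ N)) * h8
    rw [setIntegral_congr_fun measurableSet_Ioi h4, integral_const_mul, integral_complex_ofReal,
      setIntegral_indicator measurableSet_Ioi]
    have h7 : Ioi (0:ℝ) ∩ Ioi (‖ξ‖ ^ 2) = Ioi (‖ξ‖ ^ 2) := by
      apply inter_eq_right.2 (Ioi_subset_Ioi (by positivity))
    rw [h7]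
    simp only [Real.rpow_ofNat]
  refine ⟨h1.congr hae, ?_⟩
  have : 𝓕⁻ (fun ξ : V => ∫ μ in Ioi (0:ℝ), w μ • F ((√μ)⁻¹ • ξ)) =
      𝓕⁻ (fun ξ : V => p ξ * (Real.exp (-c * ‖ξ‖ ^ (2 * α)) : ℂ)) := by
    ext x
    rw [Real.fourierInv_eq, Real.fourierInv_eq]
    refine integral_congr_ae ?_
    filter_upwards [hae] with ξ hξ
    rw [hξ]
  rwa [this] at h2

/-! ### Derivatives and products under the inverse Fourier transform -/

/-- Differentiation under the Fourier integral, applied to the bilinear form −⟨·,·⟩, whose sign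
turns the direct transform into the inverse one. -/
theorem hasFDerivAt_fourierInv {V : Type*} [NormedAddCommGroup V]
    [InnerProductSpace ℝ V] [FiniteDimensional ℝ V] [MeasurableSpace V] [BorelSpace V]
    {m : V → ℂ} (hm : Integrable m) (hm' : Integrable (fun v => ‖v‖ * ‖m v‖)) (x : V) :
    ∃ L : V →L[ℝ] ℂ, HasFDerivAt (𝓕⁻ m) L x ∧
      ∀ e, L e = 𝓕⁻ (fun v => (2 * Real.pi * Complex.I * (inner ℝ v e : ℝ)) * m v) x := by
  have key : ∀ (E : Type) [NormedAddCommGroup E] [NormedSpace ℂ E] (g : V → E) (w : V),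
      VectorFourier.fourierIntegral Real.fourierChar volume
        (-(innerSL ℝ) : V →L[ℝ] V →L[ℝ] ℝ).toLinearMap₁₂ g w
        = ∫ v, Real.fourierChar (inner ℝ v w) • g v := by
    intro E _ _ g w
    rw [VectorFourier.fourierIntegral]
    congr 1
    ext v
    congr 2
    simp
  have h := VectorFourier.hasFDerivAt_fourierIntegral (-(innerSL ℝ) : V →L[ℝ] V →L[ℝ] ℝ) hm hm' x
  refine ⟨VectorFourier.fourierIntegral Real.fourierChar volume
      (-(innerSL ℝ) : V →L[ℝ] V →L[ℝ] ℝ).toLinearMap₁₂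
      (VectorFourier.fourierSMulRight (-(innerSL ℝ) : V →L[ℝ] V →L[ℝ] ℝ) m) x, ?_, ?_⟩
  · have he : 𝓕⁻ m = VectorFourier.fourierIntegral Real.fourierChar volume
        (-(innerSL ℝ) : V →L[ℝ] V →L[ℝ] ℝ).toLinearMap₁₂ m := by
      ext w
      rw [key, Real.fourierInv_eq]
    rw [he]
    exact h
  · intro e
    rw [VectorFourier.fourierIntegral_continuousLinearMap_apply]
    · rw [VectorFourier.fourierIntegral, Real.fourierInv_eq]
      congr 1
      ext v
      simp only [VectorFourier.fourierSMulRight_apply]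
      congr 1
      · congr 1; simp [innerSL_apply_apply ℝ]
      · simp [innerSL_apply_apply ℝ]; ring
    · exact Real.continuous_fourierChar
    · have := VectorFourier.norm_fourierSMulRight_le (-(innerSL ℝ) : V →L[ℝ] V →L[ℝ] ℝ) m
      refine (hm'.const_mul (2 * Real.pi * ‖(-(innerSL ℝ) : V →L[ℝ] V →L[ℝ] ℝ)‖)).mono'
        hm.1.fourierSMulRight (ae_of_all _ fun v => (this v).trans (by rw [mul_assoc]))

/-- Inverse Fourier transforms convert convolution into multiplication. -/
theorem integral_fourierInv_mul_fourierInv_sub {V : Type*} [NormedAddCommGroup V]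
    [InnerProductSpace ℝ V] [FiniteDimensional ℝ V] [MeasurableSpace V] [BorelSpace V]
    {m m' : V → ℂ} (hmc : Continuous m) (hm : Integrable m) (hFm : Integrable (𝓕⁻ m))
    (hm' : Integrable m') (x : V) :
    ∫ y, (𝓕⁻ m) y * (𝓕⁻ m') (x - y) = (𝓕⁻ (fun ξ => m ξ * m' ξ)) x := by
  have hFF : 𝓕 (𝓕⁻ m) = m := by
    refine hmc.fourier_fourierInv_eq hm ?_
    have : 𝓕 m = fun x => 𝓕⁻ m (-x) := by
      ext x; rw [Real.fourierInv_eq_fourier_neg, neg_neg]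
    rw [this]
    exact hFm.comp_neg
  have h1 : ∀ y, (𝓕⁻ m) y * (𝓕⁻ m') (x - y) =
      ∫ ξ, (𝓕⁻ m) y * (Real.fourierChar (inner ℝ ξ (x - y)) • m' ξ) := by
    intro y
    rw [integral_const_mul, Real.fourierInv_eq m']
  simp_rw [h1]
  rw [integral_integral_swap]
  · rw [Real.fourierInv_eq]
    congr 1
    ext ξ
    -- After Fubini the y-integral is the Fourier transform of `𝓕⁻ m` at ξ, which inversion
    -- identifies with m(ξ).
    nth_rewrite 2 [← hFF]
    rw [Real.fourier_eq, Circle.smul_def, ← integral_mul_const, ← integral_smul]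
    congr 1
    ext y
    simp only [Circle.smul_def, inner_sub_right, AddChar.map_sub_eq_div, AddChar.map_neg_eq_inv,
        real_inner_comm y ξ, smul_eq_mul, Circle.coe_div, Circle.coe_inv]
    ring
  · have h2 := hFm.mul_prod hm'
    refine h2.mono ?_ (ae_of_all _ fun z => ?_)
    · have hc : Continuous fun z : V × V => Real.fourierChar (inner ℝ z.2 (x - z.1)) :=
        Real.continuous_fourierChar.comp (by fun_prop)
      refine (hc.aestronglyMeasurable.smul h2.1).congr (ae_of_all _ fun z => ?_)
      simp [Function.uncurry, Circle.smul_def]; ring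
    · simp [Function.uncurry, Circle.norm_smul]

/-! ### Homogeneous symbols and their kernels -/

/-- The symbol of a Fourier multiplier: analytic, homogeneous of degree `d`, and conjugation
symmetric (so that its kernels are real). -/
structure IsHomogeneousSymbol {V : Type*} [NormedAddCommGroup V] [InnerProductSpace ℝ V]
    (p : V → ℂ) (d : ℕ) : Prop where
  contDiff : ContDiff ℝ ⊤ p
  map_smul : ∀ s > (0:ℝ), ∀ ξ, p (s • ξ) = s ^ d • p ξ
  map_neg : ∀ ξ, p (-ξ) = starRingEnd ℂ (p ξ)

/-- The symbol `p(ξ) exp (-t |2πξ|^{2α})`. -/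
noncomputable def heatSymbol {V : Type*} [NormedAddCommGroup V] [InnerProductSpace ℝ V]
    (p : V → ℂ) (α t : ℝ) (ξ : V) : ℂ :=
  p ξ * ((Real.exp (-(t * (2 * Real.pi * ‖ξ‖) ^ (2 * α))) : ℝ) : ℂ)

/-- The real kernel with symbol `heatSymbol p α t`. -/
noncomputable def heatKernel {V : Type*} [NormedAddCommGroup V]
    [InnerProductSpace ℝ V] [FiniteDimensional ℝ V] [MeasurableSpace V] [BorelSpace V]
    (p : V → ℂ) (α t : ℝ) (x : V) : ℝ := (𝓕⁻ (heatSymbol p α t) x).re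

section heatKernel

variable {V : Type*} [NormedAddCommGroup V] [InnerProductSpace ℝ V] {p : V → ℂ} {d : ℕ} {α t : ℝ}

theorem isHomogeneousSymbol_one : IsHomogeneousSymbol (fun _ : V => (1 : ℂ)) 0 :=
  ⟨contDiff_const, by simp, by simp⟩

theorem isHomogeneousSymbol_norm_sq : IsHomogeneousSymbol
    (fun ξ : V => (((2 * Real.pi * ‖ξ‖) ^ 2 : ℝ) : ℂ)) 2 := by
  refine ⟨?_, fun s hs ξ => ?_, fun ξ => ?_⟩
  · have : ContDiff ℝ ⊤ (fun ξ : V => (2 * Real.pi * ‖ξ‖) ^ 2) := by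
      simp_rw [mul_pow]
      exact contDiff_const.mul (contDiff_norm_sq ℝ)
    exact Complex.ofRealCLM.contDiff.comp this
  · rw [norm_smul, Real.norm_of_nonneg hs.le]; simp only [Complex.real_smul]; push_cast; ring
  · rw [norm_neg, Complex.conj_ofReal]

theorem isHomogeneousSymbol_inner (β : V) :
    IsHomogeneousSymbol (fun ξ : V => 2 * Real.pi * Complex.I * ((inner ℝ ξ β : ℝ) : ℂ)) 1 := by
  refine ⟨?_, fun s hs ξ => ?_, fun ξ => ?_⟩
  · have : ContDiff ℝ ⊤ (fun ξ : V => (inner ℝ ξ β : ℝ)) := contDiff_id.inner ℝ contDiff_const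
    exact contDiff_const.mul (Complex.ofRealCLM.contDiff.comp this)
  · simp only [inner_smul_left, pow_one, Complex.real_smul, conj_trivial]; push_cast; ring
  · simp only [inner_neg_left, map_mul, Complex.conj_ofReal, Complex.conj_I, map_ofNat]
    push_cast; ring

theorem isHomogeneousSymbol_neg (hp : IsHomogeneousSymbol p d) :
    IsHomogeneousSymbol (fun ξ => - p ξ) d :=
  ⟨hp.contDiff.neg, fun s hs ξ => by rw [hp.map_smul s hs]; simp, fun ξ => by
    rw [hp.map_neg]; simp⟩

theorem heatSymbol_eq (ξ : V) : heatSymbol p α t ξ =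
    p ξ * ((Real.exp (-(t * (2 * Real.pi) ^ (2 * α)) * ‖ξ‖ ^ (2 * α)) : ℝ) : ℂ) := by
  rw [heatSymbol, Real.mul_rpow (by positivity) (by positivity)]
  ring_nf

theorem continuous_heatSymbol (hp : IsHomogeneousSymbol p d) (hα : 0 < α) :
    Continuous (heatSymbol p α t) := by
  have h1 : Continuous fun ξ : V => (2 * Real.pi * ‖ξ‖) ^ (2 * α) :=
    Continuous.rpow_const (by fun_prop) (fun _ => Or.inr (by positivity))
  have h2 := hp.contDiff.continuous
  unfold heatSymbol
  fun_prop

variable [FiniteDimensional ℝ V] [MeasurableSpace V] [BorelSpace V]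

theorem integrable_heatSymbol [Nontrivial V] (hp : IsHomogeneousSymbol p d) (hα : 0 < α)
    (ht : 0 < t) : Integrable (heatSymbol p α t) ∧ Integrable (𝓕⁻ (heatSymbol p α t)) := by
  have h : heatSymbol p α t = fun ξ =>
    p ξ * (Real.exp (-(t * (2 * Real.pi) ^ (2 * α)) * ‖ξ‖ ^ (2 * α)) : ℂ) := by
    ext ξ; rw [heatSymbol_eq]
  rw [h]
  exact integrable_fourierInv_homogeneous_mul_exp hp.contDiff d hp.map_smul (by positivity) hα

/-- Conjugating the integral and substituting −ξ for ξ leaves it unchanged, by the symmetry of p.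
Taking real parts in `heatKernel` therefore loses nothing. -/
theorem ofReal_heatKernel (hp : IsHomogeneousSymbol p d) (x : V) :
    ((heatKernel p α t x : ℝ) : ℂ) = 𝓕⁻ (heatSymbol p α t) x := by
  rw [heatKernel, ← Complex.conj_eq_iff_re, Real.fourierInv_eq, ← integral_conj]
  rw [← integral_neg_eq_self]
  congr 1
  ext ξ
  simp only [heatSymbol, Circle.smul_def, inner_neg_left, smul_eq_mul, map_mul,
      hp.map_neg, norm_neg,
    Complex.conj_conj, Complex.conj_ofReal, AddChar.map_neg_eq_inv, Circle.coe_inv_eq_conj]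

theorem integrable_heatKernel [Nontrivial V] (hp : IsHomogeneousSymbol p d) (hα : 0 < α)
    (ht : 0 < t) : Integrable (heatKernel p α t) := (integrable_heatSymbol hp hα ht).2.re

theorem continuous_heatKernel [Nontrivial V] (hp : IsHomogeneousSymbol p d) (hα : 0 < α)
    (ht : 0 < t) : Continuous (heatKernel p α t) := by
  refine Complex.continuous_re.comp ?_
  have h4 : (𝓕⁻ (heatSymbol p α t)) = fun x => 𝓕 (heatSymbol p α t) (-x) := by
    ext x; exact Real.fourierInv_eq_fourier_neg _ x
  rw [h4]
  have : Continuous (𝓕 (heatSymbol p α t)) :=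
    VectorFourier.fourierIntegral_continuous Real.continuous_fourierChar
      (by exact continuous_inner) (integrable_heatSymbol hp hα ht).1
  exact this.comp continuous_neg

/-- The substitution ξ = sη with s = t^(−1/(2α)) removes t from the exponential; the Jacobian gives
s^n and the homogeneity of p gives s^d. -/
theorem heatKernel_scaling (hp : IsHomogeneousSymbol p d) (hα : 0 < α) (ht : 0 < t) (x : V) :
    heatKernel p α t x = (t ^ (-(1 / (2 * α)))) ^ (Module.finrank ℝ V + d) *
      heatKernel p α 1 ((t ^ (-(1 / (2 * α)))) • x) := by
  set s := t ^ (-(1 / (2 * α))) with hs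
  have hs0 : 0 < s := Real.rpow_pos_of_pos ht _
  have h1 : ∀ η : V, heatSymbol p α t (s • η) = s ^ d • heatSymbol p α 1 η := by
    intro η
    have : t * (2 * Real.pi * ‖s • η‖) ^ (2 * α) = 1 * (2 * Real.pi * ‖η‖) ^ (2 * α) := by
      rw [norm_smul, Real.norm_of_nonneg hs0.le,
        show 2 * Real.pi * (s * ‖η‖) = s * (2 * Real.pi * ‖η‖) by ring,
        Real.mul_rpow hs0.le (by positivity), hs, ← Real.rpow_mul ht.le,
        show -(1 / (2 * α)) * (2 * α) = -1 by field_simp, Real.rpow_neg_one]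
      field_simp
    rw [heatSymbol, heatSymbol, hp.map_smul s hs0, this, smul_mul_assoc]
  have h2 : (𝓕⁻ (heatSymbol p α t)) x =
      ((s ^ (Module.finrank ℝ V + d) : ℝ) : ℂ) * (𝓕⁻ (heatSymbol p α 1)) (s • x) := by
    rw [Real.fourierInv_eq, Real.fourierInv_eq]
    have h3 := Measure.integral_comp_smul (volume : Measure V)
      (fun ξ => (Real.fourierChar (inner ℝ ξ x)) • heatSymbol p α t ξ) s
    rw [abs_of_pos (by positivity)] at h3
    have h4 : ∫ ξ, (Real.fourierChar (inner ℝ ξ x)) • heatSymbol p α t ξ =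
      s ^ Module.finrank ℝ V • ∫ ξ, (Real.fourierChar (inner ℝ (s • ξ) x)) • heatSymbol p α
          t (s • ξ) := by
      rw [h3, smul_smul, mul_inv_cancel₀ (by positivity), one_smul]
    rw [h4, ← integral_smul, ← integral_const_mul]
    congr 1
    ext ξ
    rw [h1, inner_smul_left, inner_smul_right]
    simp only [conj_trivial, Circle.smul_def, Complex.real_smul, smul_eq_mul, pow_add]
    push_cast
    ring
  rw [heatKernel, h2, Complex.re_ofReal_mul, heatKernel]

/-- Fourier inversion read at frequency 0, where the symbol equals 1. -/
theorem integral_heatKernel [Nontrivial V] (hα : 0 < α) (ht : 0 < t) :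
    ∫ x : V, heatKernel (fun _ => 1) α t x = 1 := by
  have hp := isHomogeneousSymbol_one (V := V)
  obtain ⟨h1, h2⟩ := integrable_heatSymbol hp hα ht
  have hFF : 𝓕 (𝓕⁻ (heatSymbol (fun _ : V => (1:ℂ)) α t)) = heatSymbol (fun _ => 1) α t := by
    refine (continuous_heatSymbol hp hα).fourier_fourierInv_eq h1 ?_
    have : 𝓕 (heatSymbol (fun _ : V => (1:ℂ)) α t) =
        fun x => (𝓕⁻ (heatSymbol (fun _ : V => (1:ℂ)) α t) : V → ℂ) (-x) := by
      ext x; rw [Real.fourierInv_eq_fourier_neg, neg_neg]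
    rw [this]
    exact h2.comp_neg
  have h3 := congrFun hFF 0
  rw [Real.fourier_eq] at h3
  simp only [inner_zero_right, neg_zero, AddChar.map_zero_eq_one, one_smul] at h3
  simp_rw [← ofReal_heatKernel hp] at h3
  rw [integral_complex_ofReal] at h3
  have h4 : heatSymbol (fun _ : V => (1:ℂ)) α t 0 = 1 := by
    simp [heatSymbol, Real.zero_rpow (show 2 * α ≠ 0 by positivity)]
  rw [h4] at h3
  exact_mod_cast h3

/-- The semigroup property. -/
theorem integral_heatKernel_mul_heatKernel_sub [Nontrivial V] (hp : IsHomogeneousSymbol p d)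
    (hα : 0 < α) {s : ℝ} (ht : 0 < t) (hs : 0 < s) (x : V) :
    ∫ y, heatKernel (fun _ => 1) α t y * heatKernel p α s (x - y) = heatKernel p α (t + s) x := by
  have hp1 := isHomogeneousSymbol_one (V := V)
  obtain ⟨h1, h2⟩ := integrable_heatSymbol hp1 hα ht
  have h := integral_fourierInv_mul_fourierInv_sub (continuous_heatSymbol hp1 hα) h1 h2
    (integrable_heatSymbol hp hα hs).1 x
  have h3 : (fun ξ => heatSymbol (fun _ => 1) α t ξ * heatSymbol p α s ξ) = heatSymbol p
      α (t + s) := by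
    ext ξ
    simp only [heatSymbol]
    rw [add_mul, neg_add, Real.exp_add]
    push_cast; ring
  rw [h3] at h
  simp_rw [← ofReal_heatKernel hp, ← ofReal_heatKernel hp1, ← Complex.ofReal_mul] at h
  rw [integral_complex_ofReal] at h
  exact_mod_cast h

end heatKernel

/-! ### Kernel bounds and derivatives of the kernel -/

section kernelDerivatives

variable {V : Type*} [NormedAddCommGroup V] [InnerProductSpace ℝ V] [FiniteDimensional ℝ V]
  [MeasurableSpace V] [BorelSpace V] {α t : ℝ}

theorem integral_abs_heatKernel {p : V → ℂ} {d : ℕ} (hp : IsHomogeneousSymbol p d) (hα : 0 < α)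
    (ht : 0 < t) :
    ∫ x, |heatKernel p α t x| = (t ^ (-(1 / (2 * α)))) ^ d * ∫ x, |heatKernel p α 1 x| := by
  have hs0 : 0 < t ^ (-(1 / (2 * α))) := Real.rpow_pos_of_pos ht _
  simp_rw [heatKernel_scaling hp hα ht, abs_mul, abs_of_pos (pow_pos hs0 _)]
  rw [integral_const_mul, Measure.integral_comp_smul (volume : Measure V)
    (fun x => |heatKernel p α 1 x|), abs_of_pos (by positivity), smul_eq_mul]
  field_simp
  ring

/-- By scaling only t = 1 matters, where the supremum is at most the L¹ norm of the symbol. A single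
constant serves for both bounds so that Young's inequality later produces that same constant. -/
theorem exists_heatKernel_bound {p : V → ℂ} {d : ℕ} (hp : IsHomogeneousSymbol p d) (hα : 0 < α) :
    ∃ A > 0, ∀ t > 0, (∫ x, |heatKernel p α t x|) ≤ A * t ^ (-(d / (2 * α))) ∧
      ∀ x, |heatKernel p α t x| ≤ A * t ^ (-((d + Module.finrank ℝ V) / (2 * α))) := by
  set B := ∫ ξ, ‖heatSymbol p α 1 ξ‖
  have hB : ∀ x, |heatKernel p α 1 x| ≤ B := by
    intro x
    refine (Complex.abs_re_le_norm _).trans ?_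
    rw [Real.fourierInv_eq]
    refine (norm_integral_le_integral_norm _).trans (le_of_eq ?_)
    simp_rw [Circle.norm_smul]
    rfl
  have hB0 : 0 ≤ B := (abs_nonneg _).trans (hB 0)
  have hA0 : 0 ≤ ∫ x, |heatKernel p α 1 x| := integral_nonneg fun x => abs_nonneg _
  have hpow : ∀ t > (0:ℝ), ∀ j : ℕ, (t ^ (-(1 / (2 * α)))) ^ j = t ^ (-(j / (2 * α))) := by
    intro t ht j
    rw [← Real.rpow_natCast, ← Real.rpow_mul ht.le]
    congr 1; ring
  refine ⟨(∫ x, |heatKernel p α 1 x|) + B + 1, by positivity, fun t ht => ⟨?_, fun x => ?_⟩⟩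
  · rw [integral_abs_heatKernel hp hα ht, hpow t ht, mul_comm]
    gcongr
    linarith
  · rw [heatKernel_scaling hp hα ht, hpow t ht, abs_mul, abs_of_pos
      (Real.rpow_pos_of_pos ht _), mul_comm]
    rw [show ((Module.finrank ℝ V + d : ℕ) : ℝ) = d + Module.finrank ℝ V by push_cast; ring]
    gcongr
    linarith [hB (t ^ (-(1 / (2 * α))) • x)]

variable [Nontrivial V]

/-- One majorant for all moments up to order two, which is what differentiating the kernel twice
requires. -/
theorem integrable_one_add_norm_sq_mul_heatSymbol (hα : 0 < α) (ht : 0 < t) :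
    Integrable fun ξ : V => (1 + ‖ξ‖ ^ 2) * ‖heatSymbol (fun _ : V => (1:ℂ)) α t ξ‖ := by
  have h1 := (integrable_heatSymbol (isHomogeneousSymbol_one (V := V)) hα ht).1.norm
  have h2 := ((integrable_heatSymbol (isHomogeneousSymbol_norm_sq (V := V)) hα ht).1.norm).const_mul
    ((2 * Real.pi) ^ 2)⁻¹
  refine (h1.add h2).congr (ae_of_all _ fun ξ => ?_)
  simp only [Pi.add_apply, heatSymbol, norm_mul, Complex.norm_real, one_mul, norm_pow,
    norm_norm, Real.norm_of_nonneg Real.pi_pos.le, Real.norm_ofNat]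
  field_simp

theorem hasFDerivAt_heatKernel (hα : 0 < α) (ht : 0 < t) (x : V) :
    ∃ L : V →L[ℝ] ℝ, HasFDerivAt (heatKernel (fun _ : V => (1:ℂ)) α t) L x ∧ ∀ e, L e =
      heatKernel (fun ξ : V => 2 * Real.pi * Complex.I * ((inner ℝ ξ e : ℝ) : ℂ)) α t x := by
  have hi := integrable_one_add_norm_sq_mul_heatSymbol (V := V) hα ht
  have hm := (integrable_heatSymbol (isHomogeneousSymbol_one (V := V)) hα ht).1
  have hm' : Integrable fun ξ : V => ‖ξ‖ * ‖heatSymbol (fun _ : V => (1:ℂ)) α t ξ‖ := by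
    refine hi.mono' (by have := hm.1; fun_prop) (ae_of_all _ fun ξ => ?_)
    rw [norm_mul, norm_norm, norm_norm]
    gcongr
    nlinarith [sq_nonneg (‖ξ‖ - 1)]
  obtain ⟨L, hL, hLe⟩ := hasFDerivAt_fourierInv hm hm' x
  refine ⟨Complex.reCLM.comp L, Complex.reCLM.hasFDerivAt.comp x hL, fun e => ?_⟩
  simp only [ContinuousLinearMap.comp_apply, hLe, heatKernel, Complex.reCLM_apply]
  congr 1
  refine congrArg (fun f : V → ℂ => (𝓕⁻ f : V → ℂ) x) (funext fun ξ => ?_)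
  simp [heatSymbol]

theorem hasFDerivAt_heatKernel_inner (hα : 0 < α) (ht : 0 < t) (e x : V) :
    ∃ L : V →L[ℝ] ℝ, HasFDerivAt
      (heatKernel (fun ξ : V => 2 * Real.pi * Complex.I * ((inner ℝ ξ e : ℝ) : ℂ)) α t) L x ∧
      L e = heatKernel (fun ξ : V => (2 * Real.pi * Complex.I * ((inner ℝ ξ e : ℝ) : ℂ)) ^
          2) α t x := by
  have hi := integrable_one_add_norm_sq_mul_heatSymbol (V := V) hα ht
  have hm := (integrable_heatSymbol (isHomogeneousSymbol_inner (V := V) e) hα ht).1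
  have hm' : Integrable fun ξ : V => ‖ξ‖ * ‖heatSymbol (fun ξ : V => 2 * Real.pi * Complex.I *
      ((inner ℝ ξ e : ℝ) : ℂ)) α t ξ‖ := by
    refine (hi.const_mul (2 * Real.pi * ‖e‖)).mono' (by have := hm.1; fun_prop)
      (ae_of_all _ fun ξ => ?_)
    rw [norm_mul, norm_norm, norm_norm]
    simp only [heatSymbol, norm_mul, one_mul, Complex.norm_I, mul_one, Complex.norm_real,
      Complex.norm_ofNat, Real.norm_of_nonneg Real.pi_pos.le]
    have h1 := norm_inner_le_norm (𝕜 := ℝ) ξ e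
    have h2 := Real.pi_pos
    calc ‖ξ‖ * (2 * Real.pi * ‖(inner ℝ ξ e : ℝ)‖ * ‖Real.exp (-(t * (2 * Real.pi * ‖ξ‖) ^ (2 * α)))‖)
        ≤ ‖ξ‖ * (2 * Real.pi * (‖ξ‖ * ‖e‖) * ‖Real.exp (-(t * (2 * Real.pi * ‖ξ‖) ^
            (2 * α)))‖) := by
          gcongr
      _ = 2 * Real.pi * ‖e‖ * (‖ξ‖ ^ 2 * ‖Real.exp (-(t * (2 * Real.pi * ‖ξ‖) ^
          (2 * α)))‖) := by ring
      _ ≤ _ := by gcongr; linarith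
  obtain ⟨L, hL, hLe⟩ := hasFDerivAt_fourierInv hm hm' x
  refine ⟨Complex.reCLM.comp L, Complex.reCLM.hasFDerivAt.comp x hL, ?_⟩
  simp only [ContinuousLinearMap.comp_apply, hLe, heatKernel, Complex.reCLM_apply]
  congr 1
  refine congrArg (fun f : V → ℂ => (𝓕⁻ f : V → ℂ) x) (funext fun ξ => ?_)
  simp [heatSymbol]
  ring

/-- The Laplacian is the trace of the second derivative in an orthonormal basis. Each direction e
multiplies the symbol by (2πi⟨ξ,e⟩)², and Parseval sums these factors to −(2π|ξ|)². -/
theorem laplacian_heatKernel (hα : 0 < α) (ht : 0 < t) (x : V) :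
    Laplacian.laplacian (heatKernel (fun _ : V => (1:ℂ)) α t) x =
      heatKernel (fun ξ : V => -(((2 * Real.pi * ‖ξ‖) ^ 2 : ℝ) : ℂ)) α t x := by
  set k : V → ℝ := heatKernel (fun _ : V => (1:ℂ)) α t with hk
  have hm := (integrable_heatSymbol (isHomogeneousSymbol_one (V := V)) hα ht).1
  have hi := integrable_one_add_norm_sq_mul_heatSymbol (V := V) hα ht
  have hcd : ContDiff ℝ 2 k := by
    refine Complex.reCLM.contDiff.comp ?_
    have h4 : (𝓕⁻ (heatSymbol (fun _ : V => (1:ℂ)) α t) : V → ℂ) =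
      fun x => 𝓕 (heatSymbol (fun _ : V => (1:ℂ)) α t) (-x) := by
      ext x; exact Real.fourierInv_eq_fourier_neg _ x
    rw [h4]
    refine ContDiff.comp (g := 𝓕 (heatSymbol (fun _ : V => (1:ℂ)) α t)) ?_ contDiff_neg
    refine Real.contDiff_fourier (N := 2) fun n hn => ?_
    refine hi.mono' (by have := hm.1; fun_prop) (ae_of_all _ fun ξ => ?_)
    rw [norm_mul, norm_norm, norm_pow, norm_norm]
    gcongr
    have hn' : n ≤ 2 := by exact_mod_cast hn
    interval_cases n
    · simp
    · nlinarith [sq_nonneg (‖ξ‖ - 1)]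
    · linarith
  rw [InnerProductSpace.laplacian_eq_iteratedFDeriv_stdOrthonormalBasis]
  have h1 : ∀ e : V, iteratedFDeriv ℝ 2 k x ![e, e] =
      heatKernel (fun ξ : V => (2 * Real.pi * Complex.I * ((inner ℝ ξ e : ℝ) : ℂ)) ^ 2) α t x := by
    intro e
    rw [iteratedFDeriv_two_apply]
    simp only [Matrix.cons_val_zero, Matrix.cons_val_one]
    have hd : DifferentiableAt ℝ (fderiv ℝ k) x :=
      ((hcd.fderiv_right (m := 1) (by norm_num)).differentiable (by norm_num)) x
    obtain ⟨L, hL, hLe⟩ := hasFDerivAt_heatKernel_inner hα ht e x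
    have h2 : (fun y => fderiv ℝ k y e) =
        heatKernel (fun ξ : V => 2 * Real.pi * Complex.I * ((inner ℝ ξ e : ℝ) : ℂ)) α t := by
      ext y
      obtain ⟨L', hL', hLe'⟩ := hasFDerivAt_heatKernel hα ht y
      rw [hL'.fderiv, hLe']
    have h3 : HasFDerivAt (fun y => fderiv ℝ k y e) ((fderiv ℝ (fderiv ℝ k) x).flip e) x := by
      simpa using hd.hasFDerivAt.clm_apply (hasFDerivAt_const e x)
    rw [h2] at h3
    rw [← hLe, hL.unique h3]
    rfl
  simp_rw [h1, heatKernel]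
  rw [← Complex.re_sum]
  congr 1
  have hint : ∀ e : V, Integrable (fun ξ : V => Real.fourierChar (inner ℝ ξ x) • heatSymbol
      (fun ξ : V => (2 * Real.pi * Complex.I * ((inner ℝ ξ e : ℝ) : ℂ)) ^ 2) α t ξ) := by
    intro e
    have hs : Continuous (heatSymbol (fun ξ : V => (2 * Real.pi * Complex.I *
        ((inner ℝ ξ e : ℝ) : ℂ)) ^ 2) α t) := by
      have h1 : Continuous fun ξ : V => (2 * Real.pi * ‖ξ‖) ^ (2 * α) :=
        Continuous.rpow_const (by fun_prop) (fun _ => Or.inr (by positivity))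
      unfold heatSymbol
      fun_prop
    have hc : Continuous fun ξ : V => Real.fourierChar (inner ℝ ξ x) :=
        Real.continuous_fourierChar.comp (by fun_prop)
    refine (hi.const_mul ((2 * Real.pi * ‖e‖) ^ 2)).mono' (hc.smul hs).aestronglyMeasurable
      (ae_of_all _ fun ξ => ?_)
    rw [Circle.norm_smul]
    simp only [heatSymbol, norm_mul, one_mul, Complex.norm_I, mul_one, Complex.norm_real, norm_pow,
      Complex.norm_ofNat, Real.norm_of_nonneg Real.pi_pos.le]
    have h1 := norm_inner_le_norm (𝕜 := ℝ) ξ e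
    have h2 := Real.pi_pos
    calc (2 * Real.pi * ‖(inner ℝ ξ e : ℝ)‖) ^ 2 * ‖Real.exp (-(t * (2 * Real.pi * ‖ξ‖) ^ (2 * α)))‖
        ≤ (2 * Real.pi * (‖ξ‖ * ‖e‖)) ^ 2 * ‖Real.exp (-(t * (2 * Real.pi * ‖ξ‖) ^ (2 * α)))‖ := by
          gcongr
      _ = (2 * Real.pi * ‖e‖) ^ 2 * (‖ξ‖ ^ 2 * ‖Real.exp
          (-(t * (2 * Real.pi * ‖ξ‖) ^ (2 * α)))‖) := by ring
      _ ≤ _ := by gcongr; linarith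
  simp_rw [Real.fourierInv_eq]
  rw [← integral_finsetSum _ (fun i _ => hint _)]
  congr 1
  ext ξ
  rw [← Finset.smul_sum]
  congr 1
  simp only [heatSymbol]
  rw [← Finset.sum_mul]
  congr 1
  have h5 := (stdOrthonormalBasis ℝ V).sum_sq_inner_left ξ
  simp_rw [mul_pow, Complex.I_sq]
  rw [← Finset.mul_sum]
  have h6 : ∑ i, ((inner ℝ ξ ((stdOrthonormalBasis ℝ V) i) : ℝ) : ℂ) ^ 2 = ((‖ξ‖ ^ 2 : ℝ) : ℂ) := by
    rw [← h5]; push_cast; rfl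
  rw [h6]
  push_cast
  ring

end kernelDerivatives

/-! ### The differential operators as Fourier multipliers -/

/-- The degree of the operator as a natural number. -/
def HigherOrderTerm.degree {n : ℕ} : HigherOrderTerm n → ℕ
  | .convection _ => 1
  | .laplacian => 2

theorem HigherOrderTerm.order_eq {n : ℕ} (P : HigherOrderTerm n) : P.order = P.degree := by
  cases P <;> simp [HigherOrderTerm.order, HigherOrderTerm.degree]

/-- The Fourier symbol of the operator. -/
noncomputable def HigherOrderTerm.symbol {n : ℕ} (P : HigherOrderTerm n) :
    EuclideanSpace ℝ (Fin n) → ℂ :=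
  match P with
  | .convection β => fun ξ => 2 * Real.pi * Complex.I * ((inner ℝ ξ β : ℝ) : ℂ)
  | .laplacian => fun ξ => -(((2 * Real.pi * ‖ξ‖) ^ 2 : ℝ) : ℂ)

theorem HigherOrderTerm.isHomogeneousSymbol {n : ℕ} (P : HigherOrderTerm n) :
    IsHomogeneousSymbol P.symbol P.degree := by
  cases P with
  | convection β => exact isHomogeneousSymbol_inner β
  | laplacian => exact isHomogeneousSymbol_neg isHomogeneousSymbol_norm_sq

theorem dissipativeKernel_eq {n : ℕ} (α t : ℝ) :
    dissipativeKernel n α t = heatKernel (fun _ => (1:ℂ)) α t := by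
  ext x
  unfold dissipativeKernel heatKernel
  congr 1
  refine congrArg (fun f : EuclideanSpace ℝ (Fin n) → ℂ => (𝓕⁻ f : EuclideanSpace ℝ (Fin n) → ℂ) x)
      (funext fun ξ => ?_)
  simp [heatSymbol]

theorem HigherOrderTerm.apply_dissipativeKernel {n : ℕ} [NeZero n] (P : HigherOrderTerm n)
    {α t : ℝ} (hα : 0 < α) (ht : 0 < t) :
    P.apply (dissipativeKernel n α t) = heatKernel P.symbol α t := by
  rw [dissipativeKernel_eq]
  ext x
  cases P with
  | convection β =>
    obtain ⟨L, hL, hLe⟩ := hasFDerivAt_heatKernel hα ht x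
    exact (hL.hasLineDerivAt β).lineDeriv.trans (hLe β)
  | laplacian => exact laplacian_heatKernel hα ht x

/-! ### Young's inequality for bounded integrable kernels -/

/-- `k` is an integrable kernel with `‖k‖_{L¹} ≤ A` and `|k| ≤ B`. -/
structure KernelBound {V : Type*} [MeasureSpace V] (k : V → ℝ) (A B : ℝ) : Prop where
  integrable : Integrable k
  integral_le : ∫ x, |k x| ≤ A
  abs_le : ∀ x, |k x| ≤ B

section convolution

variable {V : Type*} [NormedAddCommGroup V] [InnerProductSpace ℝ V] [FiniteDimensional ℝ V]
  [MeasurableSpace V] [BorelSpace V] {F : Type*} [NormedAddCommGroup F]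
  {k : V → ℝ} {A B : ℝ} {g : V → F}

theorem KernelBound.lintegral_le (hk : KernelBound k A B) : ∫⁻ y, ‖k y‖ₑ ≤ ENNReal.ofReal A := by
  rw [← ofReal_integral_norm_eq_lintegral_enorm hk.integrable]
  exact ENNReal.ofReal_le_ofReal hk.integral_le

theorem KernelBound.enorm_le (hk : KernelBound k A B) (y : V) : ‖k y‖ₑ ≤ ENNReal.ofReal B := by
  rw [← ofReal_norm]
  exact ENNReal.ofReal_le_ofReal (hk.abs_le y)

theorem aemeasurable_enorm_sub (hg : AEStronglyMeasurable g volume) (x : V) :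
    AEMeasurable (fun y => ‖g (x - y)‖ₑ) :=
  (hg.comp_quasiMeasurePreserving (quasiMeasurePreserving_sub_left volume x)).enorm

/-- Hölder's inequality for the measure |k(y)| dy, with the kernel split as |k|^(1−1/s) |k|^(1/s).
-/
theorem lintegral_convolution_rpow_le {s : ℝ} (hs : 1 ≤ s) (hk : AEStronglyMeasurable k volume)
    (hg : AEStronglyMeasurable g volume) (x : V) :
    (∫⁻ y, ‖k y‖ₑ * ‖g (x - y)‖ₑ) ^ s ≤
      (∫⁻ y, ‖k y‖ₑ) ^ (s - 1) * ∫⁻ y, ‖k y‖ₑ * ‖g (x - y)‖ₑ ^ s := by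
  have hs0 : 0 < s := by linarith
  have hgx := aemeasurable_enorm_sub hg x
  have h := ENNReal.lintegral_mul_norm_pow_le (μ := volume) (f := fun y => ‖k y‖ₑ)
    (g := fun y => ‖k y‖ₑ * ‖g (x - y)‖ₑ ^ s) hk.enorm (hk.enorm.mul (hgx.pow_const s))
    (p := 1 - 1 / s) (q := 1 / s) (by rw [sub_nonneg, div_le_one hs0]; exact hs) (by positivity)
    (by ring)
  have h2 : ∀ y, ‖k y‖ₑ ^ (1 - 1 / s) * (‖k y‖ₑ * ‖g (x - y)‖ₑ ^ s) ^ (1 / s) =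
      ‖k y‖ₑ * ‖g (x - y)‖ₑ := by
    intro y
    rw [ENNReal.mul_rpow_of_nonneg _ _ (by positivity), ← mul_assoc, ← ENNReal.rpow_mul,
      mul_one_div_cancel hs0.ne', ENNReal.rpow_one,
      ← ENNReal.rpow_add_of_nonneg _ _ (by rw [sub_nonneg, div_le_one hs0]; exact hs)
          (by positivity)]
    simp
  simp_rw [h2] at h
  refine (ENNReal.rpow_le_rpow h hs0.le).trans (le_of_eq ?_)
  rw [ENNReal.mul_rpow_of_nonneg _ _ hs0.le, ← ENNReal.rpow_mul, ← ENNReal.rpow_mul,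
    one_div_mul_cancel hs0.ne', ENNReal.rpow_one]
  congr 2
  field_simp

theorem lintegral_enorm_mul_rpow_sub_le {s : ℝ} (hk : KernelBound k A B) (x : V) :
    ∫⁻ y, ‖k y‖ₑ * ‖g (x - y)‖ₑ ^ s ≤ ENNReal.ofReal B * ∫⁻ y, ‖g y‖ₑ ^ s := by
  calc ∫⁻ y, ‖k y‖ₑ * ‖g (x - y)‖ₑ ^ s ≤ ∫⁻ y, ENNReal.ofReal B * ‖g (x - y)‖ₑ ^ s := by
        gcongr with y; exact hk.enorm_le y
    _ = ENNReal.ofReal B * ∫⁻ y, ‖g y‖ₑ ^ s := by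
        rw [lintegral_const_mul' _ _ ENNReal.ofReal_ne_top,
          lintegral_sub_left_eq_self (fun y => ‖g y‖ₑ ^ s) x]

theorem aemeasurable_prod_convolution {s : ℝ} (hk : AEStronglyMeasurable k volume)
    (hg : AEStronglyMeasurable g volume) :
    AEMeasurable (fun z : V × V => ‖k z.2‖ₑ * ‖g (z.1 - z.2)‖ₑ ^ s) (volume.prod volume) := by
  have h1 : AEStronglyMeasurable (fun z : V × V => g (z.1 - z.2)) (volume.prod volume) :=
    hg.comp_quasiMeasurePreserving (quasiMeasurePreserving_sub_of_right_invariant volume volume)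
  exact hk.comp_snd.enorm.mul (h1.enorm.pow_const s)

theorem lintegral_lintegral_convolution {s : ℝ} (hk : AEStronglyMeasurable k volume)
    (hg : AEStronglyMeasurable g volume) :
    ∫⁻ x, ∫⁻ y, ‖k y‖ₑ * ‖g (x - y)‖ₑ ^ s = (∫⁻ y, ‖k y‖ₑ) * ∫⁻ y, ‖g y‖ₑ ^ s := by
  rw [lintegral_lintegral_swap (aemeasurable_prod_convolution hk hg)]
  have h : ∀ y, ∫⁻ x, ‖k y‖ₑ * ‖g (x - y)‖ₑ ^ s = ‖k y‖ₑ * ∫⁻ y, ‖g y‖ₑ ^ s := by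
    intro y
    rw [lintegral_const_mul' _ _ enorm_ne_top, lintegral_sub_right_eq_self (fun y => ‖g y‖ₑ ^ s) y]
  simp_rw [h]
  rw [lintegral_mul_const'' _ hk.enorm]

/-- Boundedness of k, on top of integrability, makes the convolution converge at every x and not
only almost everywhere. -/
theorem lintegral_convolution_lt_top (hk : KernelBound k A B) {s : ℝ≥0∞} (hs : 1 ≤ s) (hs' : s ≠ ⊤)
    (hg : MemLp g s) (x : V) : ∫⁻ y, ‖k y‖ₑ * ‖g (x - y)‖ₑ < ⊤ := by
  have hs1 : 1 ≤ s.toReal := by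
    rw [← ENNReal.toReal_one]; exact ENNReal.toReal_mono hs' hs
  have hG := hg.eLpNorm_lt_top
  have hG' : ∫⁻ y, ‖g y‖ₑ ^ s.toReal < ⊤ :=
    lintegral_rpow_enorm_lt_top_of_eLpNorm_lt_top (by positivity) hs' hG
  have h := (lintegral_convolution_rpow_le hs1 hk.integrable.1 hg.1 x).trans
    (mul_le_mul' (ENNReal.rpow_le_rpow hk.lintegral_le (by linarith))
      (lintegral_enorm_mul_rpow_sub_le hk x))
  have h3 : (∫⁻ y, ‖k y‖ₑ * ‖g (x - y)‖ₑ) ^ s.toReal < ⊤ :=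
    h.trans_lt (ENNReal.mul_lt_top (ENNReal.rpow_lt_top_of_nonneg (by linarith)
      ENNReal.ofReal_ne_top) (ENNReal.mul_lt_top ENNReal.ofReal_lt_top hG'))
  rwa [ENNReal.rpow_lt_top_iff_of_pos (by linarith)] at h3

variable [NormedSpace ℝ F]

theorem KernelBound.convolutionExists (hk : KernelBound k A B) {s : ℝ≥0∞} (hs : 1 ≤ s) (hs' : s ≠ ⊤)
    (hg : MemLp g s) : ConvolutionExists k g (ContinuousLinearMap.lsmul ℝ ℝ) volume := by
  intro x
  refine ⟨?_, ?_⟩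
  · exact (hk.integrable.1.smul (hg.1.comp_quasiMeasurePreserving
      (quasiMeasurePreserving_sub_left volume x)))
  · refine lt_of_eq_of_lt ?_ (lintegral_convolution_lt_top hk hs hs' hg x)
    refine lintegral_congr fun y => ?_
    simp [enorm_smul]

theorem enorm_convolution_le (x : V) :
    ‖convolution k g (ContinuousLinearMap.lsmul ℝ ℝ) volume x‖ₑ ≤
      ∫⁻ y, ‖k y‖ₑ * ‖g (x - y)‖ₑ := by
  refine (enorm_integral_le_lintegral_enorm _).trans (le_of_eq ?_)
  refine lintegral_congr fun y => ?_
  simp [enorm_smul]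

theorem aestronglyMeasurable_convolution (hk : AEStronglyMeasurable k volume)
    (hg : AEStronglyMeasurable g volume) :
    AEStronglyMeasurable (convolution k g (ContinuousLinearMap.lsmul ℝ ℝ) volume) volume :=
  (hk.convolution_integrand (ContinuousLinearMap.lsmul ℝ ℝ) hg).integral_prod_right'

/-- Young's inequality for a bounded integrable kernel. -/
theorem eLpNorm_convolution_le (hk : KernelBound k A B) {s e : ℝ≥0∞} (hs : 1 ≤ s) (hse : s ≤ e)
    (he : e ≠ ⊤) (hg : MemLp g s) :
    eLpNorm (convolution k g (ContinuousLinearMap.lsmul ℝ ℝ) volume) e volume ≤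
      ENNReal.ofReal (A ^ (1 - (1 / s.toReal - 1 / e.toReal)) *
        B ^ (1 / s.toReal - 1 / e.toReal)) * eLpNorm g s volume := by
  have hs' : s ≠ ⊤ := ne_top_of_le_ne_top he hse
  have hs1 : 1 ≤ s.toReal := by
    rw [← ENNReal.toReal_one]; exact ENNReal.toReal_mono hs' hs
  have hse' : s.toReal ≤ e.toReal := ENNReal.toReal_mono he hse
  have hs0 : s ≠ 0 := (one_pos.trans_le hs).ne'
  have he0 : e ≠ 0 := (one_pos.trans_le (hs.trans hse)).ne'
  set σ := s.toReal
  set ε := e.toReal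
  have hσ : 0 < σ := by linarith
  have hε : 0 < ε := by linarith
  have hA0 : 0 ≤ A := (integral_nonneg fun _ => abs_nonneg _).trans hk.integral_le
  have hB0 : 0 ≤ B := (abs_nonneg _).trans (hk.abs_le 0)
  set θ := 1 / σ - 1 / ε with hθ
  have hθ0 : 0 ≤ θ := by rw [hθ, sub_nonneg]; exact one_div_le_one_div_of_le hσ hse'
  have hθ1 : 0 ≤ 1 - θ := by
    have : 1 / σ ≤ 1 := by rw [div_le_one hσ]; exact hs1
    have : 0 ≤ 1 / ε := by positivity
    linarith
  set G := ∫⁻ y, ‖g y‖ₑ ^ σ with hGdef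
  set J : V → ℝ≥0∞ := fun x => ∫⁻ y, ‖k y‖ₑ * ‖g (x - y)‖ₑ ^ σ
  set a := ENNReal.ofReal A
  set b := ENNReal.ofReal B
  have hes : 0 ≤ ε / σ - 1 := by rw [sub_nonneg, le_div_iff₀ hσ]; linarith
  -- The L^σ bound is raised to the power ε/σ. All but one of the resulting factors J(x) are
  -- replaced by their supremum bound b·G; the last one is kept and integrated by Tonelli.
  have hpt : ∀ x, ‖convolution k g (ContinuousLinearMap.lsmul ℝ ℝ) volume x‖ₑ ^ ε ≤
      (a ^ (σ - 1)) ^ (ε / σ) * (b * G) ^ (ε / σ - 1) * J x := by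
    intro x
    calc ‖convolution k g (ContinuousLinearMap.lsmul ℝ ℝ) volume x‖ₑ ^ ε
        ≤ (∫⁻ y, ‖k y‖ₑ * ‖g (x - y)‖ₑ) ^ ε :=
          ENNReal.rpow_le_rpow (enorm_convolution_le x) hε.le
      _ = ((∫⁻ y, ‖k y‖ₑ * ‖g (x - y)‖ₑ) ^ σ) ^ (ε / σ) := by
          rw [← ENNReal.rpow_mul]; congr 1; field_simp
      _ ≤ (a ^ (σ - 1) * J x) ^ (ε / σ) := by
          refine ENNReal.rpow_le_rpow ?_ (by positivity)
          refine (lintegral_convolution_rpow_le hs1 hk.integrable.1 hg.1 x).trans ?_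
          exact mul_le_mul' (ENNReal.rpow_le_rpow hk.lintegral_le (by linarith)) le_rfl
      _ = (a ^ (σ - 1)) ^ (ε / σ) * (J x ^ (ε / σ - 1) * J x) := by
          rw [ENNReal.mul_rpow_of_nonneg _ _ (by positivity)]
          congr 1
          conv_rhs => rw [← ENNReal.rpow_one (J x), ← ENNReal.rpow_mul,
            ← ENNReal.rpow_add_of_nonneg _ _ (by linarith) zero_le_one]
          congr 1; ring
      _ ≤ (a ^ (σ - 1)) ^ (ε / σ) * ((b * G) ^ (ε / σ - 1) * J x) := by
          gcongr
          exact lintegral_enorm_mul_rpow_sub_le hk x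
      _ = _ := by ring
  rw [eLpNorm_eq_lintegral_rpow_enorm_toReal he0 he, eLpNorm_eq_lintegral_rpow_enorm_toReal hs0 hs']
  have hG' : G < ⊤ := lintegral_rpow_enorm_lt_top_of_eLpNorm_lt_top hs0 hs' hg.eLpNorm_lt_top
  have hint : ∫⁻ x, ‖convolution k g (ContinuousLinearMap.lsmul ℝ ℝ) volume x‖ₑ ^ ε ≤
      (a ^ (σ - 1)) ^ (ε / σ) * (b * G) ^ (ε / σ - 1) * (a * G) := by
    refine (lintegral_mono hpt).trans ?_
    rw [lintegral_const_mul']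
    · gcongr
      change ∫⁻ x, ∫⁻ y, ‖k y‖ₑ * ‖g (x - y)‖ₑ ^ σ ≤ a * G
      rw [lintegral_lintegral_convolution hk.integrable.1 hg.1]
      gcongr
      exact hk.lintegral_le
    · refine ENNReal.mul_ne_top ?_ ?_
      · exact ENNReal.rpow_ne_top_of_nonneg (by positivity)
          (ENNReal.rpow_ne_top_of_nonneg (by linarith) ENNReal.ofReal_ne_top)
      · exact ENNReal.rpow_ne_top_of_nonneg hes (ENNReal.mul_ne_top ENNReal.ofReal_ne_top hG'.ne)
  refine (ENNReal.rpow_le_rpow hint (by positivity)).trans (le_of_eq ?_)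
  rw [ENNReal.ofReal_mul (by positivity), ← ENNReal.ofReal_rpow_of_nonneg hA0 hθ1,
    ← ENNReal.ofReal_rpow_of_nonneg hB0 hθ0]
  have hε' : 0 ≤ 1 / ε := by positivity
  rw [ENNReal.mul_rpow_of_nonneg _ _ hε', ENNReal.mul_rpow_of_nonneg _ _ hε',
    ENNReal.mul_rpow_of_nonneg _ _ hε', ENNReal.mul_rpow_of_nonneg _ _ hes,
    ENNReal.mul_rpow_of_nonneg _ _ hε']
  change _ = a ^ (1 - θ) * b ^ θ * G ^ (1 / σ)
  simp only [← ENNReal.rpow_mul]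
  have e1 : (σ - 1) * (ε / σ * (1 / ε)) = 1 - 1 / σ := by field_simp
  have e2 : (ε / σ - 1) * (1 / ε) = θ := by rw [hθ]; field_simp
  have e3 : 1 - θ = (1 - 1 / σ) + 1 / ε := by rw [hθ]; ring
  have e4 : 1 / σ = θ + 1 / ε := by rw [hθ]; ring
  have hσ1 : 0 ≤ 1 - 1 / σ := by rw [sub_nonneg, div_le_one hσ]; exact hs1
  have e5 : G ^ (1 / σ) = G ^ θ * G ^ (1 / ε) := by
    rw [e4, ENNReal.rpow_add_of_nonneg _ _ hθ0 hε']
  rw [mul_assoc (σ - 1), e1, e2, e3, ENNReal.rpow_add_of_nonneg _ _ hσ1 hε', e5]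
  ring

end convolution

/-! ### Convolution operators on Lebesgue spaces and approximate identities -/

section convolutionOperator

variable {V : Type*} [NormedAddCommGroup V] [InnerProductSpace ℝ V] [FiniteDimensional ℝ V]
  [MeasurableSpace V] [BorelSpace V] {F : Type*} [NormedAddCommGroup F]
  {k : V → ℝ} {A B : ℝ} {g : V → F}

theorem continuous_translate {s : ℝ≥0∞} [Fact (1 ≤ s)] (hs : s ≠ ⊤)
    (g : Lp F s (volume : Measure V)) :
    Continuous fun y : V => Lp.compMeasurePreserving (fun x => x - y)
      (measurePreserving_sub_right volume y) g := by
  let φ : C(V, C(V, V)) := (ContinuousMap.mk (fun z : V × V => z.2 - z.1) (by fun_prop)).curry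
  exact Continuous.compMeasurePreservingLp (f := fun _ : V => g) (g := fun y => φ y)
    continuous_const φ.continuous (fun y => measurePreserving_sub_right volume y) hs

variable [NormedSpace ℝ F]

theorem convolution_congr_ae_right {g g' : V → F} (h : g =ᵐ[volume] g') :
    convolution k g (ContinuousLinearMap.lsmul ℝ ℝ) volume =
      convolution k g' (ContinuousLinearMap.lsmul ℝ ℝ) volume := by
  ext x
  refine integral_congr_ae ?_
  filter_upwards [(quasiMeasurePreserving_sub_left volume x).ae_eq_comp h] with y hy
  simp only [Function.comp] at hy
  rw [hy]

theorem KernelBound.nonneg (hk : KernelBound k A B) : 0 ≤ A ∧ 0 ≤ B :=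
  ⟨(integral_nonneg fun _ => abs_nonneg _).trans hk.integral_le, (abs_nonneg _).trans (hk.abs_le 0)⟩

theorem memLp_convolution (hk : KernelBound k A B) {s e : ℝ≥0∞} (hs : 1 ≤ s) (hse : s ≤ e)
    (he : e ≠ ⊤) (hg : MemLp g s) :
    MemLp (convolution k g (ContinuousLinearMap.lsmul ℝ ℝ) volume) e :=
  ⟨aestronglyMeasurable_convolution hk.integrable.1 hg.1,
    (eLpNorm_convolution_le hk hs hse he hg).trans_lt
      (ENNReal.mul_lt_top ENNReal.ofReal_lt_top hg.eLpNorm_lt_top)⟩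

theorem exists_convolution_clm (hk : KernelBound k A B) {s e : ℝ≥0∞} [hs : Fact (1 ≤ s)]
    [Fact (1 ≤ e)] (hse : s ≤ e) (he : e ≠ ⊤) :
    ∃ Φ : Lp F s (volume : Measure V) →L[ℝ] Lp F e (volume : Measure V),
      (∀ g, Φ g =ᵐ[volume] convolution k g (ContinuousLinearMap.lsmul ℝ ℝ) volume) ∧
      ∀ g, ‖Φ g‖ ≤ A ^ (1 - (1 / s.toReal - 1 / e.toReal)) *
        B ^ (1 / s.toReal - 1 / e.toReal) * ‖g‖ := by
  have hs' : s ≠ ⊤ := ne_top_of_le_ne_top he hse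
  have hm : ∀ g : Lp F s (volume : Measure V),
      MemLp (convolution k g (ContinuousLinearMap.lsmul ℝ ℝ) volume) e := fun g =>
    memLp_convolution hk hs.out hse he (Lp.memLp g)
  have hex : ∀ g : Lp F s (volume : Measure V),
      ConvolutionExists k g (ContinuousLinearMap.lsmul ℝ ℝ) volume := fun g =>
    hk.convolutionExists hs.out hs' (Lp.memLp g)
  let L : Lp F s (volume : Measure V) →ₗ[ℝ] Lp F e (volume : Measure V) :=
    { toFun := fun g => (hm g).toLp _
      map_add' := fun g g' => by
        rw [← MemLp.toLp_add]
        refine MemLp.toLp_congr _ _ (ae_of_all _ fun x => ?_)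
        rw [convolution_congr_ae_right (Lp.coeFn_add g g'),
          (hex g).distrib_add (hex g')]
      map_smul' := fun c g => by
        rw [RingHom.id_apply, ← MemLp.toLp_const_smul]
        refine MemLp.toLp_congr _ _ (ae_of_all _ fun x => ?_)
        rw [convolution_congr_ae_right (Lp.coeFn_smul c g), convolution_smul] }
  have hb : ∀ g, ‖L g‖ ≤ A ^ (1 - (1 / s.toReal - 1 / e.toReal)) *
      B ^ (1 / s.toReal - 1 / e.toReal) * ‖g‖ := by
    intro g
    have h := eLpNorm_convolution_le hk hs.out hse he (Lp.memLp g)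
    have hC : 0 ≤ A ^ (1 - (1 / s.toReal - 1 / e.toReal)) * B ^ (1 / s.toReal - 1 / e.toReal) :=
      mul_nonneg (Real.rpow_nonneg hk.nonneg.1 _) (Real.rpow_nonneg hk.nonneg.2 _)
    change ‖(hm g).toLp _‖ ≤ _
    rw [Lp.norm_toLp, Lp.norm_def, ← ENNReal.toReal_ofReal hC, ← ENNReal.toReal_mul]
    exact ENNReal.toReal_mono (ENNReal.mul_ne_top ENNReal.ofReal_ne_top (Lp.eLpNorm_ne_top g)) h
  exact ⟨L.mkContinuous _ hb, fun g => MemLp.coeFn_toLp (hm g), hb⟩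

/-- Associativity of convolution with bounded integrable kernels. -/
theorem convolution_convolution_kernel [CompleteSpace F] {k' : V → ℝ} {A' B' : ℝ}
    (hk : KernelBound k A B)
    (hk' : KernelBound k' A' B') {s : ℝ≥0∞} (hs : 1 ≤ s) (hs' : s ≠ ⊤) (hg : MemLp g s) (x : V) :
    convolution k (convolution k' g (ContinuousLinearMap.lsmul ℝ ℝ) volume)
      (ContinuousLinearMap.lsmul ℝ ℝ) volume x =
    convolution (convolution k k' (ContinuousLinearMap.lsmul ℝ ℝ) volume) g
      (ContinuousLinearMap.lsmul ℝ ℝ) volume x := by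
  have hkn : KernelBound (fun x => ‖k x‖) A B := ⟨hk.integrable.norm, by simpa using hk.integral_le,
    by simpa using hk.abs_le⟩
  have hkn' : KernelBound (fun x => ‖k' x‖) A' B' := ⟨hk'.integrable.norm, by simpa using
      hk'.integral_le,
    by simpa using hk'.abs_le⟩
  symm
  refine convolution_assoc (𝕜 := ℝ) _ _ _ _ (fun x y z => ?_) hk.integrable.1
      hk'.integrable.1 hg.1 ?_ ?_ ?_
  · simp [smul_smul, mul_comm]
  · exact ae_of_all _ (hk.convolutionExists le_rfl (by simp)
      (memLp_one_iff_integrable.2 hk'.integrable))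
  · refine ae_of_all _ fun y => ?_
    have := hkn'.convolutionExists hs hs' hg.norm y
    exact this
  · have h := hkn.convolutionExists hs hs'
      (memLp_convolution hkn' hs le_rfl hs' hg.norm) x
    exact h

/-- Approximate identities obtained by dilation converge strongly in `L^s`, `s < ∞`. -/
theorem tendsto_eLpNorm_convolution_dilation_sub [CompleteSpace F] (hk : KernelBound k A B)
    (hkcont : Continuous k) (hk1 : ∫ x, k x = 1) {s : ℝ≥0∞} [hs1 : Fact (1 ≤ s)] (hs : s ≠ ⊤)
    (g : Lp F s (volume : Measure V)) {ι : Type*} {l : Filter ι} [l.IsCountablyGenerated]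
    {c : ι → ℝ} (hc : ∀ i, 0 < c i) (hcl : Tendsto c l atTop) :
    Tendsto (fun i => eLpNorm (fun x => convolution
      (fun y => c i ^ (Module.finrank ℝ V) * k (c i • y)) g (ContinuousLinearMap.lsmul ℝ ℝ) volume x
        - g x) s volume) l (𝓝 0) := by
  have hsσ : 1 ≤ s.toReal := by
    rw [← ENNReal.toReal_one]; exact ENNReal.toReal_mono hs hs1.out
  have hs0 : s ≠ 0 := (one_pos.trans_le hs1.out).ne'
  set σ := s.toReal
  have hσ0 : 0 < σ := by linarith
  set n := Module.finrank ℝ V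
  set τ : V → Lp F s (volume : Measure V) := fun y => Lp.compMeasurePreserving (fun x => x - y)
      (measurePreserving_sub_right volume y) g with hτ
  have hτc : Continuous τ := continuous_translate hs g
  -- ω(y) is the s-th power of the L^s distance between g and its translate by y: continuous,
  -- bounded, and zero at 0. The error of the approximate identity is bounded by the mean of ω
  -- against the dilated kernel.
  set ω : V → ℝ≥0∞ := fun y => ‖τ y - g‖ₑ ^ σ with hω
  have hωc : Continuous ω := (ENNReal.continuous_rpow_const).comp (by fun_prop)
  have hτ0 : τ 0 = g := by
    refine Lp.ext ((Lp.coeFn_compMeasurePreserving g _).trans (ae_of_all _ fun x => ?_))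
    simp
  have hω0 : ω 0 = 0 := by simp only [hω, hτ0, sub_self, enorm_zero]; exact
      ENNReal.zero_rpow_of_pos hσ0
  have hωb : ∀ y, ω y ≤ ENNReal.ofReal ((2 * ‖g‖) ^ σ) := by
    intro y
    simp only [hω]
    rw [← ENNReal.ofReal_rpow_of_nonneg (by positivity) hσ0.le, ← ofReal_norm]
    gcongr
    calc ‖τ y - g‖ ≤ ‖τ y‖ + ‖g‖ := norm_sub_le _ _
      _ = 2 * ‖g‖ := by rw [hτ]; simp only [Lp.norm_compMeasurePreserving]; ring
  have hωint : ∀ y, ∫⁻ x, ‖g (x - y) - g x‖ₑ ^ σ = ω y := by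
    intro y
    have h1 : ‖τ y - g‖ₑ = eLpNorm (fun x => g (x - y) - g x) s volume := by
      rw [Lp.enorm_def]
      refine eLpNorm_congr_ae ?_
      filter_upwards [Lp.coeFn_sub (τ y) g, Lp.coeFn_compMeasurePreserving g
        (measurePreserving_sub_right volume y)] with x hx hx'
      rw [hx, Pi.sub_apply, hx']
      rfl
    simp only [hω]
    rw [h1, eLpNorm_eq_lintegral_rpow_enorm_toReal hs0 hs, ← ENNReal.rpow_mul,
      one_div_mul_cancel hσ0.ne', ENNReal.rpow_one]
  have hkc : ∀ i, KernelBound (fun y => c i ^ n * k (c i • y)) A (c i ^ n * B) := by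
    intro i
    have hci := hc i
    refine ⟨(hk.integrable.comp_smul hci.ne').const_mul _, ?_, fun x => ?_⟩
    · simp_rw [abs_mul, abs_of_pos (pow_pos hci n)]
      rw [integral_const_mul, Measure.integral_comp_smul (volume : Measure V) (fun x => |k x|),
        abs_of_pos (by positivity), smul_eq_mul, ← mul_assoc, mul_inv_cancel₀ (by positivity),
        one_mul]
      exact hk.integral_le
    · rw [abs_mul, abs_of_pos (pow_pos hci n)]
      gcongr
      exact hk.abs_le _
  have hint1 : ∀ i, ∫ y, c i ^ n * k (c i • y) = 1 := by
    intro i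
    have hci := hc i
    rw [integral_const_mul, Measure.integral_comp_smul (volume : Measure V) k,
        abs_of_pos (by positivity), smul_eq_mul, ← mul_assoc, mul_inv_cancel₀ (by positivity),
        one_mul, hk1]
  have hlint : ∀ i, ∫⁻ y, ‖c i ^ n * k (c i • y)‖ₑ * ω y = ∫⁻ z, ‖k z‖ₑ * ω ((c i)⁻¹ • z) := by
    intro i
    have hci := hc i
    have h : ∫⁻ y, ‖k (c i • y)‖ₑ * ω ((c i)⁻¹ • c i • y) =
        ENNReal.ofReal (c i ^ n)⁻¹ * ∫⁻ z, ‖k z‖ₑ * ω ((c i)⁻¹ • z) := by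
      have h0 := (Homeomorph.smulOfNeZero (c i) hci.ne').measurableEmbedding.lintegral_map
        (μ := (volume : Measure V)) (fun z => ‖k z‖ₑ * ω ((c i)⁻¹ • z))
      have h1 := Measure.map_addHaar_smul (volume : Measure V) hci.ne'
      rw [abs_of_pos (by positivity)] at h1
      change ∫⁻ z, ‖k z‖ₑ * ω ((c i)⁻¹ • z) ∂(Measure.map (c i • ·) volume) = _ at h0
      rw [h1, lintegral_smul_measure] at h0
      exact h0.symm
    have h2 : ∀ y, ‖c i ^ n * k (c i • y)‖ₑ * ω y =
        ENNReal.ofReal (c i ^ n) * (‖k (c i • y)‖ₑ * ω ((c i)⁻¹ • c i • y)) := by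
      intro y
      rw [smul_smul, inv_mul_cancel₀ hci.ne', one_smul, enorm_mul, mul_assoc,
        Real.enorm_of_nonneg (by positivity)]
    simp_rw [h2]
    rw [lintegral_const_mul' _ _ ENNReal.ofReal_ne_top, h, ← mul_assoc, ← ENNReal.ofReal_mul
        (by positivity),
      mul_inv_cancel₀ (by positivity)]
    simp
  have hptw : ∀ i x, ‖convolution (fun y => c i ^ n * k (c i • y)) g
      (ContinuousLinearMap.lsmul ℝ ℝ) volume x - g x‖ₑ ≤
        ∫⁻ y, ‖c i ^ n * k (c i • y)‖ₑ * ‖g (x - y) - g x‖ₑ := by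
    intro i x
    have hex := (hkc i).convolutionExists hs1.out hs (Lp.memLp g) x
    have h1 : convolution (fun y => c i ^ n * k (c i • y)) g
      (ContinuousLinearMap.lsmul ℝ ℝ) volume x - g x =
        ∫ y, (c i ^ n * k (c i • y)) • (g (x - y) - g x) := by
      simp_rw [smul_sub]
      rw [integral_sub]
      · rw [integral_smul_const, hint1, one_smul]
        rfl
      · exact hex
      · exact (hkc i).integrable.smul_const _
    rw [h1]
    refine (enorm_integral_le_lintegral_enorm _).trans (le_of_eq ?_)
    simp_rw [enorm_smul]
  have hmain : ∀ i, ∫⁻ x, ‖convolution (fun y => c i ^ n * k (c i • y)) g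
      (ContinuousLinearMap.lsmul ℝ ℝ) volume x - g x‖ₑ ^ σ ≤
        ENNReal.ofReal A ^ (σ - 1) * ∫⁻ z, ‖k z‖ₑ * ω ((c i)⁻¹ • z) := by
    intro i
    have hki := (hkc i).integrable.1
    have hgm := (Lp.memLp g).1
    have hJ : ∀ x, (∫⁻ y, ‖c i ^ n * k (c i • y)‖ₑ * ‖g (x - y) - g x‖ₑ) ^ σ ≤
        ENNReal.ofReal A ^ (σ - 1) *
          ∫⁻ y, ‖c i ^ n * k (c i • y)‖ₑ * ‖g (x - y) - g x‖ₑ ^ σ := by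
      intro x
      have hgx : AEStronglyMeasurable (fun z => g z - g x) volume :=
        hgm.sub aestronglyMeasurable_const
      refine (lintegral_convolution_rpow_le (g := fun z => g z - g x) hsσ hki hgx x).trans ?_
      gcongr
      exact (hkc i).lintegral_le
    calc _ ≤ ∫⁻ x, ENNReal.ofReal A ^ (σ - 1) *
          ∫⁻ y, ‖c i ^ n * k (c i • y)‖ₑ * ‖g (x - y) - g x‖ₑ ^ σ :=
          lintegral_mono fun x => (ENNReal.rpow_le_rpow (hptw i x) hσ0.le).trans (hJ x)
      _ = ENNReal.ofReal A ^ (σ - 1) *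
          ∫⁻ x, ∫⁻ y, ‖c i ^ n * k (c i • y)‖ₑ * ‖g (x - y) - g x‖ₑ ^ σ := by
          rw [lintegral_const_mul']
          exact ENNReal.rpow_ne_top_of_nonneg (by linarith) ENNReal.ofReal_ne_top
      _ = ENNReal.ofReal A ^ (σ - 1) *
          ∫⁻ y, ∫⁻ x, ‖c i ^ n * k (c i • y)‖ₑ * ‖g (x - y) - g x‖ₑ ^ σ := by
          rw [lintegral_lintegral_swap]
          have h1 : AEStronglyMeasurable (fun z : V × V => g (z.1 - z.2)) (volume.prod volume) :=
            hgm.comp_quasiMeasurePreserving (quasiMeasurePreserving_sub_of_right_invariant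
                volume volume)
          exact hki.comp_snd.enorm.mul ((h1.sub hgm.comp_fst).enorm.pow_const σ)
      _ = ENNReal.ofReal A ^ (σ - 1) * ∫⁻ y, ‖c i ^ n * k (c i • y)‖ₑ * ω y := by
          congr 1
          refine lintegral_congr fun y => ?_
          rw [lintegral_const_mul' _ _ enorm_ne_top, hωint]
      _ = _ := by rw [hlint]
  -- In the rescaled variable the kernel is fixed and the argument of ω shrinks to 0, so dominated
  -- convergence applies.
  have hlim : Tendsto (fun i => ∫⁻ z, ‖k z‖ₑ * ω ((c i)⁻¹ • z)) l (𝓝 0) := by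
    have h := tendsto_lintegral_filter_of_dominated_convergence (μ := volume) (l := l)
      (F := fun i z => ‖k z‖ₑ * ω ((c i)⁻¹ • z)) (f := fun _ => 0)
      (fun z => ‖k z‖ₑ * ENNReal.ofReal ((2 * ‖g‖) ^ σ)) ?_ ?_ ?_ ?_
    · simpa using h
    · exact Eventually.of_forall fun i => hkcont.measurable.enorm.mul
        (hωc.comp (continuous_const_smul (c i)⁻¹)).measurable
    · exact Eventually.of_forall fun i => ae_of_all _ fun z => by gcongr; exact hωb _
    · rw [lintegral_mul_const'' _ hk.integrable.1.enorm]
      exact (ENNReal.mul_lt_top hk.integrable.2 ENNReal.ofReal_lt_top).ne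
    · refine ae_of_all _ fun z => ?_
      have h1 : Tendsto (fun i => (c i)⁻¹ • z) l (𝓝 0) := by
        simpa using (tendsto_inv_atTop_zero.comp hcl).smul_const z
      have h2 := (hωc.tendsto 0).comp h1
      rw [hω0] at h2
      have h3 := ENNReal.Tendsto.const_mul (a := ‖k z‖ₑ) h2 (Or.inr enorm_ne_top)
      simpa using h3
  have h1 := ENNReal.Tendsto.const_mul (a := ENNReal.ofReal A ^ (σ - 1)) hlim
    (Or.inr (ENNReal.rpow_ne_top_of_nonneg (by linarith) ENNReal.ofReal_ne_top))
  have h2 := h1.ennrpow_const (1 / σ)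
  rw [mul_zero, ENNReal.zero_rpow_of_pos (by positivity)] at h2
  refine tendsto_of_tendsto_of_tendsto_of_le_of_le tendsto_const_nhds h2
      (fun _ => bot_le) fun i => ?_
  simp only
  rw [eLpNorm_eq_lintegral_rpow_enorm_toReal hs0 hs]
  exact ENNReal.rpow_le_rpow (hmain i) (by positivity)

end convolutionOperator

/-! ### The operators S_α(t)P: smoothing, semigroup law, continuity in time -/

section heatOp

variable {V : Type*} [NormedAddCommGroup V] [InnerProductSpace ℝ V] [FiniteDimensional ℝ V]
  [MeasurableSpace V] [BorelSpace V] {F : Type*} [NormedAddCommGroup F] [NormedSpace ℝ F]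
  {p : V → ℂ} {d : ℕ} {α : ℝ}

open Classical in
/-- Convolution with `heatKernel p α t` as a bounded operator `L^s → L^e`. -/
noncomputable def heatOp (F : Type*) [NormedAddCommGroup F] [NormedSpace ℝ F] (p : V → ℂ) (α t : ℝ)
    (s e : ℝ≥0∞) [Fact (1 ≤ s)] [Fact (1 ≤ e)] :
    Lp F s (volume : Measure V) →L[ℝ] Lp F e (volume : Measure V) :=
  if h : ∃ Φ : Lp F s (volume : Measure V) →L[ℝ] Lp F e (volume : Measure V),
    ∀ g, Φ g =ᵐ[volume] convolution (heatKernel p α t) g (ContinuousLinearMap.lsmul ℝ ℝ) volume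
  then h.choose else 0

variable [Nontrivial V]

theorem exists_kernelBound_heatKernel (hp : IsHomogeneousSymbol p d) (hα : 0 < α) :
    ∃ A > 0, ∀ t > 0, KernelBound (heatKernel p α t) (A * t ^ (-(d / (2 * α))))
      (A * t ^ (-((d + Module.finrank ℝ V) / (2 * α)))) := by
  obtain ⟨A, hA, h⟩ := exists_heatKernel_bound hp hα
  exact ⟨A, hA, fun t ht => ⟨integrable_heatKernel hp hα ht, (h t ht).1, (h t ht).2⟩⟩

theorem heatOp_coeFn (hp : IsHomogeneousSymbol p d) (hα : 0 < α) {t : ℝ} (ht : 0 < t)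
    {s e : ℝ≥0∞} [Fact (1 ≤ s)] [Fact (1 ≤ e)] (hse : s ≤ e) (he : e ≠ ⊤)
    (g : Lp F s (volume : Measure V)) :
    heatOp F p α t s e g =ᵐ[volume]
      convolution (heatKernel p α t) g (ContinuousLinearMap.lsmul ℝ ℝ) volume := by
  obtain ⟨A, -, hk⟩ := exists_kernelBound_heatKernel hp hα
  obtain ⟨Φ, hΦ, -⟩ := exists_convolution_clm (F := F) (hk t ht) hse he
  have h : ∃ Φ : Lp F s (volume : Measure V) →L[ℝ] Lp F e (volume : Measure V),
    ∀ g, Φ g =ᵐ[volume] convolution (heatKernel p α t) g (ContinuousLinearMap.lsmul ℝ ℝ) volume :=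
    ⟨Φ, hΦ⟩
  rw [heatOp, dif_pos h]
  exact h.choose_spec g

/-- The smoothing estimate `L^s → L^e`. -/
theorem exists_norm_heatOp_le (hp : IsHomogeneousSymbol p d) (hα : 0 < α) :
    ∃ A > 0, ∀ t > 0, ∀ (s e : ℝ≥0∞) [Fact (1 ≤ s)] [Fact (1 ≤ e)], s ≤ e → e ≠ ⊤ →
      ∀ g : Lp F s (volume : Measure V), ‖heatOp F p α t s e g‖ ≤
        A * t ^ (-(d / (2 * α) + Module.finrank ℝ V / (2 * α) * (1 / s.toReal - 1 / e.toReal))) *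
          ‖g‖ := by
  obtain ⟨A, hA, hk⟩ := exists_kernelBound_heatKernel hp hα
  refine ⟨A, hA, fun t ht s e _ _ hse he g => ?_⟩
  obtain ⟨Φ, hΦ, hb⟩ := exists_convolution_clm (F := F) (hk t ht) hse he
  have h : heatOp F p α t s e g = Φ g :=
    Lp.ext ((heatOp_coeFn hp hα ht hse he g).trans (hΦ g).symm)
  rw [h]
  refine (hb g).trans (le_of_eq ?_)
  congr 1
  set θ := 1 / s.toReal - 1 / e.toReal
  have ht' := ht.le
  rw [Real.mul_rpow hA.le (Real.rpow_nonneg ht' _), Real.mul_rpow hA.le (Real.rpow_nonneg ht' _),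
    ← Real.rpow_mul ht', ← Real.rpow_mul ht']
  have h1 : A ^ (1 - θ) * A ^ θ = A := by
    rw [← Real.rpow_add hA]; simp
  calc _ = (A ^ (1 - θ) * A ^ θ) * (t ^ (-(d / (2 * α)) * (1 - θ)) *
        t ^ (-((d + Module.finrank ℝ V) / (2 * α)) * θ)) := by ring
    _ = _ := by
      rw [h1, ← Real.rpow_add ht]
      congr 2
      ring

variable [CompleteSpace F]

theorem convolution_heatKernel_heatKernel (hp : IsHomogeneousSymbol p d) (hα : 0 < α) {t t' : ℝ}
    (ht : 0 < t) (ht' : 0 < t') {s : ℝ≥0∞} (hs : 1 ≤ s) (hs' : s ≠ ⊤) {g : V → F} (hg : MemLp g s) :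
    convolution (heatKernel (fun _ => (1:ℂ)) α t) (convolution (heatKernel p α t') g
      (ContinuousLinearMap.lsmul ℝ ℝ) volume) (ContinuousLinearMap.lsmul ℝ ℝ) volume =
    convolution (heatKernel p α (t + t')) g (ContinuousLinearMap.lsmul ℝ ℝ) volume := by
  obtain ⟨A, -, hk⟩ := exists_kernelBound_heatKernel hp hα
  obtain ⟨A', -, hk'⟩ := exists_kernelBound_heatKernel (isHomogeneousSymbol_one (V := V)) hα
  ext x
  rw [convolution_convolution_kernel (hk' t ht) (hk t' ht') hs hs' hg]
  congr 2
  ext y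
  exact integral_heatKernel_mul_heatKernel_sub hp hα ht ht' y

theorem convolution_heatKernel_heatKernel' (hp : IsHomogeneousSymbol p d) (hα : 0 < α) {t t' : ℝ}
    (ht : 0 < t) (ht' : 0 < t') {s : ℝ≥0∞} (hs : 1 ≤ s) (hs' : s ≠ ⊤) {g : V → F} (hg : MemLp g s) :
    convolution (heatKernel p α t) (convolution (heatKernel (fun _ => (1:ℂ)) α t') g
      (ContinuousLinearMap.lsmul ℝ ℝ) volume) (ContinuousLinearMap.lsmul ℝ ℝ) volume =
    convolution (heatKernel p α (t + t')) g (ContinuousLinearMap.lsmul ℝ ℝ) volume := by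
  obtain ⟨A, -, hk⟩ := exists_kernelBound_heatKernel hp hα
  obtain ⟨A', -, hk'⟩ := exists_kernelBound_heatKernel (isHomogeneousSymbol_one (V := V)) hα
  ext x
  rw [convolution_convolution_kernel (hk t ht) (hk' t' ht') hs hs' hg]
  congr 2
  ext y
  rw [add_comm, ← integral_heatKernel_mul_heatKernel_sub hp hα ht' ht y]
  rw [convolution_eq_swap]
  refine integral_congr_ae (ae_of_all _ fun z => ?_)
  simp [mul_comm]

theorem heatOp_heatOp (hp : IsHomogeneousSymbol p d) (hα : 0 < α) {t t' : ℝ}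
    (ht : 0 < t) (ht' : 0 < t') {s e : ℝ≥0∞} [hs : Fact (1 ≤ s)] [he1 : Fact (1 ≤ e)]
        (hse : s ≤ e) (he : e ≠ ⊤)
    (g : Lp F s (volume : Measure V)) :
    heatOp F (fun _ => (1:ℂ)) α t e e (heatOp F p α t' s e g) = heatOp F p α (t + t') s e g := by
  refine Lp.ext ?_
  refine (heatOp_coeFn isHomogeneousSymbol_one hα ht le_rfl he _).trans ?_
  rw [convolution_congr_ae_right (heatOp_coeFn hp hα ht' hse he g),
    convolution_heatKernel_heatKernel hp hα ht ht' hs.out (ne_top_of_le_ne_top he hse) (Lp.memLp g)]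
  exact (heatOp_coeFn hp hα (by positivity) hse he g).symm

/-- Here the free semigroup acts first, inside L^s. Time dependence can thus be moved from the
smoothing operator to the semigroup, whose strong continuity is known. -/
theorem heatOp_heatOp' (hp : IsHomogeneousSymbol p d) (hα : 0 < α) {t t' : ℝ}
    (ht : 0 < t) (ht' : 0 < t') {s e : ℝ≥0∞} [hs : Fact (1 ≤ s)] [he1 : Fact (1 ≤ e)]
        (hse : s ≤ e) (he : e ≠ ⊤)
    (g : Lp F s (volume : Measure V)) :
    heatOp F p α t s e (heatOp F (fun _ => (1:ℂ)) α t' s s g) = heatOp F p α (t + t') s e g := by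
  have hs' := ne_top_of_le_ne_top he hse
  refine Lp.ext ?_
  refine (heatOp_coeFn hp hα ht hse he _).trans ?_
  rw [convolution_congr_ae_right (heatOp_coeFn isHomogeneousSymbol_one hα ht' le_rfl hs' g),
    convolution_heatKernel_heatKernel' hp hα ht ht' hs.out hs' (Lp.memLp g)]
  exact (heatOp_coeFn hp hα (by positivity) hse he g).symm

/-- By the scaling law K_t is the dilate of K_1 by t^(−1/(2α)) and has mass one, hence is an
approximate identity. -/
theorem tendsto_heatOp_zero (hα : 0 < α) {s : ℝ≥0∞} [hs : Fact (1 ≤ s)] (hs' : s ≠ ⊤)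
    (g : Lp F s (volume : Measure V)) :
    Tendsto (fun t => heatOp F (fun _ : V => (1:ℂ)) α t s s g) (𝓝[>] 0) (𝓝 g) := by
  have hp := isHomogeneousSymbol_one (V := V)
  obtain ⟨A', -, hk'⟩ := exists_kernelBound_heatKernel hp hα
  -- The index set is the positive half-line as a subtype, because the dilation factors must be
  -- positive for every index.
  have hc : Tendsto (fun t : Ioi (0:ℝ) => (t : ℝ) ^ (-(1 / (2 * α))))
      (comap (Subtype.val : Ioi (0:ℝ) → ℝ) (𝓝[>] 0)) atTop := by
    have h := tendsto_rpow_neg_nhdsGT_zero (y := -(1 / (2 * α))) (by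
      rw [neg_lt_zero]; positivity)
    exact h.comp tendsto_comap
  have h := tendsto_eLpNorm_convolution_dilation_sub (hk' 1 one_pos)
    (continuous_heatKernel hp hα one_pos) (integral_heatKernel hα one_pos) hs' g
    (fun t : Ioi (0:ℝ) => Real.rpow_pos_of_pos t.2 _) hc
  rw [tendsto_iff_norm_sub_tendsto_zero]
  have h2 := (ENNReal.tendsto_toReal (by simp)).comp h
  rw [ENNReal.toReal_zero] at h2
  have h3 : Tendsto (fun t : Ioi (0:ℝ) => ‖heatOp F (fun _ : V => (1:ℂ)) α t s s g - g‖)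
      (comap (Subtype.val : Ioi (0:ℝ) → ℝ) (𝓝[>] 0)) (𝓝 0) := by
    refine h2.congr fun t => ?_
    simp only [Function.comp]
    rw [Lp.norm_def]
    congr 1
    refine eLpNorm_congr_ae ?_
    filter_upwards [Lp.coeFn_sub (heatOp F (fun _ : V => (1:ℂ)) α t s s g) g,
      heatOp_coeFn hp hα t.2 le_rfl hs' g] with x hx hx'
    rw [hx, Pi.sub_apply, hx']
    congr 3
    ext y
    rw [heatKernel_scaling hp hα t.2, add_zero]
  have h4 : map (Subtype.val : Ioi (0:ℝ) → ℝ) (comap (Subtype.val : Ioi (0:ℝ) → ℝ) (𝓝[>] 0))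
      = 𝓝[>] 0 := by
    rw [map_comap, Subtype.range_coe, inf_eq_left]
    exact le_principal_iff.2 self_mem_nhdsWithin
  rw [← h4, tendsto_map'_iff]
  exact h3

/-- For a < b, S(b)g − S(a)g = S(a)(S(b−a)g − g). Uniform boundedness of the semigroup reduces both
one-sided limits to continuity at 0. -/
theorem tendsto_heatOp_one (hα : 0 < α) {s : ℝ≥0∞} [hs : Fact (1 ≤ s)] (hs' : s ≠ ⊤)
    (g : Lp F s (volume : Measure V)) {t₀ : ℝ} (ht₀ : 0 < t₀) :
    Tendsto (fun t => heatOp F (fun _ : V => (1:ℂ)) α t s s g) (𝓝 t₀)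
      (𝓝 (heatOp F (fun _ : V => (1:ℂ)) α t₀ s s g)) := by
  have hp := isHomogeneousSymbol_one (V := V)
  obtain ⟨A, hA, hb⟩ := exists_norm_heatOp_le (F := F) hp hα
  have hb' : ∀ t > 0, ∀ g : Lp F s (volume : Measure V),
      ‖heatOp F (fun _ : V => (1:ℂ)) α t s s g‖ ≤ A * ‖g‖ := by
    intro t ht g
    simpa using hb t ht s s le_rfl hs' g
  have h0 := tendsto_heatOp_zero hα hs' g
  rw [tendsto_iff_norm_sub_tendsto_zero] at h0
  rw [Metric.tendsto_nhds]
  intro ε hε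
  have h1 : ∀ᶠ h in 𝓝[>] (0:ℝ), ‖heatOp F (fun _ : V => (1:ℂ)) α h s s g - g‖ < ε / A :=
    h0.eventually (gt_mem_nhds (by positivity))
  rw [eventually_nhdsWithin_iff, Metric.eventually_nhds_iff] at h1
  obtain ⟨δ, hδ, h1⟩ := h1
  have h2 : ∀ᶠ t in 𝓝 t₀, 0 < t := lt_mem_nhds ht₀
  have h3 : ∀ᶠ t in 𝓝 t₀, dist t t₀ < δ := Metric.ball_mem_nhds t₀ hδ
  have key : ∀ a b, 0 < a → a < b → b - a < δ →
      ‖heatOp F (fun _ : V => (1:ℂ)) α b s s g - heatOp F (fun _ : V => (1:ℂ)) α a s s g‖ < ε := by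
    intro a b ha hab hd
    have hba : 0 < b - a := by linarith
    have h4 := heatOp_heatOp hp hα ha hba le_rfl hs' g
    rw [add_sub_cancel] at h4
    rw [← h4, ← map_sub]
    refine (hb' a ha _).trans_lt ?_
    have h5 := h1 (y := b - a) (by rw [Real.dist_eq, sub_zero, abs_of_pos hba]; exact hd) hba
    rwa [lt_div_iff₀ hA, mul_comm] at h5
  filter_upwards [h2, h3] with t ht htd
  rw [Real.dist_eq] at htd
  rw [dist_eq_norm]
  rcases lt_trichotomy t t₀ with h | h | h
  · rw [norm_sub_rev]
    refine key t t₀ ht h ?_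
    rw [abs_sub_comm, abs_of_pos (by linarith)] at htd
    exact htd
  · rw [h]; simpa using hε
  · refine key t₀ t ht₀ h ?_
    rwa [abs_of_pos (by linarith)] at htd

/-- Joint continuity of `(t, g) ↦ S(t) P g`, `t > 0`. -/
theorem tendsto_heatOp (hp : IsHomogeneousSymbol p d) (hα : 0 < α)
    {s e : ℝ≥0∞} [hs : Fact (1 ≤ s)] [he1 : Fact (1 ≤ e)] (hse : s ≤ e) (he : e ≠ ⊤)
    {ι : Type*} {l : Filter ι} {t : ι → ℝ} {t₀ : ℝ} (ht₀ : 0 < t₀) (ht : Tendsto t l (𝓝 t₀))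
    {g : ι → Lp F s (volume : Measure V)} {g₀ : Lp F s (volume : Measure V)}
    (hg : Tendsto g l (𝓝 g₀)) :
    Tendsto (fun i => heatOp F p α (t i) s e (g i)) l (𝓝 (heatOp F p α t₀ s e g₀)) := by
  have hs' := ne_top_of_le_ne_top he hse
  have hp1 := isHomogeneousSymbol_one (V := V)
  obtain ⟨A, hA, hb⟩ := exists_norm_heatOp_le (F := F) hp1 hα
  have hb' : ∀ t > 0, ∀ g : Lp F s (volume : Measure V),
      ‖heatOp F (fun _ : V => (1:ℂ)) α t s s g‖ ≤ A * ‖g‖ := by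
    intro t ht g
    simpa using hb t ht s s le_rfl hs' g
  have h2 : 0 < t₀ / 2 := by positivity
  have hev : ∀ᶠ i in l, t₀ / 2 < t i := ht.eventually (lt_mem_nhds (by linarith))
  -- Half of t₀ is reserved for the fixed smoothing operator; the remaining time t − t₀/2 stays
  -- positive and is spent on the semigroup in L^s.
  have hinner : Tendsto (fun i => heatOp F (fun _ : V => (1:ℂ)) α (t i - t₀ / 2) s s (g i)) l
      (𝓝 (heatOp F (fun _ : V => (1:ℂ)) α (t₀ / 2) s s g₀)) := by
    have h3 := (tendsto_heatOp_one hα hs' g₀ h2).comp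
      (show Tendsto (fun i => t i - t₀ / 2) l (𝓝 (t₀ / 2)) by
        have := ht.sub_const (t₀ / 2); rwa [sub_half] at this)
    have h4 : Tendsto (fun i => heatOp F (fun _ : V => (1:ℂ)) α (t i - t₀ / 2) s s
        (g i - g₀)) l (𝓝 0) := by
      rw [tendsto_zero_iff_norm_tendsto_zero]
      have h5 : Tendsto (fun i => A * ‖g i - g₀‖) l (𝓝 0) := by
        simpa using (tendsto_iff_norm_sub_tendsto_zero.1 hg).const_mul A
      refine squeeze_zero' (Eventually.of_forall fun i => norm_nonneg _) ?_ h5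
      filter_upwards [hev] with i hi
      exact hb' _ (by linarith) _
    have h6 := h4.add h3
    rw [zero_add] at h6
    refine h6.congr fun i => ?_
    simp [map_sub]
  have h7 := ((heatOp F p α (t₀ / 2) s e).continuous.tendsto _).comp hinner
  rw [heatOp_heatOp' hp hα h2 h2 hse he, add_halves] at h7
  refine h7.congr' ?_
  filter_upwards [hev] with i hi
  simp only [Function.comp]
  rw [heatOp_heatOp' hp hα h2 (by linarith) hse he]
  congr 2; ring

end heatOp

/-! ### Interpolation, Hölder and Minkowski inequalities -/

section LpTools

variable {X : Type*} [MeasurableSpace X] {μ : Measure X} {F : Type*} [NormedAddCommGroup F]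

/-- Log-convexity of the `L^p` norms. -/
theorem eLpNorm_le_rpow_mul_rpow {u : X → F} (hu : AEStronglyMeasurable u μ) {r e M : ℝ≥0∞} {θ : ℝ}
    (hr : r ≠ 0) (hr' : r ≠ ⊤) (he : e ≠ 0) (he' : e ≠ ⊤) (hM : M ≠ 0) (hM' : M ≠ ⊤)
    (hθ : 0 ≤ θ) (hθ' : θ ≤ 1)
    (h : 1 / e.toReal = (1 - θ) / r.toReal + θ / M.toReal) :
    eLpNorm u e μ ≤ eLpNorm u r μ ^ (1 - θ) * eLpNorm u M μ ^ θ := by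
  have hr0 := ENNReal.toReal_pos hr hr'
  have he0 := ENNReal.toReal_pos he he'
  have hM0 := ENNReal.toReal_pos hM hM'
  rw [eLpNorm_eq_lintegral_rpow_enorm_toReal he he', eLpNorm_eq_lintegral_rpow_enorm_toReal hr hr',
    eLpNorm_eq_lintegral_rpow_enorm_toReal hM hM']
  set ρ := r.toReal
  set ε := e.toReal
  set m := M.toReal
  have h1 : 0 ≤ 1 - θ := by linarith
  have ha : 0 ≤ ε * ((1 - θ) / ρ) := by positivity
  have hb : 0 ≤ ε * (θ / m) := by positivity
  have hab : ε * ((1 - θ) / ρ) + ε * (θ / m) = 1 := by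
    rw [← mul_add, ← h, mul_one_div_cancel he0.ne']
  have hL := ENNReal.lintegral_mul_norm_pow_le (μ := μ) (f := fun x => ‖u x‖ₑ ^ ρ)
    (g := fun x => ‖u x‖ₑ ^ m) (hu.enorm.pow_const ρ) (hu.enorm.pow_const m) ha hb hab
  have heq : ∀ x, (‖u x‖ₑ ^ ρ) ^ (ε * ((1 - θ) / ρ)) * (‖u x‖ₑ ^ m) ^ (ε * (θ / m)) =
      ‖u x‖ₑ ^ ε := by
    intro x
    rw [← ENNReal.rpow_mul, ← ENNReal.rpow_mul, ← ENNReal.rpow_add_of_nonneg _ _ (by positivity)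
      (by positivity)]
    congr 1
    field_simp
    ring
  simp_rw [heq] at hL
  refine (ENNReal.rpow_le_rpow hL (by positivity)).trans (le_of_eq ?_)
  rw [ENNReal.mul_rpow_of_nonneg _ _ (by positivity)]
  simp only [← ENNReal.rpow_mul]
  congr 2 <;> field_simp

/-- The endpoint M = ∞ of log-convexity, for solutions whose nonlinear terms make sense through a
local L^∞ bound. -/
theorem eLpNorm_le_of_top {u : X → F} {r e : ℝ≥0∞} (hr : r ≠ 0) (hre : r ≤ e) (he' : e ≠ ⊤)
    (htop : eLpNorm u ⊤ μ ≠ ⊤) :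
    eLpNorm u e μ ≤ eLpNorm u r μ ^ (r.toReal / e.toReal) * eLpNorm u ⊤ μ ^
        (1 - r.toReal / e.toReal) := by
  have hr' : r ≠ ⊤ := ne_top_of_le_ne_top he' hre
  have he : e ≠ 0 := (hr.bot_lt.trans_le hre).ne'
  have hr0 := ENNReal.toReal_pos hr hr'
  have he0 := ENNReal.toReal_pos he he'
  have hre' : r.toReal ≤ e.toReal := ENNReal.toReal_mono he' hre
  rw [eLpNorm_eq_lintegral_rpow_enorm_toReal he he', eLpNorm_eq_lintegral_rpow_enorm_toReal hr hr',
    eLpNorm_exponent_top]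
  set ρ := r.toReal
  set ε := e.toReal
  have h1 : ∫⁻ x, ‖u x‖ₑ ^ ε ∂μ ≤ (∫⁻ x, ‖u x‖ₑ ^ ρ ∂μ) * eLpNormEssSup u μ ^ (ε - ρ) := by
    have hm : eLpNormEssSup u μ ^ (ε - ρ) ≠ ⊤ :=
      ENNReal.rpow_ne_top_of_nonneg (by linarith) (by rwa [eLpNorm_exponent_top] at htop)
    rw [← lintegral_mul_const' _ _ hm]
    refine lintegral_mono_ae ?_
    filter_upwards [enorm_ae_le_eLpNormEssSup u μ] with x hx
    calc ‖u x‖ₑ ^ ε = ‖u x‖ₑ ^ ρ * ‖u x‖ₑ ^ (ε - ρ) := by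
          rw [← ENNReal.rpow_add_of_nonneg _ _ hr0.le (by linarith)]; congr 1; ring
      _ ≤ _ := by gcongr
  refine (ENNReal.rpow_le_rpow h1 (by positivity)).trans (le_of_eq ?_)
  rw [ENNReal.mul_rpow_of_nonneg _ _ (by positivity)]
  simp only [← ENNReal.rpow_mul]
  congr 2 <;> field_simp

/-- Hölder's inequality in the form used for power nonlinearities. -/
theorem eLpNorm_rpow_mul_le {u w : X → F} (hu : AEStronglyMeasurable u μ)
    (hw : AEStronglyMeasurable w μ) {s e : ℝ≥0∞} {b : ℝ} (hb : 0 < b)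
    (hs : s ≠ 0) (hs' : s ≠ ⊤) (he : e ≠ 0) (he' : e ≠ ⊤) (h : e.toReal = (b + 1) * s.toReal) :
    eLpNorm (fun x => ‖u x‖ ^ b * ‖w x‖) s μ ≤ eLpNorm u e μ ^ b * eLpNorm w e μ := by
  have hs0 := ENNReal.toReal_pos hs hs'
  have he0 := ENNReal.toReal_pos he he'
  rw [eLpNorm_eq_lintegral_rpow_enorm_toReal he he', eLpNorm_eq_lintegral_rpow_enorm_toReal hs hs',
    eLpNorm_eq_lintegral_rpow_enorm_toReal he he']
  set σ := s.toReal
  set ε := e.toReal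
  have hL := ENNReal.lintegral_mul_norm_pow_le (μ := μ) (f := fun x => ‖u x‖ₑ ^ ε)
    (g := fun x => ‖w x‖ₑ ^ ε) (hu.enorm.pow_const ε) (hw.enorm.pow_const ε) (p := b / (b + 1))
    (q := 1 / (b + 1)) (by positivity) (by positivity) (by field_simp)
  have heq : ∀ x, (‖u x‖ₑ ^ ε) ^ (b / (b + 1)) * (‖w x‖ₑ ^ ε) ^ (1 / (b + 1)) =
      ‖‖u x‖ ^ b * ‖w x‖‖ₑ ^ σ := by
    intro x
    rw [← ENNReal.rpow_mul, ← ENNReal.rpow_mul, enorm_mul, ENNReal.mul_rpow_of_nonneg _ _ hs0.le,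
      Real.enorm_rpow_of_nonneg (norm_nonneg _) hb.le, enorm_norm, enorm_norm, ←
          ENNReal.rpow_mul, h]
    congr 2 <;> field_simp
  simp_rw [heq] at hL
  refine (ENNReal.rpow_le_rpow hL (by positivity)).trans (le_of_eq ?_)
  rw [ENNReal.mul_rpow_of_nonneg _ _ (by positivity)]
  simp only [← ENNReal.rpow_mul]
  rw [h]
  congr 2 <;> field_simp

/-- Lower semicontinuity of the `L^M` norm with respect to `L^r` convergence. -/
theorem isClosed_eLpNorm_le {r M : ℝ≥0∞} [hr : Fact (1 ≤ r)] (c : ℝ≥0∞) :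
    IsClosed {g : Lp F r μ | eLpNorm g M μ ≤ c} := by
  refine IsSeqClosed.isClosed fun g g₀ hg hlim => ?_
  have h1 : Tendsto (fun n => eLpNorm (g n - g₀ : X → F) r μ) atTop (𝓝 0) :=
    (Lp.tendsto_Lp_iff_tendsto_eLpNorm' g g₀).1 hlim
  have h2 := tendstoInMeasure_of_tendsto_eLpNorm (one_pos.trans_le hr.out).ne'
    (fun n => (Lp.memLp (g n)).1) (Lp.memLp g₀).1 h1
  obtain ⟨ns, -, hns⟩ := h2.exists_seq_tendsto_ae
  refine (Lp.eLpNorm_lim_le_liminf_eLpNorm (fun n => (Lp.memLp (g (ns n))).1) _ hns).trans ?_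
  refine liminf_le_of_frequently_le' (Frequently.of_forall fun n => hg (ns n))

/-- The closed convex cone behind Minkowski's integral inequality. -/
theorem eLpNorm_integral_le [NormedSpace ℝ F] [CompleteSpace F] {Y : Type*} [MeasurableSpace Y]
    {ρ : Measure Y}
    [IsFiniteMeasure ρ] {r M : ℝ≥0∞} [hr : Fact (1 ≤ r)] (hM : 1 ≤ M) {G : Y → Lp F r μ} {N : Y → ℝ}
    (hG : Integrable G ρ) (hN : Integrable N ρ)
    (h : ∀ᵐ y ∂ρ, 0 ≤ N y ∧ eLpNorm (G y) M μ ≤ ENNReal.ofReal (N y)) :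
    eLpNorm (∫ y, G y ∂ρ : Lp F r μ) M μ ≤ ENNReal.ofReal (∫ y, N y ∂ρ) := by
  -- C is the epigraph of the L^M norm: convex by the triangle inequality, and closed in L^r × ℝ by
  -- lower semicontinuity. An average of points of C stays in C, so no Bochner integrability in L^M
  -- is needed.
  set C : Set (Lp F r μ × ℝ) := {z | 0 ≤ z.2 ∧ eLpNorm z.1 M μ ≤ ENNReal.ofReal z.2} with hC
  rcases eq_zero_or_neZero ρ with h0 | h0
  · subst h0
    simp only [integral_zero_measure]
    rw [eLpNorm_congr_ae (Lp.coeFn_zero F r μ)]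
    simp
  have hconv : Convex ℝ C := by
    rintro ⟨g, a⟩ ⟨ha, hg⟩ ⟨g', a'⟩ ⟨ha', hg'⟩ x y hx hy -
    refine ⟨by simp only [Prod.smul_mk, Prod.mk_add_mk, smul_eq_mul] at *; positivity, ?_⟩
    simp only [Prod.smul_mk, Prod.mk_add_mk, smul_eq_mul] at *
    rw [eLpNorm_congr_ae ((Lp.coeFn_add (x • g) (y • g')).trans
      ((Lp.coeFn_smul x g).add (Lp.coeFn_smul y g')))]
    refine (eLpNorm_add_le ((Lp.memLp g).1.const_smul x) ((Lp.memLp g').1.const_smul y) hM).trans ?_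
    rw [eLpNorm_const_smul, eLpNorm_const_smul, ENNReal.ofReal_add (by positivity) (by positivity),
      ENNReal.ofReal_mul hx, ENNReal.ofReal_mul hy, Real.enorm_of_nonneg hx,
          Real.enorm_of_nonneg hy]
    gcongr
  have hclosed : IsClosed C := by
    refine IsSeqClosed.isClosed fun z z₀ hz hlim => ?_
    have h1 : Tendsto (fun n => (z n).1) atTop (𝓝 z₀.1) := (continuous_fst.tendsto _).comp hlim
    have h2 : Tendsto (fun n => (z n).2) atTop (𝓝 z₀.2) := (continuous_snd.tendsto _).comp hlim
    refine ⟨ge_of_tendsto' h2 fun n => (hz n).1, ?_⟩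
    refine le_of_forall_gt_imp_ge_of_dense fun c hc => ?_
    have h3 : ∀ᶠ n in atTop, ENNReal.ofReal (z n).2 < c :=
      (ENNReal.tendsto_ofReal h2).eventually (gt_mem_nhds hc)
    refine (isClosed_eLpNorm_le (F := F) (μ := μ) (r := r) (M := M) c).mem_of_tendsto h1 ?_
    filter_upwards [h3] with n hn
    exact (hz n).2.trans hn.le
  have hmem := hconv.average_mem hclosed (f := fun y => (G y, N y)) h (hG.prodMk hN)
  rw [average_eq, integral_pair hG hN] at hmem
  have hρ : 0 < ρ.real univ := by
    rw [measureReal_def]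
    exact ENNReal.toReal_pos (NeZero.ne _) (measure_ne_top _ _)
  obtain ⟨-, h2⟩ := hmem
  simp only [Prod.smul_mk, smul_eq_mul] at h2
  rw [eLpNorm_congr_ae (Lp.coeFn_smul _ _), eLpNorm_const_smul,
    Real.enorm_of_nonneg (by positivity), ENNReal.ofReal_mul (by positivity)] at h2
  have h3 : ENNReal.ofReal (ρ.real univ)⁻¹ ≠ 0 := by
    rw [ne_eq, ENNReal.ofReal_eq_zero, not_le]; positivity
  exact (ENNReal.mul_le_mul_iff_right h3 ENNReal.ofReal_ne_top).1 h2

end LpTools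

/-! ### The power nonlinearity -/

section powerNonlinearity

variable {𝕜 : Type*} [RCLike 𝕜]

/-- For |w| ≤ |z| the difference is |z|^b (z − w) + (|z|^b − |w|^b) w. Bernoulli's inequality for
the power b + 1 of |w|/|z| bounds the second summand by b|z|^b(|z| − |w|). -/
theorem norm_rpow_smul_sub_le {b : ℝ} (hb : 0 < b) (z w : 𝕜) :
    ‖(‖z‖ ^ b) • z - (‖w‖ ^ b) • w‖ ≤ (b + 1) * (‖z‖ ^ b + ‖w‖ ^ b) * ‖z - w‖ := by
  have key : ∀ z w : 𝕜, ‖w‖ ≤ ‖z‖ →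
      ‖(‖z‖ ^ b) • z - (‖w‖ ^ b) • w‖ ≤ (b + 1) * ‖z‖ ^ b * ‖z - w‖ := by
    intro z w hwz
    rcases (norm_nonneg z).eq_or_lt with hz | hz
    · have h1 : z = 0 := norm_eq_zero.1 hz.symm
      have h2 : w = 0 := norm_eq_zero.1 (le_antisymm (hwz.trans hz.symm.le) (norm_nonneg w))
      simp [h1, h2]
    have hB := one_add_mul_self_le_rpow_one_add (s := ‖w‖ / ‖z‖ - 1) (p := b + 1)
      (by have : 0 ≤ ‖w‖ / ‖z‖ := by positivity
          linarith) (by linarith)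
    rw [add_sub_cancel, Real.div_rpow (norm_nonneg _) (norm_nonneg _),
      le_div_iff₀ (by positivity)] at hB
    have e1 : ‖z‖ ^ (b + 1) = ‖z‖ ^ b * ‖z‖ := by rw [Real.rpow_add_one hz.ne']
    have e2 : ‖w‖ ^ (b + 1) = ‖w‖ ^ b * ‖w‖ := by
      rw [Real.rpow_add_of_nonneg (norm_nonneg _) hb.le zero_le_one, Real.rpow_one]
    rw [e1, e2] at hB
    have hB' : (1 + (b + 1) * (‖w‖ / ‖z‖ - 1)) * (‖z‖ ^ b * ‖z‖) =
        ‖z‖ ^ b * ‖z‖ + (b + 1) * ‖z‖ ^ b * (‖w‖ - ‖z‖) := by field_simp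
    rw [hB'] at hB
    have hmono : ‖w‖ ^ b ≤ ‖z‖ ^ b := Real.rpow_le_rpow (norm_nonneg _) hwz hb.le
    have hdecomp : (‖z‖ ^ b) • z - (‖w‖ ^ b) • w = (‖z‖ ^ b) • (z - w) +
        (‖z‖ ^ b - ‖w‖ ^ b) • w := by
      rw [smul_sub, sub_smul]; abel
    rw [hdecomp]
    refine (norm_add_le _ _).trans ?_
    rw [norm_smul, norm_smul, Real.norm_of_nonneg (by positivity), Real.norm_of_nonneg
        (by linarith)]
    have h3 : ‖z‖ - ‖w‖ ≤ ‖z - w‖ := norm_sub_norm_le z w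
    have h4 : b * ‖z‖ ^ b * (‖z‖ - ‖w‖) ≤ b * ‖z‖ ^ b * ‖z - w‖ := by gcongr
    nlinarith
  rcases le_total ‖w‖ ‖z‖ with h | h
  · refine (key z w h).trans ?_
    gcongr
    have : 0 ≤ ‖w‖ ^ b := by positivity
    linarith
  · rw [norm_sub_rev, norm_sub_rev z w]
    refine (key w z h).trans ?_
    gcongr
    have : 0 ≤ ‖z‖ ^ b := by positivity
    linarith

theorem norm_powerNonlinearity_sub_le {b ε : ℝ} (hb : 0 < b) (hε : ε = 1 ∨ ε = -1) (z w : 𝕜) :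
    ‖powerNonlinearity ε b z - powerNonlinearity ε b w‖ ≤
      (b + 1) * (‖z‖ ^ b + ‖w‖ ^ b) * ‖z - w‖ := by
  have h : powerNonlinearity ε b z - powerNonlinearity ε b w =
      ε • ((‖z‖ ^ b) • z - (‖w‖ ^ b) • w) := by
    rw [powerNonlinearity, powerNonlinearity, smul_sub, smul_smul, smul_smul]
  have h2 : ‖ε‖ = 1 := by rcases hε with rfl | rfl <;> simp
  rw [h, norm_smul, h2, one_mul]
  exact norm_rpow_smul_sub_le hb z w

theorem continuous_powerNonlinearity {b ε : ℝ} (hb : 0 < b) :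
    Continuous (powerNonlinearity ε b : 𝕜 → 𝕜) := by
  unfold powerNonlinearity
  exact (continuous_const.mul (continuous_norm.rpow_const fun _ => Or.inr hb.le)).smul continuous_id

theorem powerNonlinearity_zero {b ε : ℝ} : powerNonlinearity ε b (0 : 𝕜) = 0 := by
  simp [powerNonlinearity]

variable {X : Type*} [MeasurableSpace X] {μ : Measure X}

theorem eLpNorm_powerNonlinearity_sub_le {b ε : ℝ} (hb : 0 < b) (hε : ε = 1 ∨ ε = -1)
    {u v : X → 𝕜} (hu : AEStronglyMeasurable u μ) (hv : AEStronglyMeasurable v μ)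
    {s e : ℝ≥0∞} (hs : 1 ≤ s) (hs' : s ≠ ⊤) (he : e ≠ 0) (he' : e ≠ ⊤)
    (h : e.toReal = (b + 1) * s.toReal) :
    eLpNorm (fun x => powerNonlinearity ε b (u x) - powerNonlinearity ε b (v x)) s μ ≤
      ENNReal.ofReal (b + 1) * (eLpNorm u e μ ^ b + eLpNorm v e μ ^ b) *
        eLpNorm (fun x => u x - v x) e μ := by
  have hs0 : s ≠ 0 := (one_pos.trans_le hs).ne'
  have hw : AEStronglyMeasurable (fun x => u x - v x) μ := hu.sub hv
  have hub : AEStronglyMeasurable (fun x => ‖u x‖ ^ b) μ :=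
    (continuous_id.rpow_const fun _ => Or.inr hb.le).comp_aestronglyMeasurable hu.norm
  have hvb : AEStronglyMeasurable (fun x => ‖v x‖ ^ b) μ :=
    (continuous_id.rpow_const fun _ => Or.inr hb.le).comp_aestronglyMeasurable hv.norm
  calc _ ≤ eLpNorm ((b + 1) • ((fun x => ‖u x‖ ^ b * ‖u x - v x‖) +
        (fun x => ‖v x‖ ^ b * ‖u x - v x‖))) s μ := by
        refine eLpNorm_mono_real fun x => ?_
        refine (norm_powerNonlinearity_sub_le hb hε _ _).trans (le_of_eq ?_)
        simp only [Pi.smul_apply, Pi.add_apply, smul_eq_mul]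
        ring
    _ ≤ ENNReal.ofReal (b + 1) * (eLpNorm u e μ ^ b * eLpNorm (fun x => u x - v x) e μ +
          eLpNorm v e μ ^ b * eLpNorm (fun x => u x - v x) e μ) := by
        rw [eLpNorm_const_smul, Real.enorm_of_nonneg (by linarith)]
        gcongr
        refine (eLpNorm_add_le (hub.mul hw.norm) (hvb.mul hw.norm) hs).trans ?_
        gcongr
        · exact eLpNorm_rpow_mul_le hu hw hb hs0 hs' he he' h
        · exact eLpNorm_rpow_mul_le hv hw hb hs0 hs' he he' h
    _ = _ := by ring

end powerNonlinearity

/-! ### Choice of exponents and the time integral -/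

/-- Choice of the Lebesgue exponents `e` (of the solution) and `s = e / (b + 1)` (of the
nonlinearity) for which the Duhamel term maps into `L^o`. -/
theorem exists_exponents {ν ρ m b δ o : ℝ} (hν : 0 < ν) (hρ : 1 ≤ ρ) (hρm : ρ ≤ m) (hb : 0 < b)
    (hbm : b + 1 ≤ m) (hδ : 0 ≤ δ) (hsub : δ + ν * b / ρ < 1) (hσ : ν * (1 / ρ - 1 / m) < 1)
    (ho : ρ ≤ o) (hom : o ≤ m) :
    ∃ e s : ℝ, ρ ≤ e ∧ e ≤ m ∧ (ρ < m → b + 1 < m → e < m) ∧ e = (b + 1) * s ∧ 1 ≤ s ∧ s ≤ o ∧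
      (b + 1) * (ν * (1 / ρ - 1 / e)) < 1 ∧ δ + ν * (1 / s - 1 / o) < 1 := by
  have hρ0 : 0 < ρ := by linarith
  have hm0 : 0 < m := by linarith
  have ho0 : 0 < o := by linarith
  have hb1 : 0 < b + 1 := by linarith
  -- All requirements are linear in y = 1/s = (b+1)/e. Lower bounds: l₁ from e ≤ m, l₂ from s ≤ o,
  -- and l₃ (strict) from integrability at τ = 0. Upper bounds: 1 from s ≥ 1, u₂ from e ≥ ρ, and u₃
  -- (strict) from integrability at τ = t.
  set l₁ := (b + 1) / m
  set l₂ := 1 / o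
  set l₃ := (b + 1) / ρ - 1 / ν
  set u₂ := (b + 1) / ρ
  set u₃ := 1 / o + (1 - δ) / ν
  have hbρ : b / ρ < (1 - δ) / ν := by
    rw [lt_div_iff₀ hν]
    have : b / ρ * ν = ν * b / ρ := by ring
    linarith
  have hδν : (1 - δ) / ν ≤ 1 / ν := by gcongr; linarith
  have h1o : 1 / o ≤ 1 / ρ := one_div_le_one_div_of_le hρ0 ho
  have h1m : 1 / m ≤ 1 / o := one_div_le_one_div_of_le ho0 hom
  have h1ρ : 1 / ρ ≤ 1 := by rw [div_le_one hρ0]; exact hρ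
  have hu2 : u₂ = b / ρ + 1 / ρ := by simp only [u₂]; ring
  have hl1 : l₁ = b / m + 1 / m := by simp only [l₁]; ring
  have hbm' : b / m ≤ b / ρ := by gcongr
  have hbρ0 : 0 < b / ρ := by positivity
  have hσ' : 1 / ρ - 1 / m < 1 / ν := by rw [lt_div_iff₀ hν]; linarith
  have c11 : l₁ ≤ 1 := by simp only [l₁]; rw [div_le_one hm0]; exact hbm
  have c12 : l₁ ≤ u₂ := by rw [hl1, hu2]; linarith
  have c13 : l₁ < u₃ := by rw [hl1]; simp only [u₃]; linarith
  have c21 : l₂ ≤ 1 := by simp only [l₂]; linarith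
  have c22 : l₂ ≤ u₂ := by rw [hu2]; simp only [l₂]; linarith
  have c23 : l₂ < u₃ := by simp only [l₂, u₃]; linarith
  have c31 : l₃ < 1 := by
    have : l₃ = b / ρ + 1 / ρ - 1 / ν := by simp only [l₃]; ring
    rw [this]; linarith
  have hν0 : 0 < 1 / ν := by positivity
  have c32 : l₃ < u₂ := by simp only [l₃, u₂]; linarith
  have c33 : l₃ < u₃ := by
    have : l₃ = b / ρ + 1 / ρ - 1 / ν := by simp only [l₃]; ring
    rw [this]; simp only [u₃]; linarith
  set L := max l₁ (max l₂ l₃) with hL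
  set U := min 1 (min u₂ u₃) with hU
  have hLU : L ≤ U := by
    refine max_le ?_ (max_le ?_ ?_) <;> refine le_min ?_ (le_min ?_ ?_) <;> linarith
  have L1 : l₁ ≤ L := le_max_left _ _
  have L2 : l₂ ≤ L := (le_max_left _ _).trans (le_max_right _ _)
  have L3 : l₃ ≤ L := (le_max_right _ _).trans (le_max_right _ _)
  have U1 : U ≤ 1 := min_le_left _ _
  have U2 : U ≤ u₂ := (min_le_right _ _).trans (min_le_left _ _)
  have U3 : U ≤ u₃ := (min_le_right _ _).trans (min_le_right _ _)
  have hl3U : l₃ < U := lt_min c31 (lt_min c32 c33)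
  have hLu3 : L < u₃ := max_lt c13 (max_lt c23 c33)
  -- Even if L = U, the midpoint meets the strict constraints, because l₃ < U and L < u₃.
  set y := (L + U) / 2 with hy
  have y1 : l₁ ≤ y := by linarith
  have y2 : l₂ ≤ y := by linarith
  have y3 : l₃ < y := by linarith
  have y4 : y ≤ 1 := by linarith
  have y5 : y ≤ u₂ := by linarith
  have y6 : y < u₃ := by linarith
  have hl20 : 0 < l₂ := by positivity
  have y0 : 0 < y := by linarith
  have hinv : 1 / ((b + 1) / y) = y / (b + 1) := by rw [one_div_div]
  refine ⟨(b + 1) / y, 1 / y, ?_, ?_, ?_, by ring, ?_, ?_, ?_, ?_⟩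
  · rw [le_div_iff₀ y0]
    have := mul_le_mul_of_nonneg_left y5 hρ0.le
    have h2 : ρ * u₂ = b + 1 := by simp only [u₂]; field_simp
    linarith
  · rw [div_le_iff₀ y0]
    have := mul_le_mul_of_nonneg_left y1 hm0.le
    have h2 : m * l₁ = b + 1 := by simp only [l₁]; field_simp
    linarith
  · intro h1 h2
    have d1 : l₁ < 1 := by simp only [l₁]; rw [div_lt_one hm0]; exact h2
    have d2 : l₁ < u₂ := by simp only [l₁, u₂]; gcongr
    have d3 : l₁ < U := lt_min d1 (lt_min d2 c13)
    have d4 : l₁ < y := by linarith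
    rw [div_lt_iff₀ y0]
    have := mul_lt_mul_of_pos_left d4 hm0
    have h2 : m * l₁ = b + 1 := by simp only [l₁]; field_simp
    linarith
  · rw [le_div_iff₀ y0]; linarith
  · rw [div_le_iff₀ y0]
    have := mul_le_mul_of_nonneg_left y2 ho0.le
    have h2 : o * l₂ = 1 := by simp only [l₂]; field_simp
    linarith
  · rw [hinv]
    have : (b + 1) * (ν * (1 / ρ - y / (b + 1))) = ν * (u₂ - y) := by
      simp only [u₂]; field_simp
    rw [this]
    have h2 : u₂ - y < 1 / ν := by
      have : l₃ = u₂ - 1 / ν := rfl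
      linarith
    have := mul_lt_mul_of_pos_left h2 hν
    rwa [mul_one_div_cancel hν.ne'] at this
  · rw [one_div_one_div]
    have h2 : y - 1 / o < (1 - δ) / ν := by
      have : u₃ = 1 / o + (1 - δ) / ν := rfl
      linarith
    have := mul_lt_mul_of_pos_left h2 hν
    rw [mul_div_cancel₀ _ hν.ne'] at this
    linarith

/-- A bound for the incomplete beta integral. -/
theorem exists_integral_rpow_mul_rpow_le {a c : ℝ} (ha : 0 ≤ a) (ha' : a < 1) (hc : 0 ≤ c)
    (hc' : c < 1) :
    ∃ C > 0, ∀ t > 0, IntegrableOn (fun τ : ℝ => (t - τ) ^ (-a) * τ ^ (-c)) (Ioo 0 t) ∧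
      ∫ τ in Ioo 0 t, (t - τ) ^ (-a) * τ ^ (-c) ≤ C * t ^ (1 - a - c) := by
  refine ⟨2 ^ a / (1 - c) + 2 ^ c / (1 - a), by
    have : 0 < 1 - c := by linarith
    have : 0 < 1 - a := by linarith
    positivity, fun t ht => ?_⟩
  have i1 : ∀ x : ℝ, x < 1 → IntervalIntegrable (fun τ : ℝ => τ ^ (-x)) volume 0 t := fun x hx =>
    intervalIntegral.intervalIntegrable_rpow' (by linarith)
  have i2 : IntervalIntegrable (fun τ : ℝ => (t - τ) ^ (-a)) volume 0 t := by
    have := (i1 a ha').comp_sub_left t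
    simpa using this.symm
  have v1 : ∀ x : ℝ, x < 1 → ∫ τ in (0:ℝ)..t, τ ^ (-x) = t ^ (1 - x) / (1 - x) := by
    intro x hx
    rw [integral_rpow (Or.inl (by linarith))]
    rw [Real.zero_rpow (by linarith), sub_zero]
    ring_nf
  have v2 : ∫ τ in (0:ℝ)..t, (t - τ) ^ (-a) = t ^ (1 - a) / (1 - a) := by
    rw [intervalIntegral.integral_comp_sub_left (fun τ => τ ^ (-a)) t]
    simp [v1 a ha']
  -- On each half of (0,t) only one factor is singular; the other is at most its value at t/2. N is
  -- the sum of the two majorants.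
  set N : ℝ → ℝ := fun τ => (t / 2) ^ (-a) * τ ^ (-c) + (t / 2) ^ (-c) * (t - τ) ^ (-a) with hN
  have hNi : IntervalIntegrable N volume 0 t := ((i1 c hc').const_mul _).add (i2.const_mul _)
  have hNv : ∫ τ in (0:ℝ)..t, N τ = (2 ^ a / (1 - c) + 2 ^ c / (1 - a)) * t ^ (1 - a - c) := by
    rw [hN, intervalIntegral.integral_add ((i1 c hc').const_mul _) (i2.const_mul _),
      intervalIntegral.integral_const_mul, intervalIntegral.integral_const_mul, v1 c hc', v2]
    rw [Real.div_rpow ht.le (by norm_num), Real.div_rpow ht.le (by norm_num),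
      Real.rpow_neg (show (0:ℝ) ≤ 2 by norm_num) a, Real.rpow_neg (show (0:ℝ) ≤ 2 by norm_num) c]
    have e1 : t ^ (1 - a - c) = t ^ (-a) * t ^ (1 - c) := by rw [← Real.rpow_add ht]; congr 1; ring
    have e2 : t ^ (1 - a - c) = t ^ (-c) * t ^ (1 - a) := by rw [← Real.rpow_add ht]; congr 1; ring
    rw [add_mul]
    nth_rewrite 1 [e1]
    rw [e2, div_inv_eq_mul, div_inv_eq_mul]
    ring
  have hle : ∀ τ ∈ Ioo 0 t, (t - τ) ^ (-a) * τ ^ (-c) ≤ N τ := by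
    rintro τ ⟨h0, h1⟩
    have h1' : 0 < t - τ := by linarith
    rcases le_total τ (t / 2) with h | h
    · have h2 : (t - τ) ^ (-a) ≤ (t / 2) ^ (-a) :=
        Real.rpow_le_rpow_of_nonpos (by positivity) (by linarith) (by linarith)
      have h3 : (t - τ) ^ (-a) * τ ^ (-c) ≤ (t / 2) ^ (-a) * τ ^ (-c) := by gcongr
      have h4 : 0 ≤ (t / 2) ^ (-c) * (t - τ) ^ (-a) := by positivity
      simp only [hN]; linarith
    · have h2 : τ ^ (-c) ≤ (t / 2) ^ (-c) :=
        Real.rpow_le_rpow_of_nonpos (by positivity) h (by linarith)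
      have h3 : (t - τ) ^ (-a) * τ ^ (-c) ≤ (t - τ) ^ (-a) * (t / 2) ^ (-c) := by gcongr
      have h4 : 0 ≤ (t / 2) ^ (-a) * τ ^ (-c) := by positivity
      simp only [hN]; linarith
  have hNi' : IntegrableOn N (Ioo 0 t) :=
    ((intervalIntegrable_iff_integrableOn_Ioc_of_le ht.le).1 hNi).mono_set Ioo_subset_Ioc_self
  have hint : IntegrableOn (fun τ : ℝ => (t - τ) ^ (-a) * τ ^ (-c)) (Ioo 0 t) := by
    refine hNi'.mono' (by fun_prop) ?_
    filter_upwards [ae_restrict_mem measurableSet_Ioo] with τ hτ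
    have : 0 < t - τ := by linarith [hτ.2]
    have := hτ.1
    rw [Real.norm_of_nonneg (by positivity)]
    exact hle τ hτ
  refine ⟨hint, ?_⟩
  calc _ ≤ ∫ τ in Ioo 0 t, N τ := setIntegral_mono_on hint hNi' measurableSet_Ioo hle
    _ = ∫ τ in (0:ℝ)..t, N τ := by
        rw [intervalIntegral.integral_of_le ht.le, integral_Ioc_eq_integral_Ioo]
    _ = _ := hNv

/-! ### Weighted bounds and the estimate of one nonlinear term -/

section Kato

variable {V : Type*} [NormedAddCommGroup V] [InnerProductSpace ℝ V] [FiniteDimensional ℝ V]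
  [MeasurableSpace V] [BorelSpace V] {𝕜 : Type*} [RCLike 𝕜]

/-- The function `w` is bounded by `K` in `L^r` and by `K t ^ (-σ)` in `L^M`. -/
def KatoAt {r : ℝ≥0∞} (σ : ℝ) (M : ℝ≥0∞) (K t : ℝ) (w : Lp 𝕜 r (volume : Measure V)) : Prop :=
  ‖w‖ ≤ K ∧ eLpNorm w M volume ≤ ENNReal.ofReal (K * t ^ (-σ))

/-- Bounds of a curve on `(0, T)` in `L^r` and, with the weight `t ^ σ`, in `L^M`. -/
def KatoBound {r : ℝ≥0∞} (σ : ℝ) (M : ℝ≥0∞) (K T : ℝ)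
    (u : ℝ → Lp 𝕜 r (volume : Measure V)) : Prop :=
  ∀ t ∈ Ioo 0 T, KatoAt σ M K t (u t)

theorem KatoBound.mono {r M : ℝ≥0∞} {σ K K' T T' : ℝ} {u : ℝ → Lp 𝕜 r (volume : Measure V)}
    (h : KatoBound σ M K T u) (hK : K ≤ K') (hT : T' ≤ T) : KatoBound σ M K' T' u := by
  intro t ht
  obtain ⟨h1, h2⟩ := h t ⟨ht.1, ht.2.trans_le hT⟩
  refine ⟨h1.trans hK, h2.trans (ENNReal.ofReal_le_ofReal ?_)⟩
  have := ht.1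
  gcongr

/-- The weight exponent ν(1/r − 1/e) is affine in 1/e, so log-convexity of the norms reproduces the
weight with the same constant K. The case ν = 0, t = 1 is plain interpolation. -/
theorem eLpNorm_le_of_interpolation {r e M : ℝ≥0∞} [hr : Fact (1 ≤ r)] (hre : r ≤ e)
    (heM : e ≤ M) (hM : M ≠ ⊤)
    {ν K t : ℝ} (ht : 0 < t) (hK : 0 ≤ K)
    {u : Lp 𝕜 r (volume : Measure V)} (h1 : ‖u‖ ≤ K)
    (h2 : eLpNorm u M volume ≤ ENNReal.ofReal (K * t ^ (-(ν * (1 / r.toReal - 1 / M.toReal))))) :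
    eLpNorm u e volume ≤ ENNReal.ofReal (K * t ^ (-(ν * (1 / r.toReal - 1 / e.toReal)))) := by
  have he := ne_top_of_le_ne_top hM heM
  have hr' := ne_top_of_le_ne_top he hre
  have hr0 : r ≠ 0 := (one_pos.trans_le hr.out).ne'
  have he0 : e ≠ 0 := (hr0.bot_lt.trans_le hre).ne'
  have hM0 : M ≠ 0 := (he0.bot_lt.trans_le heM).ne'
  have pr := ENNReal.toReal_pos hr0 hr'
  have pe := ENNReal.toReal_pos he0 he
  have pM := ENNReal.toReal_pos hM0 hM
  have l1 : r.toReal ≤ e.toReal := ENNReal.toReal_mono he hre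
  have l2 : e.toReal ≤ M.toReal := ENNReal.toReal_mono hM heM
  have g1 := one_div_le_one_div_of_le pr l1
  have g2 := one_div_le_one_div_of_le pe l2
  obtain ⟨θ, hθ0, hθ1, hθ⟩ : ∃ θ : ℝ, 0 ≤ θ ∧ θ ≤ 1 ∧
      1 / r.toReal - 1 / e.toReal = θ * (1 / r.toReal - 1 / M.toReal) := by
    rcases (g2.trans g1).eq_or_lt with h | h
    · exact ⟨0, le_rfl, zero_le_one, by linarith⟩
    · have h' : 0 < 1 / r.toReal - 1 / M.toReal := by linarith
      refine ⟨(1 / r.toReal - 1 / e.toReal) / (1 / r.toReal - 1 / M.toReal), ?_, ?_, ?_⟩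
      · exact div_nonneg (by linarith) h'.le
      · rw [div_le_one h']; linarith
      · rw [div_mul_cancel₀ _ h'.ne']
  have hi := eLpNorm_le_rpow_mul_rpow (Lp.memLp u).1 hr0 hr' he0 he hM0 hM hθ0 hθ1
    (by
      have : (1 - θ) / r.toReal + θ / M.toReal =
        1 / r.toReal - θ * (1 / r.toReal - 1 / M.toReal) := by ring
      rw [this, ← hθ]; ring)
  have h1' : eLpNorm u r volume ≤ ENNReal.ofReal K := by
    rw [← Lp.enorm_def, ← ofReal_norm]; exact ENNReal.ofReal_le_ofReal h1
  refine hi.trans ?_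
  calc _ ≤ ENNReal.ofReal K ^ (1 - θ) *
        ENNReal.ofReal (K * t ^ (-(ν * (1 / r.toReal - 1 / M.toReal)))) ^ θ := by
        gcongr
    _ = _ := by
        rw [ENNReal.ofReal_rpow_of_nonneg hK (by linarith),
          ENNReal.ofReal_rpow_of_nonneg (by positivity) hθ0, ← ENNReal.ofReal_mul (by positivity),
          Real.mul_rpow hK (by positivity), ← mul_assoc, ← Real.rpow_add_of_nonneg hK
              (by linarith) hθ0,
          sub_add_cancel, Real.rpow_one, ← Real.rpow_mul ht.le, hθ]
        congr 3
        ring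

/-- The smoothing estimate for a single nonlinear term at one time. -/
theorem exists_eLpNorm_convolution_powerNonlinearity_sub_le [Nontrivial V] {p : V → ℂ} {d : ℕ}
    (hp : IsHomogeneousSymbol p d) {α : ℝ} (hα : 0 < α) :
    ∃ A > 0, ∀ t > 0, ∀ {b ε : ℝ}, 0 < b → (ε = 1 ∨ ε = -1) → ∀ {s e o : ℝ≥0∞}, 1 ≤ s → s ≤ o →
      o ≠ ⊤ → e ≠ 0 → e ≠ ⊤ → e.toReal = (b + 1) * s.toReal → ∀ {u v : V → 𝕜}, MemLp u
          e → MemLp v e →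
      eLpNorm (fun x => convolution (heatKernel p α t) (fun y => powerNonlinearity ε b (u y))
          (ContinuousLinearMap.lsmul ℝ ℝ) volume x -
        convolution (heatKernel p α t) (fun y => powerNonlinearity ε b (v y))
          (ContinuousLinearMap.lsmul ℝ ℝ) volume x) o volume ≤
        ENNReal.ofReal (A * t ^ (-(d / (2 * α) + Module.finrank ℝ V / (2 * α) *
          (1 / s.toReal - 1 / o.toReal)))) *
        (ENNReal.ofReal (b + 1) * (eLpNorm u e volume ^ b + eLpNorm v e volume ^ b) *
          eLpNorm (fun x => u x - v x) e volume) := by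
  obtain ⟨A, hA, hk⟩ := exists_kernelBound_heatKernel hp hα
  refine ⟨A, hA, ?_⟩
  intro t ht b ε hb hε s e o hs hso ho he he' h u v hu hv
  have hs' := ne_top_of_le_ne_top ho hso
  have hs0 : s ≠ 0 := (one_pos.trans_le hs).ne'
  have hmem : ∀ {w : V → 𝕜}, MemLp w e → MemLp (fun y => powerNonlinearity ε b (w y)) s := by
    intro w hw
    -- Comparison with the zero function turns the difference estimate into a bound for f(w) itself.
    refine ⟨(continuous_powerNonlinearity hb).comp_aestronglyMeasurable hw.1, ?_⟩
    have h1 := eLpNorm_powerNonlinearity_sub_le hb hε hw.1 (aestronglyMeasurable_const (b := (0:𝕜)))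
      hs hs' he he' h
    simp only [powerNonlinearity_zero, sub_zero] at h1
    refine h1.trans_lt (ENNReal.mul_lt_top (ENNReal.mul_lt_top ENNReal.ofReal_lt_top ?_) hw.2)
    refine ENNReal.add_lt_top.2 ⟨ENNReal.rpow_lt_top_of_nonneg hb.le hw.2.ne, ?_⟩
    refine ENNReal.rpow_lt_top_of_nonneg hb.le ?_
    simp
  have hex : ∀ {w : V → 𝕜}, MemLp w s → ConvolutionExists (heatKernel p α t) w
      (ContinuousLinearMap.lsmul ℝ ℝ) volume := fun hw => (hk t ht).convolutionExists hs hs' hw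
  have heq : (fun x => convolution (heatKernel p α t) (fun y => powerNonlinearity ε b (u y))
          (ContinuousLinearMap.lsmul ℝ ℝ) volume x -
        convolution (heatKernel p α t) (fun y => powerNonlinearity ε b (v y))
          (ContinuousLinearMap.lsmul ℝ ℝ) volume x) =
      convolution (heatKernel p α t)
        (fun y => powerNonlinearity ε b (u y) - powerNonlinearity ε b (v y))
        (ContinuousLinearMap.lsmul ℝ ℝ) volume := by
    ext x
    simp only [convolution]
    rw [← integral_sub (hex (hmem hu) x) (hex (hmem hv) x)]
    simp [smul_sub]
  rw [heq]
  refine (eLpNorm_convolution_le (hk t ht) hs hso ho ((hmem hu).sub (hmem hv))).trans ?_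
  refine mul_le_mul' (le_of_eq ?_)
    (eLpNorm_powerNonlinearity_sub_le hb hε hu.1 hv.1 hs hs' he he' h)
  congr 1
  set θ := 1 / s.toReal - 1 / o.toReal
  have ht' := ht.le
  rw [Real.mul_rpow hA.le (Real.rpow_nonneg ht' _), Real.mul_rpow hA.le (Real.rpow_nonneg ht' _),
    ← Real.rpow_mul ht', ← Real.rpow_mul ht']
  have h1 : A ^ (1 - θ) * A ^ θ = A := by
    rw [← Real.rpow_add hA]; simp
  calc _ = (A ^ (1 - θ) * A ^ θ) * (t ^ (-(d / (2 * α)) * (1 - θ)) *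
        t ^ (-((d + Module.finrank ℝ V) / (2 * α)) * θ)) := by ring
    _ = _ := by
      rw [h1, ← Real.rpow_add ht]
      congr 2
      ring

end Kato

section singleTerm

variable {V : Type*} [NormedAddCommGroup V] [InnerProductSpace ℝ V] [FiniteDimensional ℝ V]
  [MeasurableSpace V] [BorelSpace V] {𝕜 : Type*} [RCLike 𝕜]

/-- The smoothing estimate for a single nonlinear term of the Duhamel integrand, with an
integrable majorant in time. -/
theorem exists_integrable_bound_convolution_powerNonlinearity [Nontrivial V] {p : V → ℂ} {d : ℕ}
    (hp : IsHomogeneousSymbol p d) {α : ℝ} (hα : 0 < α) {b ε : ℝ} (hb : 0 < b)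
    (hε : ε = 1 ∨ ε = -1) {r o M : ℝ≥0∞} [hr : Fact (1 ≤ r)] (hro : r ≤ o) (hoM : o ≤ M)
    (hM : M ≠ ⊤) (hbM : b + 1 ≤ M.toReal)
    (hσ : Module.finrank ℝ V / (2 * α) * (1 / r.toReal - 1 / M.toReal) < 1)
    (hsub : d / (2 * α) + Module.finrank ℝ V / (2 * α) * b / r.toReal < 1) :
    ∃ C > 0, ∀ K ≥ 0, ∀ D ≥ 0, ∀ t > 0, ∃ N : ℝ → ℝ, IntegrableOn N (Ioo 0 t) ∧
      ∫ τ in Ioo 0 t, N τ ≤ C * (t ^ (1 - d / (2 * α) -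
        Module.finrank ℝ V / (2 * α) * b / r.toReal) * K ^ b) * D *
          t ^ (-(Module.finrank ℝ V / (2 * α) * (1 / r.toReal - 1 / o.toReal))) ∧
      ∀ τ ∈ Ioo 0 t, 0 ≤ N τ ∧ ∀ w z : Lp 𝕜 r (volume : Measure V),
        KatoAt (Module.finrank ℝ V / (2 * α) * (1 / r.toReal - 1 / M.toReal)) M K τ w →
        KatoAt (Module.finrank ℝ V / (2 * α) * (1 / r.toReal - 1 / M.toReal)) M K τ z →
        KatoAt (Module.finrank ℝ V / (2 * α) * (1 / r.toReal - 1 / M.toReal)) M D τ (w - z) →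
        eLpNorm (fun x => convolution (heatKernel p α (t - τ))
            (fun y => powerNonlinearity ε b (w y)) (ContinuousLinearMap.lsmul ℝ ℝ) volume x -
          convolution (heatKernel p α (t - τ)) (fun y => powerNonlinearity ε b (z y))
            (ContinuousLinearMap.lsmul ℝ ℝ) volume x) o volume ≤ ENNReal.ofReal (N τ) := by
  set ν : ℝ := Module.finrank ℝ V / (2 * α) with hν
  have hν0 : 0 < ν := by
    have : (0:ℝ) < Module.finrank ℝ V := by exact_mod_cast Module.finrank_pos
    positivity
  have ho := ne_top_of_le_ne_top hM hoM
  have hr' := ne_top_of_le_ne_top ho hro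
  have hρ1 : 1 ≤ r.toReal := by
    rw [← ENNReal.toReal_one]; exact ENNReal.toReal_mono hr' hr.out
  have hro' : r.toReal ≤ o.toReal := ENNReal.toReal_mono ho hro
  have hoM' : o.toReal ≤ M.toReal := ENNReal.toReal_mono hM hoM
  have hδ : 0 ≤ (d:ℝ) / (2 * α) := by positivity
  obtain ⟨e, s, hre, heM, -, hes, hs1, hso, hc1, ha1⟩ := exists_exponents hν0 hρ1
    (hro'.trans hoM') hb hbM hδ hsub hσ hro' hoM'
  have he0 : 0 < e := by linarith
  have hs0 : 0 < s := by linarith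
  have ho0 : 0 < o.toReal := by linarith
  set a := (d:ℝ) / (2 * α) + ν * (1 / s - 1 / o.toReal) with ha
  set γ := ν * (1 / r.toReal - 1 / e) with hγ
  have ha0 : 0 ≤ a := by
    have := one_div_le_one_div_of_le hs0 hso
    have : 0 ≤ ν * (1 / s - 1 / o.toReal) := mul_nonneg hν0.le (by linarith)
    positivity
  have hγ0 : 0 ≤ γ := by
    have := one_div_le_one_div_of_le (by linarith) hre
    exact mul_nonneg hν0.le (by linarith)
  have hc0 : 0 ≤ (b + 1) * γ := by positivity
  obtain ⟨A, hA, hest⟩ := exists_eLpNorm_convolution_powerNonlinearity_sub_le (𝕜 := 𝕜) hp hα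
  obtain ⟨C, hC, hint⟩ := exists_integral_rpow_mul_rpow_le ha0 ha1 hc0 hc1
  refine ⟨2 * A * (b + 1) * C, by positivity, fun K hK D hD t ht => ?_⟩
  -- The factor 2 comes from the sum |w|^b + |z|^b, both of whose terms are controlled by K.
  refine ⟨fun τ => 2 * A * (b + 1) * K ^ b * D * ((t - τ) ^ (-a) * τ ^ (-((b + 1) * γ))),
    (hint t ht).1.const_mul _, ?_, ?_⟩
  · rw [integral_const_mul]
    -- Because 1/s = (b+1)/e, the auxiliary exponents cancel in the total power of t.
    have h1 : t ^ (1 - d / (2 * α) - ν * b / r.toReal) *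
        t ^ (-(ν * (1 / r.toReal - 1 / o.toReal))) = t ^ (1 - a - (b + 1) * γ) := by
      rw [← Real.rpow_add ht]
      congr 1
      have : 1 / s = (b + 1) * (1 / e) := by rw [hes]; field_simp
      simp only [ha, hγ, this]
      ring
    calc _ ≤ 2 * A * (b + 1) * K ^ b * D * (C * t ^ (1 - a - (b + 1) * γ)) := by
          have := (hint t ht).2
          gcongr
      _ = _ := by rw [← h1]; ring
  · rintro τ ⟨h0, h1⟩
    have htτ : 0 < t - τ := by linarith
    refine ⟨by positivity, fun w z hw hz hwz => ?_⟩
    have heE : (ENNReal.ofReal e).toReal = e := ENNReal.toReal_ofReal he0.le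
    have hsE : (ENNReal.ofReal s).toReal = s := ENNReal.toReal_ofReal hs0.le
    have hreE : r ≤ ENNReal.ofReal e := ENNReal.le_ofReal_iff_toReal_le hr' he0.le |>.2 hre
    have heME : ENNReal.ofReal e ≤ M := ENNReal.ofReal_le_iff_le_toReal hM |>.2 heM
    have key : ∀ {k : ℝ}, 0 ≤ k → ∀ {g : Lp 𝕜 r (volume : Measure V)},
        KatoAt (ν * (1 / r.toReal - 1 / M.toReal)) M k τ g →
        eLpNorm g (ENNReal.ofReal e) volume ≤ ENNReal.ofReal (k * τ ^ (-γ)) := by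
      intro k hk g hg
      have := eLpNorm_le_of_interpolation hreE heME hM (ν := ν) h0 hk hg.1 hg.2
      rwa [heE] at this
    have kw := key hK hw
    have kz := key hK hz
    have kd := key hD hwz
    rw [eLpNorm_congr_ae (Lp.coeFn_sub w z)] at kd
    have mem : ∀ {g : Lp 𝕜 r (volume : Measure V)},
        eLpNorm g (ENNReal.ofReal e) volume ≤ ENNReal.ofReal (K * τ ^ (-γ)) →
        MemLp g (ENNReal.ofReal e) := fun h => ⟨(Lp.memLp _).1, h.trans_lt ENNReal.ofReal_lt_top⟩
    have := hest (t - τ) htτ hb hε (s := ENNReal.ofReal s) (e := ENNReal.ofReal e) (o := o)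
      (by rw [← ENNReal.ofReal_one]; exact ENNReal.ofReal_le_ofReal hs1)
      (ENNReal.ofReal_le_iff_le_toReal ho |>.2 hso) ho (by simpa using he0) ENNReal.ofReal_ne_top
      (by rw [heE, hsE, hes]) (mem kw) (mem kz)
    refine this.trans ?_
    rw [hsE]
    have hX : 0 ≤ K * τ ^ (-γ) := by positivity
    calc _ ≤ ENNReal.ofReal (A * (t - τ) ^ (-a)) * (ENNReal.ofReal (b + 1) *
          (ENNReal.ofReal (K * τ ^ (-γ)) ^ b + ENNReal.ofReal (K * τ ^ (-γ)) ^ b) *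
            ENNReal.ofReal (D * τ ^ (-γ))) := by gcongr; exact kd
      _ = ENNReal.ofReal (A * (t - τ) ^ (-a) * ((b + 1) * ((K * τ ^ (-γ)) ^ b +
          (K * τ ^ (-γ)) ^ b) * (D * τ ^ (-γ)))) := by
          rw [ENNReal.ofReal_rpow_of_nonneg hX hb.le, ← ENNReal.ofReal_add (by positivity)
            (by positivity), ← ENNReal.ofReal_mul (by positivity), ← ENNReal.ofReal_mul
            (by positivity), ← ENNReal.ofReal_mul (by positivity)]
      _ = _ := by
          congr 1
          have h2 : τ ^ (-((b + 1) * γ)) = (τ ^ (-γ)) ^ b * τ ^ (-γ) := by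
            rw [← Real.rpow_mul h0.le, ← Real.rpow_add h0]; congr 1; ring
          beta_reduce
          rw [h2, Real.mul_rpow hK (by positivity)]
          ring

end singleTerm

/-! ### Representatives in Lebesgue spaces -/

section lpOf

variable {X : Type*} [MeasurableSpace X] {μ : Measure X} {F : Type*} [NormedAddCommGroup F]

open Classical in
/-- The class of `f` in `L^s`, or `0` if `f` is not in `L^s`. -/
noncomputable def lpOf (s : ℝ≥0∞) (μ : Measure X) (f : X → F) : Lp F s μ :=
  if h : MemLp f s μ then h.toLp f else 0

theorem lpOf_coeFn {s : ℝ≥0∞} {f : X → F} (h : MemLp f s μ) : lpOf s μ f =ᵐ[μ] f := by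
  rw [lpOf, dif_pos h]; exact h.coeFn_toLp

end lpOf

section interpolation

variable {V : Type*} [NormedAddCommGroup V] [InnerProductSpace ℝ V] [FiniteDimensional ℝ V]
  [MeasurableSpace V] [BorelSpace V] {𝕜 : Type*} [RCLike 𝕜]

theorem memLp_of_le_of_le {r e M : ℝ≥0∞} [hr : Fact (1 ≤ r)] (hre : r ≤ e)
    (heM : e ≤ M) (hM : M ≠ ⊤)
    {u : Lp 𝕜 r (volume : Measure V)} (h : MemLp u M) : MemLp u e := by
  refine ⟨h.1, (eLpNorm_le_of_interpolation hre heM hM (ν := 0) (t := 1) one_pos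
    (K := max ‖u‖ (eLpNorm u M volume).toReal) (le_max_of_le_left (norm_nonneg _)) (le_max_left _ _)
    ?_).trans_lt ENNReal.ofReal_lt_top⟩
  rw [zero_mul, neg_zero, Real.rpow_zero, mul_one, ENNReal.le_ofReal_iff_toReal_le h.2.ne
    (le_max_of_le_left (norm_nonneg _))]
  exact le_max_right _ _

/-- `f(u)` lies in a Lebesgue space if `u ∈ L^r ∩ L^M` with `M ≥ b + 1`. -/
theorem exists_memLp_powerNonlinearity {r M : ℝ≥0∞} [hr : Fact (1 ≤ r)] (hrM : r ≤ M) (hM : M ≠ ⊤)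
    {b ε : ℝ} (hb : 0 < b) (hε : ε = 1 ∨ ε = -1) (hbM : b + 1 ≤ M.toReal)
    {u : Lp 𝕜 r (volume : Measure V)} (h : MemLp u M) :
    ∃ s : ℝ≥0∞, 1 ≤ s ∧ s ≤ r ∧ MemLp (fun x => powerNonlinearity ε b (u x)) s := by
  have hr' := ne_top_of_le_ne_top hM hrM
  have hρ1 : 1 ≤ r.toReal := by
    rw [← ENNReal.toReal_one]; exact ENNReal.toReal_mono hr' hr.out
  have hrM' : r.toReal ≤ M.toReal := ENNReal.toReal_mono hM hrM
  -- This exponent makes s = e/(b+1) satisfy 1 ≤ s ≤ r: the upper bound holds because r ≥ 1 gives b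
  -- + 1 ≤ r(b+1).
  set e := max r.toReal (b + 1) with he
  have hb1 : 0 < b + 1 := by linarith
  have he0 : 0 < e := lt_max_of_lt_right hb1
  have hes : e / (b + 1) ≤ r.toReal := by
    rw [div_le_iff₀ hb1]
    refine max_le ?_ ?_ <;> nlinarith
  have h1s : 1 ≤ e / (b + 1) := by rw [one_le_div hb1]; exact le_max_right _ _
  have hue : MemLp u (ENNReal.ofReal e) := by
    refine memLp_of_le_of_le ?_ ?_ hM h
    · exact ENNReal.le_ofReal_iff_toReal_le hr' he0.le |>.2 (le_max_left _ _)
    · exact ENNReal.ofReal_le_iff_le_toReal hM |>.2 (max_le hrM' hbM)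
  have h1s' : 1 ≤ ENNReal.ofReal (e / (b + 1)) := by
    rw [← ENNReal.ofReal_one]; exact ENNReal.ofReal_le_ofReal h1s
  refine ⟨ENNReal.ofReal (e / (b + 1)), h1s', ENNReal.ofReal_le_iff_le_toReal hr' |>.2 hes,
    (continuous_powerNonlinearity hb).comp_aestronglyMeasurable h.1, ?_⟩
  have h1 := eLpNorm_powerNonlinearity_sub_le hb hε h.1 (aestronglyMeasurable_const (b := (0:𝕜)))
      h1s' ENNReal.ofReal_ne_top (by simpa using he0) ENNReal.ofReal_ne_top
      (e := ENNReal.ofReal e) (by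
        rw [ENNReal.toReal_ofReal he0.le, ENNReal.toReal_ofReal (by positivity)]; field_simp)
  simp only [powerNonlinearity_zero, sub_zero] at h1
  refine h1.trans_lt (ENNReal.mul_lt_top (ENNReal.mul_lt_top ENNReal.ofReal_lt_top ?_) hue.2)
  refine ENNReal.add_lt_top.2 ⟨ENNReal.rpow_lt_top_of_nonneg hb.le hue.2.ne, ?_⟩
  refine ENNReal.rpow_lt_top_of_nonneg hb.le ?_
  simp

end interpolation

/-! ### The Duhamel integrand in the subcritical range -/

/-- The standing assumptions: both nonlinear terms are subcritical in `L^r`. -/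
structure IsSubcritical {n : ℕ} (α b₁ b₂ ε₁ ε₂ : ℝ) (P : HigherOrderTerm n) (r : ℝ≥0∞) :
    Prop where
  ne_zero : n ≠ 0
  alpha_pos : 0 < α
  b₂_pos : 0 < b₂
  b₂_lt : b₂ < b₁
  sign₁ : ε₁ = 1 ∨ ε₁ = -1
  sign₂ : ε₂ = 1 ∨ ε₂ = -1
  ne_top : r ≠ ⊤
  lt_one₁ : n / (2 * α) * b₁ / r.toReal < 1
  lt_one₂ : P.degree / (2 * α) + n / (2 * α) * b₂ / r.toReal < 1

/-- The exponent of the time weight in `L^M` for data in `L^r`. -/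
noncomputable def katoExponent (n : ℕ) (α : ℝ) (r M : ℝ≥0∞) : ℝ :=
  n / (2 * α) * (1 / r.toReal - 1 / M.toReal)

/-- The factor that measures the size of the Duhamel term on `(0, t)` for functions of size `K`. -/
noncomputable def duhamelFactor {n : ℕ} (α b₁ b₂ : ℝ) (P : HigherOrderTerm n) (r : ℝ≥0∞)
    (t K : ℝ) : ℝ :=
  t ^ (1 - n / (2 * α) * b₁ / r.toReal) * K ^ b₁ +
    t ^ (1 - P.degree / (2 * α) - n / (2 * α) * b₂ / r.toReal) * K ^ b₂

section duhamel

variable {𝕜 : Type*} [RCLike 𝕜] {n : ℕ} {α b₁ b₂ ε₁ ε₂ : ℝ} {P : HigherOrderTerm n} {r : ℝ≥0∞}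

/-- Admissible choices of the auxiliary exponent `M`. -/
structure IsKatoExponent (n : ℕ) (α b₁ : ℝ) (r M : ℝ≥0∞) : Prop where
  le : r ≤ M
  ne_top : M ≠ ⊤
  b_le : b₁ + 1 ≤ M.toReal
  lt_one : katoExponent n α r M < 1

theorem kernelConv_eq_heatKernel {t : ℝ} (g : EuclideanSpace ℝ (Fin n) → 𝕜) :
    kernelConv (dissipativeKernel n α t) g =
      convolution (heatKernel (fun _ => (1:ℂ)) α t) g (ContinuousLinearMap.lsmul ℝ ℝ) volume := by
  rw [kernelConv, dissipativeKernel_eq]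

theorem duhamelIntegrand_eq (hn : n ≠ 0) (hα : 0 < α) {t : ℝ} (ht : 0 < t)
    (w : EuclideanSpace ℝ (Fin n) → 𝕜) :
    duhamelIntegrand α b₁ b₂ ε₁ ε₂ P t w = fun x =>
      convolution (heatKernel (fun _ => (1:ℂ)) α t) (fun y => powerNonlinearity ε₁ b₁ (w y))
        (ContinuousLinearMap.lsmul ℝ ℝ) volume x +
      convolution (heatKernel P.symbol α t) (fun y => powerNonlinearity ε₂ b₂ (w y))
        (ContinuousLinearMap.lsmul ℝ ℝ) volume x := by
  have : NeZero n := ⟨hn⟩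
  funext x
  simp only [duhamelIntegrand, kernelConv]
  rw [HigherOrderTerm.apply_dissipativeKernel P hα ht, dissipativeKernel_eq]

variable [Fact (1 ≤ r)]

theorem memLp_duhamelIntegrand (h : IsSubcritical α b₁ b₂ ε₁ ε₂ P r) {M : ℝ≥0∞}
    (hM : IsKatoExponent n α b₁ r M) {t : ℝ} (ht : 0 < t)
    {w : Lp 𝕜 r (volume : Measure (EuclideanSpace ℝ (Fin n)))} (hw : MemLp w M) :
    MemLp (duhamelIntegrand α b₁ b₂ ε₁ ε₂ P t w) r := by
  have : NeZero n := ⟨h.ne_zero⟩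
  have : Nonempty (Fin n) := ⟨0⟩
  have hb := h.b₂_pos.trans h.b₂_lt
  obtain ⟨A, -, hA⟩ := exists_kernelBound_heatKernel
    (isHomogeneousSymbol_one (V := EuclideanSpace ℝ (Fin n))) h.alpha_pos
  obtain ⟨B, -, hB⟩ := exists_kernelBound_heatKernel P.isHomogeneousSymbol h.alpha_pos
  obtain ⟨s, h1s, hsr, hs⟩ := exists_memLp_powerNonlinearity hM.le hM.ne_top hb h.sign₁ hM.b_le hw
  obtain ⟨s', h1s', hsr', hs'⟩ := exists_memLp_powerNonlinearity hM.le hM.ne_top h.b₂_pos h.sign₂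
    ((add_le_add_left h.b₂_lt.le 1).trans hM.b_le) hw
  rw [duhamelIntegrand_eq h.ne_zero h.alpha_pos ht]
  exact (memLp_convolution (hA t ht) h1s hsr h.ne_top hs).add
    (memLp_convolution (hB t ht) h1s' hsr' h.ne_top hs')

/-- The class in `L^r` of the integrand of Duhamel's formula. -/
noncomputable def duhamelLp (α b₁ b₂ ε₁ ε₂ : ℝ) (P : HigherOrderTerm n) (t : ℝ)
    (w : Lp 𝕜 r (volume : Measure (EuclideanSpace ℝ (Fin n)))) :
    Lp 𝕜 r (volume : Measure (EuclideanSpace ℝ (Fin n))) :=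
  lpOf r volume (duhamelIntegrand α b₁ b₂ ε₁ ε₂ P t w)

theorem duhamelLp_coeFn (h : IsSubcritical α b₁ b₂ ε₁ ε₂ P r) {M : ℝ≥0∞}
    (hM : IsKatoExponent n α b₁ r M) {t : ℝ} (ht : 0 < t)
    {w : Lp 𝕜 r (volume : Measure (EuclideanSpace ℝ (Fin n)))} (hw : MemLp w M) :
    duhamelLp α b₁ b₂ ε₁ ε₂ P t w =ᵐ[volume] duhamelIntegrand α b₁ b₂ ε₁ ε₂ P t w :=
  lpOf_coeFn (memLp_duhamelIntegrand h hM ht hw)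

/-- The semigroup law for both kernels, applied term by term. It lets S_α(t) pass under the Duhamel
integral when the evolution is restarted. -/
theorem heatOp_duhamelLp (h : IsSubcritical α b₁ b₂ ε₁ ε₂ P r) {M : ℝ≥0∞}
    (hM : IsKatoExponent n α b₁ r M) {t t' : ℝ} (ht : 0 < t) (ht' : 0 < t')
    {w : Lp 𝕜 r (volume : Measure (EuclideanSpace ℝ (Fin n)))} (hw : MemLp w M) :
    heatOp 𝕜 (fun _ => (1:ℂ)) α t r r (duhamelLp α b₁ b₂ ε₁ ε₂ P t' w) =
      duhamelLp α b₁ b₂ ε₁ ε₂ P (t + t') w := by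
  have : NeZero n := ⟨h.ne_zero⟩
  have : Nonempty (Fin n) := ⟨0⟩
  have hb := h.b₂_pos.trans h.b₂_lt
  have h1 := isHomogeneousSymbol_one (V := EuclideanSpace ℝ (Fin n))
  obtain ⟨A, -, hA⟩ := exists_kernelBound_heatKernel h1 h.alpha_pos
  obtain ⟨B, -, hB⟩ := exists_kernelBound_heatKernel P.isHomogeneousSymbol h.alpha_pos
  obtain ⟨s, h1s, hsr, hs⟩ := exists_memLp_powerNonlinearity hM.le hM.ne_top hb h.sign₁ hM.b_le hw
  obtain ⟨s', h1s', hsr', hs'⟩ := exists_memLp_powerNonlinearity hM.le hM.ne_top h.b₂_pos h.sign₂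
    ((add_le_add_left h.b₂_lt.le 1).trans hM.b_le) hw
  have hr1 : (1:ℝ≥0∞) ≤ r := Fact.out
  refine Lp.ext ?_
  refine (heatOp_coeFn h1 h.alpha_pos ht le_rfl h.ne_top _).trans ?_
  refine EventuallyEq.trans ?_ (duhamelLp_coeFn h hM (by positivity) hw).symm
  rw [convolution_congr_ae_right (duhamelLp_coeFn h hM ht' hw),
    duhamelIntegrand_eq h.ne_zero h.alpha_pos ht',
    duhamelIntegrand_eq h.ne_zero h.alpha_pos (by positivity)]
  refine Eventually.of_forall fun x => ?_
  have e1 := congrFun (convolution_heatKernel_heatKernel h1 h.alpha_pos ht ht' h1s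
    (ne_top_of_le_ne_top h.ne_top hsr) hs) x
  have e2 := congrFun (convolution_heatKernel_heatKernel P.isHomogeneousSymbol h.alpha_pos ht ht'
    h1s' (ne_top_of_le_ne_top h.ne_top hsr') hs') x
  beta_reduce
  rw [← e1, ← e2]
  have c1 := (hA t ht).convolutionExists hr1 h.ne_top
    (memLp_convolution (hA t' ht') h1s hsr h.ne_top hs) x
  have c2 := (hA t ht).convolutionExists hr1 h.ne_top
    (memLp_convolution (hB t' ht') h1s' hsr' h.ne_top hs') x
  exact c1.distrib_add c2

/-- The basic estimate for differences of Duhamel terms. -/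
theorem exists_integrable_bound_duhamelLp (h : IsSubcritical α b₁ b₂ ε₁ ε₂ P r) {M o : ℝ≥0∞}
    (hM : IsKatoExponent n α b₁ r M) (hro : r ≤ o) (hoM : o ≤ M) :
    ∃ C > 0, ∀ K ≥ 0, ∀ D ≥ 0, ∀ t > 0, ∃ N : ℝ → ℝ, IntegrableOn N (Ioo 0 t) ∧
      ∫ τ in Ioo 0 t, N τ ≤ C * duhamelFactor α b₁ b₂ P r t K * D * t ^ (-katoExponent n α r o) ∧
      ∀ τ ∈ Ioo 0 t, 0 ≤ N τ ∧ ∀ w z : Lp 𝕜 r (volume : Measure (EuclideanSpace ℝ (Fin n))),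
        KatoAt (katoExponent n α r M) M K τ w → KatoAt (katoExponent n α r M) M K τ z →
        KatoAt (katoExponent n α r M) M D τ (w - z) →
        eLpNorm (duhamelLp α b₁ b₂ ε₁ ε₂ P (t - τ) w - duhamelLp α b₁ b₂ ε₁ ε₂ P (t - τ) z : Lp 𝕜 r
          (volume : Measure (EuclideanSpace ℝ (Fin n)))) o volume ≤ ENNReal.ofReal (N τ) := by
  have : NeZero n := ⟨h.ne_zero⟩
  have : Nonempty (Fin n) := ⟨0⟩
  have hb := h.b₂_pos.trans h.b₂_lt
  have h1 := isHomogeneousSymbol_one (V := EuclideanSpace ℝ (Fin n))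
  have hσ := hM.lt_one
  obtain ⟨C₁, hC₁, H₁⟩ := exists_integrable_bound_convolution_powerNonlinearity (𝕜 := 𝕜) h1
    h.alpha_pos hb h.sign₁ hro hoM hM.ne_top hM.b_le
    (by rw [finrank_euclideanSpace_fin]; exact hσ)
    (by have := h.lt_one₁; simpa using this)
  obtain ⟨C₂, hC₂, H₂⟩ := exists_integrable_bound_convolution_powerNonlinearity (𝕜 := 𝕜)
    P.isHomogeneousSymbol h.alpha_pos h.b₂_pos h.sign₂ hro hoM hM.ne_top
    ((add_le_add_left h.b₂_lt.le 1).trans hM.b_le)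
    (by rw [finrank_euclideanSpace_fin]; exact hσ)
    (by have := h.lt_one₂; rwa [finrank_euclideanSpace_fin])
  refine ⟨max C₁ C₂, lt_max_of_lt_left hC₁, fun K hK D hD t ht => ?_⟩
  obtain ⟨N₁, hN₁, hI₁, hb₁⟩ := H₁ K hK D hD t ht
  obtain ⟨N₂, hN₂, hI₂, hb₂⟩ := H₂ K hK D hD t ht
  rw [finrank_euclideanSpace_fin] at hI₁ hb₁ hI₂ hb₂
  refine ⟨fun τ => N₁ τ + N₂ τ, hN₁.add hN₂, ?_, ?_⟩
  · rw [integral_add hN₁ hN₂]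
    rw [Nat.cast_zero, zero_div, sub_zero] at hI₁
    have := mul_le_mul_of_nonneg_right (le_max_left C₁ C₂)
      (show 0 ≤ t ^ (1 - n / (2 * α) * b₁ / r.toReal) * K ^ b₁ * D *
        t ^ (-katoExponent n α r o) by positivity)
    have := mul_le_mul_of_nonneg_right (le_max_right C₁ C₂)
      (show 0 ≤ t ^ (1 - P.degree / (2 * α) - n / (2 * α) * b₂ / r.toReal) * K ^ b₂ * D *
        t ^ (-katoExponent n α r o) by positivity)
    rw [duhamelFactor]
    rw [← katoExponent] at hI₁ hI₂
    linarith
  · intro τ hτ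
    obtain ⟨p1, q1⟩ := hb₁ τ hτ
    obtain ⟨p2, q2⟩ := hb₂ τ hτ
    refine ⟨add_nonneg p1 p2, fun w z hw hz hwz => ?_⟩
    have htτ : 0 < t - τ := by linarith [hτ.2]
    have mem : ∀ {g : Lp 𝕜 r (volume : Measure (EuclideanSpace ℝ (Fin n)))},
        KatoAt (katoExponent n α r M) M K τ g → MemLp g M :=
      fun hg => ⟨(Lp.memLp _).1, hg.2.trans_lt ENNReal.ofReal_lt_top⟩
    have r1 := q1 w z hw hz hwz
    have r2 := q2 w z hw hz hwz
    rw [ENNReal.ofReal_add p1 p2]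
    have hr1 : (1:ℝ≥0∞) ≤ r := Fact.out
    have meas : ∀ {p : EuclideanSpace ℝ (Fin n) → ℂ} {d : ℕ}, IsHomogeneousSymbol p d → ∀ {b ε : ℝ},
        0 < b → (ε = 1 ∨ ε = -1) → b + 1 ≤ M.toReal →
        ∀ {g : Lp 𝕜 r (volume : Measure (EuclideanSpace ℝ (Fin n)))}, MemLp g M →
        AEStronglyMeasurable (convolution (heatKernel p α (t - τ))
          (fun y => powerNonlinearity ε b (g y)) (ContinuousLinearMap.lsmul ℝ ℝ)
              volume) volume := by
      intro p d hp b ε hb hε hbM g hg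
      obtain ⟨A, -, hA⟩ := exists_kernelBound_heatKernel hp h.alpha_pos
      obtain ⟨s, h1s, hsr, hs⟩ := exists_memLp_powerNonlinearity hM.le hM.ne_top hb hε hbM hg
      exact (memLp_convolution (hA _ htτ) h1s hsr h.ne_top hs).1
    have hbM : b₂ + 1 ≤ M.toReal := (add_le_add_left h.b₂_lt.le 1).trans hM.b_le
    have m1 := (meas h1 hb h.sign₁ hM.b_le (mem hw)).sub (meas h1 hb h.sign₁ hM.b_le (mem hz))
    have m2 := (meas P.isHomogeneousSymbol h.b₂_pos h.sign₂ hbM (mem hw)).sub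
      (meas P.isHomogeneousSymbol h.b₂_pos h.sign₂ hbM (mem hz))
    refine le_trans ?_ ((eLpNorm_add_le m1 m2 (hr1.trans hro)).trans (add_le_add r1 r2))
    refine le_of_eq (eLpNorm_congr_ae ((Lp.coeFn_sub _ _).trans ?_))
    filter_upwards [duhamelLp_coeFn h hM htτ (mem hw), duhamelLp_coeFn h hM htτ
        (mem hz)] with x e1 e2
    rw [Pi.sub_apply, e1, e2, duhamelIntegrand_eq h.ne_zero h.alpha_pos htτ,
      duhamelIntegrand_eq h.ne_zero h.alpha_pos htτ]
    simp only [Pi.add_apply, Pi.sub_apply]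
    ring

end duhamel

/-! ### Continuity of the nonlinear terms -/

section timeContinuity

variable {V : Type*} [NormedAddCommGroup V] [InnerProductSpace ℝ V] [FiniteDimensional ℝ V]
  [MeasurableSpace V] [BorelSpace V] {𝕜 : Type*} [RCLike 𝕜]

/-- Convergence in `L^r` and boundedness in `L^M` imply convergence in between. -/
theorem tendsto_eLpNorm_sub_of_bounded {r e M : ℝ≥0∞} [hr : Fact (1 ≤ r)]
    (hre : r ≤ e) (heM : e < M)
    (hM : M ≠ ⊤) {ι : Type*} {l : Filter ι} {w : ι → Lp 𝕜 r (volume : Measure V)}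
    {w₀ : Lp 𝕜 r (volume : Measure V)} (hw : Tendsto w l (𝓝 w₀)) {c : ℝ≥0∞} (hc : c ≠ ⊤)
    (hwc : ∀ᶠ i in l, eLpNorm (w i) M volume ≤ c) (hwc₀ : eLpNorm w₀ M volume ≤ c) :
    Tendsto (fun i => eLpNorm (fun x => w i x - w₀ x) e volume) l (𝓝 0) := by
  have he := heM.ne_top
  have hr' := ne_top_of_le_ne_top he hre
  have hr0 : r ≠ 0 := (one_pos.trans_le hr.out).ne'
  have he0 : e ≠ 0 := (hr0.bot_lt.trans_le hre).ne'
  have hM0 : M ≠ 0 := (he0.bot_lt.trans heM).ne'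
  have hM1 : 1 ≤ M := (hr.out.trans hre).trans heM.le
  have pr := ENNReal.toReal_pos hr0 hr'
  have pe := ENNReal.toReal_pos he0 he
  have l1 : r.toReal ≤ e.toReal := ENNReal.toReal_mono he hre
  have l2 : e.toReal < M.toReal := ENNReal.toReal_strict_mono hM heM
  have g1 := one_div_le_one_div_of_le pr l1
  have g2 := one_div_lt_one_div_of_lt pe l2
  have h' : 0 < 1 / r.toReal - 1 / M.toReal := by linarith
  -- The strict inequality e < M gives θ < 1, so the vanishing L^r factor enters with a positive
  -- power.
  obtain ⟨θ, hθ0, hθ1, hθ⟩ : ∃ θ : ℝ, 0 ≤ θ ∧ θ < 1 ∧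
      1 / r.toReal - 1 / e.toReal = θ * (1 / r.toReal - 1 / M.toReal) := by
    refine ⟨(1 / r.toReal - 1 / e.toReal) / (1 / r.toReal - 1 / M.toReal), ?_, ?_, ?_⟩
    · exact div_nonneg (by linarith) h'.le
    · rw [div_lt_one h']; linarith
    · rw [div_mul_cancel₀ _ h'.ne']
  have hlim : Tendsto (fun i => eLpNorm (fun x => w i x - w₀ x) r volume) l (𝓝 0) := by
    rw [Lp.tendsto_Lp_iff_tendsto_eLpNorm'] at hw
    exact hw
  have h3 : Tendsto (fun i => eLpNorm (fun x => w i x - w₀ x) r volume ^ (1 - θ) * (c + c) ^ θ) l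
      (𝓝 0) := by
    have h4 := (ENNReal.continuous_rpow_const (y := 1 - θ)).tendsto 0 |>.comp hlim
    rw [ENNReal.zero_rpow_of_pos (by linarith)] at h4
    have := ENNReal.Tendsto.mul_const (b := (c + c) ^ θ) h4
      (Or.inr (ENNReal.rpow_ne_top_of_nonneg hθ0 (by finiteness)))
    rwa [zero_mul] at this
  refine tendsto_of_tendsto_of_tendsto_of_le_of_le' tendsto_const_nhds h3
    (Eventually.of_forall fun _ => zero_le) ?_
  filter_upwards [hwc] with i hi
  have m := ((Lp.memLp (w i)).1.sub (Lp.memLp w₀).1)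
  refine (eLpNorm_le_rpow_mul_rpow m hr0 hr' he0 he hM0 hM hθ0 hθ1.le (by
      have : (1 - θ) / r.toReal + θ / M.toReal =
        1 / r.toReal - θ * (1 / r.toReal - 1 / M.toReal) := by ring
      rw [this, ← hθ]; ring)).trans ?_
  gcongr
  · rfl
  · exact (eLpNorm_sub_le (Lp.memLp (w i)).1 (Lp.memLp w₀).1 hM1).trans (add_le_add hi hwc₀)

/-- Continuity of the nonlinearity, followed by the smoothing operator. -/
theorem tendsto_lpOf_convolution_powerNonlinearity [Nontrivial V] {p : V → ℂ} {d : ℕ}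
    (hp : IsHomogeneousSymbol p d) {α : ℝ} (hα : 0 < α) {b ε : ℝ} (hb : 0 < b)
    (hε : ε = 1 ∨ ε = -1) {r M : ℝ≥0∞} [hr : Fact (1 ≤ r)] (hrM : r < M)
    (hM : M ≠ ⊤) (hbM : b + 1 < M.toReal)
    {ι : Type*} {l : Filter ι} {w : ι → Lp 𝕜 r (volume : Measure V)}
    {w₀ : Lp 𝕜 r (volume : Measure V)} (hw : Tendsto w l (𝓝 w₀)) {c : ℝ≥0∞} (hc : c ≠ ⊤)
    (hwc : ∀ᶠ i in l, eLpNorm (w i) M volume ≤ c) (hwc₀ : eLpNorm w₀ M volume ≤ c)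
    {t : ι → ℝ} {t₀ : ℝ} (ht₀ : 0 < t₀) (ht : Tendsto t l (𝓝 t₀)) :
    Tendsto (fun i => lpOf r volume (convolution (heatKernel p α (t i))
        (fun y => powerNonlinearity ε b (w i y)) (ContinuousLinearMap.lsmul ℝ ℝ) volume)) l
      (𝓝 (lpOf r volume (convolution (heatKernel p α t₀)
        (fun y => powerNonlinearity ε b (w₀ y)) (ContinuousLinearMap.lsmul ℝ ℝ) volume))) := by
  have hr' : r ≠ ⊤ := hrM.ne_top
  have hρ1 : 1 ≤ r.toReal := by
    rw [← ENNReal.toReal_one]; exact ENNReal.toReal_mono hr' hr.out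
  have hrM' : r.toReal < M.toReal := ENNReal.toReal_strict_mono hM hrM
  -- The strict inequalities r < M and b + 1 < M keep e below M, where L^r convergence and an L^M
  -- bound imply L^e convergence.
  set e := max r.toReal (b + 1) with he
  have hb1 : 0 < b + 1 := by linarith
  have he0 : 0 < e := lt_max_of_lt_right hb1
  have hes : e / (b + 1) ≤ r.toReal := by
    rw [div_le_iff₀ hb1]
    refine max_le ?_ ?_ <;> nlinarith
  have h1s : 1 ≤ e / (b + 1) := by rw [one_le_div hb1]; exact le_max_right _ _
  have hreE : r ≤ ENNReal.ofReal e := ENNReal.le_ofReal_iff_toReal_le hr' he0.le |>.2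
      (le_max_left _ _)
  have heM : ENNReal.ofReal e < M := ENNReal.ofReal_lt_iff_lt_toReal he0.le hM |>.2
      (max_lt hrM' hbM)
  have h1s' : 1 ≤ ENNReal.ofReal (e / (b + 1)) := by
    rw [← ENNReal.ofReal_one]; exact ENNReal.ofReal_le_ofReal h1s
  have hsr : ENNReal.ofReal (e / (b + 1)) ≤ r := ENNReal.ofReal_le_iff_le_toReal hr' |>.2 hes
  set s := ENNReal.ofReal (e / (b + 1)) with hs
  have : Fact (1 ≤ s) := ⟨h1s'⟩
  have hsE : (ENNReal.ofReal e).toReal = (b + 1) * s.toReal := by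
    rw [hs, ENNReal.toReal_ofReal he0.le, ENNReal.toReal_ofReal (by positivity)]; field_simp
  have hMe : ∀ {g : Lp 𝕜 r (volume : Measure V)}, eLpNorm g M volume ≤ c →
      MemLp g (ENNReal.ofReal e) := fun h =>
    memLp_of_le_of_le hreE heM.le hM ⟨(Lp.memLp _).1, h.trans_lt hc.lt_top⟩
  have hN : ∀ {g g' : Lp 𝕜 r (volume : Measure V)},
      eLpNorm (fun x => powerNonlinearity ε b (g x) - powerNonlinearity ε b (g' x)) s volume ≤
        ENNReal.ofReal (b + 1) * (eLpNorm g (ENNReal.ofReal e) volume ^ b +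
          eLpNorm g' (ENNReal.ofReal e) volume ^ b) *
          eLpNorm (fun x => g x - g' x) (ENNReal.ofReal e) volume := fun {g g'} =>
    eLpNorm_powerNonlinearity_sub_le hb hε (Lp.memLp g).1 (Lp.memLp g').1 h1s'
      ENNReal.ofReal_ne_top (by simpa using he0) ENNReal.ofReal_ne_top hsE
  have hmem : ∀ {g : Lp 𝕜 r (volume : Measure V)}, eLpNorm g M volume ≤ c →
      MemLp (fun x => powerNonlinearity ε b (g x)) s := by
    intro g hg
    refine ⟨(continuous_powerNonlinearity hb).comp_aestronglyMeasurable (Lp.memLp g).1, ?_⟩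
    have h1 := eLpNorm_powerNonlinearity_sub_le hb hε (Lp.memLp g).1
      (aestronglyMeasurable_const (b := (0:𝕜))) h1s' ENNReal.ofReal_ne_top (by simpa using he0)
      ENNReal.ofReal_ne_top hsE
    simp only [powerNonlinearity_zero, sub_zero] at h1
    have hge := (hMe hg).2
    refine h1.trans_lt (ENNReal.mul_lt_top (ENNReal.mul_lt_top ENNReal.ofReal_lt_top ?_) hge)
    refine ENNReal.add_lt_top.2 ⟨ENNReal.rpow_lt_top_of_nonneg hb.le hge.ne, ?_⟩
    refine ENNReal.rpow_lt_top_of_nonneg hb.le ?_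
    simp
  set f : Lp 𝕜 r (volume : Measure V) → Lp 𝕜 s (volume : Measure V) := fun g =>
    lpOf s volume (fun x => powerNonlinearity ε b (g x)) with hf
  have hfeq : ∀ {g : Lp 𝕜 r (volume : Measure V)} {τ : ℝ}, eLpNorm g M volume ≤ c → 0 < τ →
      lpOf r volume (convolution (heatKernel p α τ)
        (fun y => powerNonlinearity ε b (g y)) (ContinuousLinearMap.lsmul ℝ ℝ) volume) =
      heatOp 𝕜 p α τ s r (f g) := by
    intro g τ hg hτ
    obtain ⟨A, -, hA⟩ := exists_kernelBound_heatKernel hp hα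
    refine Lp.ext ((lpOf_coeFn (memLp_convolution (hA τ hτ) h1s' hsr hr' (hmem hg))).trans ?_)
    refine EventuallyEq.trans ?_ (heatOp_coeFn hp hα hτ hsr hr' (f g)).symm
    rw [convolution_congr_ae_right (lpOf_coeFn (hmem hg))]
  have hflim : Tendsto (fun i => f (w i)) l (𝓝 (f w₀)) := by
    rw [Lp.tendsto_Lp_iff_tendsto_eLpNorm']
    have hlim := tendsto_eLpNorm_sub_of_bounded hreE heM hM hw hc hwc hwc₀
    obtain ⟨B, hB, hBt⟩ : ∃ B : ℝ≥0∞, B ≠ ⊤ ∧ ∀ᶠ i in l, eLpNorm (w i) (ENNReal.ofReal e)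
        volume ≤ B := by
      refine ⟨1 + eLpNorm w₀ (ENNReal.ofReal e) volume, ENNReal.add_ne_top.2
        ⟨ENNReal.one_ne_top, (hMe hwc₀).2.ne⟩, ?_⟩
      filter_upwards [hlim.eventually_le_const one_pos] with i hi
      have h1 : (w i : V → 𝕜) = (fun x => w i x - w₀ x) + w₀ := by ext x; simp
      rw [h1]
      exact (eLpNorm_add_le ((Lp.memLp (w i)).1.sub (Lp.memLp w₀).1) (Lp.memLp w₀).1
        (hr.out.trans hreE)).trans (add_le_add_left hi _)
    have h3 := ENNReal.Tendsto.const_mul (a := ENNReal.ofReal (b + 1) *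
        (B ^ b + eLpNorm w₀ (ENNReal.ofReal e) volume ^ b)) hlim (Or.inr (by
          have h5 := ENNReal.rpow_ne_top_of_nonneg hb.le hB
          have h6 := ENNReal.rpow_ne_top_of_nonneg hb.le (hMe hwc₀).2.ne
          finiteness))
    rw [mul_zero] at h3
    refine tendsto_of_tendsto_of_tendsto_of_le_of_le' tendsto_const_nhds h3
      (Eventually.of_forall fun _ => zero_le) ?_
    filter_upwards [hwc, hBt] with i hi hBi
    calc _ = eLpNorm (fun x => powerNonlinearity ε b (w i x) - powerNonlinearity ε b (w₀ x)) s volume := by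
          refine eLpNorm_congr_ae ?_
          filter_upwards [lpOf_coeFn (hmem hi), lpOf_coeFn (hmem hwc₀)] with x h1 h2
          simp only [hf, Pi.sub_apply, h1, h2]
      _ ≤ _ := hN
      _ ≤ _ := by gcongr
  rw [hfeq hwc₀ ht₀]
  refine (tendsto_heatOp hp hα hsr hr' ht₀ ht hflim).congr' ?_
  filter_upwards [hwc, ht.eventually_const_lt ht₀] with i hi hti
  exact (hfeq hi hti).symm

end timeContinuity

/-! ### The Duhamel integral -/

section duhamelIntegral

variable {𝕜 : Type*} [RCLike 𝕜] {n : ℕ} {α b₁ b₂ ε₁ ε₂ : ℝ} {P : HigherOrderTerm n} {r : ℝ≥0∞}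

/-- With this, bounds for a single curve are difference estimates against the zero curve. -/
theorem duhamelLp_zero (h : IsSubcritical α b₁ b₂ ε₁ ε₂ P r) {t : ℝ} (ht : 0 < t) :
    duhamelLp α b₁ b₂ ε₁ ε₂ P t
      (0 : Lp 𝕜 r (volume : Measure (EuclideanSpace ℝ (Fin n)))) = 0 := by
  have key : duhamelIntegrand α b₁ b₂ ε₁ ε₂ P t
      (0 : Lp 𝕜 r (volume : Measure (EuclideanSpace ℝ (Fin n)))) = 0 := by
    have e : ∀ b ε : ℝ, (fun y => powerNonlinearity ε b
        ((0 : Lp 𝕜 r (volume : Measure (EuclideanSpace ℝ (Fin n)))) y)) =ᵐ[volume] 0 := by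
      intro b ε
      filter_upwards [Lp.coeFn_zero 𝕜 r (volume : Measure (EuclideanSpace ℝ (Fin n)))] with x hx
      rw [hx]; exact powerNonlinearity_zero
    rw [duhamelIntegrand_eq h.ne_zero h.alpha_pos ht, convolution_congr_ae_right (e b₁ ε₁),
      convolution_congr_ae_right (e b₂ ε₂)]
    simp [convolution_zero]
    rfl
  have hz : MemLp (0 : EuclideanSpace ℝ (Fin n) → 𝕜) r volume := MemLp.zero
  rw [duhamelLp, key]
  exact Lp.ext ((lpOf_coeFn hz).trans (Lp.coeFn_zero _ _ _).symm)

theorem KatoAt.memLp {σ K t : ℝ} {M : ℝ≥0∞}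
    {w : Lp 𝕜 r (volume : Measure (EuclideanSpace ℝ (Fin n)))} (h : KatoAt σ M K t w) :
    MemLp w M :=
  ⟨(Lp.memLp _).1, h.2.trans_lt ENNReal.ofReal_lt_top⟩

variable [Fact (1 ≤ r)]

theorem tendsto_duhamelLp (h : IsSubcritical α b₁ b₂ ε₁ ε₂ P r) {M : ℝ≥0∞}
    (hM : IsKatoExponent n α b₁ r M) (hrM : r < M) (hbM : b₁ + 1 < M.toReal)
    {ι : Type*} {l : Filter ι} {w : ι → Lp 𝕜 r (volume : Measure (EuclideanSpace ℝ (Fin n)))}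
    {w₀ : Lp 𝕜 r (volume : Measure (EuclideanSpace ℝ (Fin n)))} (hw : Tendsto w l (𝓝 w₀))
    {c : ℝ≥0∞} (hc : c ≠ ⊤)
    (hwc : ∀ᶠ i in l, eLpNorm (w i) M volume ≤ c) (hwc₀ : eLpNorm w₀ M volume ≤ c)
    {t : ι → ℝ} {t₀ : ℝ} (ht₀ : 0 < t₀) (ht : Tendsto t l (𝓝 t₀)) :
    Tendsto (fun i => duhamelLp α b₁ b₂ ε₁ ε₂ P (t i) (w i)) l
      (𝓝 (duhamelLp α b₁ b₂ ε₁ ε₂ P t₀ w₀)) := by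
  have : NeZero n := ⟨h.ne_zero⟩
  have : Nonempty (Fin n) := ⟨0⟩
  have hb := h.b₂_pos.trans h.b₂_lt
  have h1 := isHomogeneousSymbol_one (V := EuclideanSpace ℝ (Fin n))
  have L₁ := tendsto_lpOf_convolution_powerNonlinearity h1 h.alpha_pos hb h.sign₁ hrM hM.ne_top hbM
    hw hc hwc hwc₀ ht₀ ht
  have L₂ := tendsto_lpOf_convolution_powerNonlinearity P.isHomogeneousSymbol h.alpha_pos h.b₂_pos
    h.sign₂ hrM hM.ne_top ((add_le_add_left h.b₂_lt.le 1).trans_lt hbM) hw hc hwc hwc₀ ht₀ ht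
  have key : ∀ {g : Lp 𝕜 r (volume : Measure (EuclideanSpace ℝ (Fin n)))} {τ : ℝ},
      eLpNorm g M volume ≤ c → 0 < τ → duhamelLp α b₁ b₂ ε₁ ε₂ P τ g =
      lpOf r volume (convolution (heatKernel (fun _ => (1:ℂ)) α τ)
        (fun y => powerNonlinearity ε₁ b₁ (g y)) (ContinuousLinearMap.lsmul ℝ ℝ) volume) +
      lpOf r volume (convolution (heatKernel P.symbol α τ)
        (fun y => powerNonlinearity ε₂ b₂ (g y)) (ContinuousLinearMap.lsmul ℝ ℝ) volume) := by
    intro g τ hg hτ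
    have hgM : MemLp g M := ⟨(Lp.memLp _).1, hg.trans_lt hc.lt_top⟩
    obtain ⟨A, -, hA⟩ := exists_kernelBound_heatKernel h1 h.alpha_pos
    obtain ⟨B, -, hB⟩ := exists_kernelBound_heatKernel P.isHomogeneousSymbol h.alpha_pos
    obtain ⟨s, h1s, hsr, hs⟩ := exists_memLp_powerNonlinearity hM.le hM.ne_top hb
        h.sign₁ hM.b_le hgM
    obtain ⟨s', h1s', hsr', hs'⟩ := exists_memLp_powerNonlinearity hM.le hM.ne_top h.b₂_pos h.sign₂
      ((add_le_add_left h.b₂_lt.le 1).trans hM.b_le) hgM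
    refine Lp.ext ((duhamelLp_coeFn h hM hτ hgM).trans ?_)
    refine EventuallyEq.trans ?_ (Lp.coeFn_add _ _).symm
    filter_upwards [lpOf_coeFn (memLp_convolution (hA τ hτ) h1s hsr h.ne_top hs),
      lpOf_coeFn (memLp_convolution (hB τ hτ) h1s' hsr' h.ne_top hs')] with x e1 e2
    rw [Pi.add_apply, e1, e2, duhamelIntegrand_eq h.ne_zero h.alpha_pos hτ]
  rw [key hwc₀ ht₀]
  refine (L₁.add L₂).congr' ?_
  filter_upwards [hwc, ht.eventually_const_lt ht₀] with i hi hti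
  exact (key hi hti).symm

theorem KatoAt.zero {σ K t : ℝ} {M : ℝ≥0∞} (hK : 0 ≤ K) :
    KatoAt σ M K t (0 : Lp 𝕜 r (volume : Measure (EuclideanSpace ℝ (Fin n)))) := by
  refine ⟨by simpa using hK, ?_⟩
  rw [eLpNorm_congr_ae (Lp.coeFn_zero _ _ _)]
  simp

theorem katoExponent_self {n : ℕ} {α : ℝ} {r : ℝ≥0∞} : katoExponent n α r r = 0 := by
  simp [katoExponent]

theorem katoExponent_nonneg {n : ℕ} {α : ℝ} (hα : 0 < α) {r M : ℝ≥0∞} [hr : Fact (1 ≤ r)]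
    (hrM : r ≤ M) (hM : M ≠ ⊤) : 0 ≤ katoExponent n α r M := by
  have h1 : 0 < r.toReal :=
    ENNReal.toReal_pos (one_pos.trans_le hr.out).ne' (ne_top_of_le_ne_top hM hrM)
  have := one_div_le_one_div_of_le h1 (ENNReal.toReal_mono hM hrM)
  exact mul_nonneg (by positivity) (by linarith)

/-- The Duhamel integrals of two curves differ by a small multiple of the difference of the
curves. -/
theorem exists_katoAt_integral_sub (h : IsSubcritical α b₁ b₂ ε₁ ε₂ P r) {M : ℝ≥0∞}
    (hM : IsKatoExponent n α b₁ r M) :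
    ∃ C > 0, ∀ K ≥ 0, ∀ D ≥ 0, ∀ t > 0,
      ∀ u v : ℝ → Lp 𝕜 r (volume : Measure (EuclideanSpace ℝ (Fin n))),
      KatoBound (katoExponent n α r M) M K t u → KatoBound (katoExponent n α r M) M K t v →
      KatoBound (katoExponent n α r M) M D t (fun τ => u τ - v τ) →
      IntegrableOn (fun τ => duhamelLp α b₁ b₂ ε₁ ε₂ P (t - τ) (u τ)) (Ioo 0 t) →
      IntegrableOn (fun τ => duhamelLp α b₁ b₂ ε₁ ε₂ P (t - τ) (v τ)) (Ioo 0 t) →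
      KatoAt (katoExponent n α r M) M (C * duhamelFactor α b₁ b₂ P r t K * D) t
        ((∫ τ in Ioo 0 t, duhamelLp α b₁ b₂ ε₁ ε₂ P (t - τ) (u τ)) -
          ∫ τ in Ioo 0 t, duhamelLp α b₁ b₂ ε₁ ε₂ P (t - τ) (v τ)) := by
  have hr1 : (1:ℝ≥0∞) ≤ r := Fact.out
  -- The two components of `KatoAt` are the target exponents o = r, where the time weight is
  -- trivial, and o = M.
  obtain ⟨C₁, hC₁, H₁⟩ := exists_integrable_bound_duhamelLp (𝕜 := 𝕜) h hM le_rfl hM.le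
  obtain ⟨C₂, hC₂, H₂⟩ := exists_integrable_bound_duhamelLp (𝕜 := 𝕜) h hM hM.le le_rfl
  refine ⟨max C₁ C₂, lt_max_of_lt_left hC₁, ?_⟩
  intro K hK D hD t ht u v hu hv huv iu iv
  have hfac : 0 ≤ duhamelFactor α b₁ b₂ P r t K := by unfold duhamelFactor; positivity
  rw [← integral_sub iu iv]
  have key : ∀ {o : ℝ≥0∞} {N : ℝ → ℝ}, 1 ≤ o → IntegrableOn N (Ioo 0 t) →
      (∀ τ ∈ Ioo 0 t, 0 ≤ N τ ∧ ∀ w z : Lp 𝕜 r (volume : Measure (EuclideanSpace ℝ (Fin n))),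
        KatoAt (katoExponent n α r M) M K τ w → KatoAt (katoExponent n α r M) M K τ z →
        KatoAt (katoExponent n α r M) M D τ (w - z) →
        eLpNorm (duhamelLp α b₁ b₂ ε₁ ε₂ P (t - τ) w - duhamelLp α b₁ b₂ ε₁ ε₂ P (t - τ) z : Lp 𝕜 r
          (volume : Measure (EuclideanSpace ℝ (Fin n)))) o volume ≤ ENNReal.ofReal (N τ)) →
      eLpNorm (∫ τ in Ioo 0 t, (duhamelLp α b₁ b₂ ε₁ ε₂ P (t - τ) (u τ) -
        duhamelLp α b₁ b₂ ε₁ ε₂ P (t - τ) (v τ)) : Lp 𝕜 r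
          (volume : Measure (EuclideanSpace ℝ (Fin n)))) o volume ≤
        ENNReal.ofReal (∫ τ in Ioo 0 t, N τ) := by
    intro o N ho hN hb
    have : IsFiniteMeasure (volume.restrict (Ioo 0 t)) := ⟨by simp⟩
    refine eLpNorm_integral_le ho (iu.sub iv) hN ?_
    filter_upwards [ae_restrict_mem measurableSet_Ioo] with τ hτ
    exact ⟨(hb τ hτ).1, (hb τ hτ).2 _ _ (hu τ hτ) (hv τ hτ) (huv τ hτ)⟩
  obtain ⟨N₁, hN₁, hI₁, hb₁⟩ := H₁ K hK D hD t ht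
  obtain ⟨N₂, hN₂, hI₂, hb₂⟩ := H₂ K hK D hD t ht
  constructor
  · have := (key hr1 hN₁ hb₁).trans (ENNReal.ofReal_le_ofReal hI₁)
    rw [katoExponent_self, neg_zero, Real.rpow_zero, mul_one] at this
    rw [Lp.norm_def]
    refine (ENNReal.toReal_le_of_le_ofReal (by positivity) this).trans ?_
    gcongr
    exact le_max_left _ _
  · refine (key (hr1.trans hM.le) hN₂ hb₂).trans (ENNReal.ofReal_le_ofReal (hI₂.trans ?_))
    gcongr
    exact le_max_right _ _

/-- Integrability of the Duhamel integrand along a continuous curve. -/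
theorem integrableOn_duhamelLp (h : IsSubcritical α b₁ b₂ ε₁ ε₂ P r) {M : ℝ≥0∞}
    (hM : IsKatoExponent n α b₁ r M) (hrM : r < M) (hbM : b₁ + 1 < M.toReal) {K t : ℝ} (hK : 0 ≤ K)
    (ht : 0 < t) {u : ℝ → Lp 𝕜 r (volume : Measure (EuclideanSpace ℝ (Fin n)))}
    (hu : KatoBound (katoExponent n α r M) M K t u) (hcont : ContinuousOn u (Ioo 0 t)) :
    IntegrableOn (fun τ => duhamelLp α b₁ b₂ ε₁ ε₂ P (t - τ) (u τ)) (Ioo 0 t) := by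
  obtain ⟨C₁, hC₁, H₁⟩ := exists_integrable_bound_duhamelLp (𝕜 := 𝕜) h hM le_rfl hM.le
  obtain ⟨N₁, hN₁, hI₁, hb₁⟩ := H₁ K hK K hK t ht
  have hσ := katoExponent_nonneg (n := n) h.alpha_pos hM.le hM.ne_top
  refine hN₁.mono' (ContinuousOn.aestronglyMeasurable ?_ measurableSet_Ioo) ?_
  · intro τ hτ
    have hτ2 : 0 < τ / 2 := by linarith [hτ.1]
    -- Beyond τ/2 the weighted bound becomes a uniform L^M bound, as the continuity of the integrand
    -- at τ requires.
    have hev : ∀ x ∈ Ioo 0 t, τ / 2 ≤ x → eLpNorm (u x) M volume ≤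
        ENNReal.ofReal (K * (τ / 2) ^ (-katoExponent n α r M)) := by
      intro x hx hx2
      refine (hu x hx).2.trans (ENNReal.ofReal_le_ofReal ?_)
      have := Real.rpow_le_rpow_of_nonpos hτ2 hx2 (neg_nonpos.2 hσ)
      gcongr
    refine tendsto_duhamelLp h hM hrM hbM (hcont τ hτ) ENNReal.ofReal_ne_top ?_
      (hev τ hτ (by linarith)) (by linarith [hτ.2]) ?_
    · filter_upwards [self_mem_nhdsWithin, mem_nhdsWithin_of_mem_nhds
        (Ioi_mem_nhds (show τ / 2 < τ by linarith))] with x hx hx2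
      exact hev x hx (le_of_lt hx2)
    · exact ((continuous_const.sub continuous_id).tendsto τ).mono_left nhdsWithin_le_nhds
  · filter_upwards [ae_restrict_mem measurableSet_Ioo] with τ hτ
    obtain ⟨p, q⟩ := hb₁ τ hτ
    have := q (u τ) 0 (hu τ hτ) (KatoAt.zero hK) (by rw [sub_zero]; exact hu τ hτ)
    rw [duhamelLp_zero h (by linarith [hτ.2]), sub_zero] at this
    rw [Lp.norm_def]
    exact ENNReal.toReal_le_of_le_ofReal p this

end duhamelIntegral

/-! ### The integral equation: restarting, gluing, continuity -/

/-- The Lebesgue space `L^r(ℝⁿ)`. -/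
noncomputable abbrev LpRn (𝕜 : Type*) [RCLike 𝕜] (n : ℕ) (r : ℝ≥0∞) :=
  Lp 𝕜 r (volume : Measure (EuclideanSpace ℝ (Fin n)))

/-- The semigroup `S_α(t)` on `L^r(ℝⁿ)`. -/
noncomputable abbrev dissipativeSemigroup (𝕜 : Type*) [RCLike 𝕜] (n : ℕ) (α : ℝ) (r : ℝ≥0∞)
    [Fact (1 ≤ r)] (t : ℝ) : LpRn 𝕜 n r →L[ℝ] LpRn 𝕜 n r :=
  heatOp 𝕜 (fun _ : EuclideanSpace ℝ (Fin n) => (1:ℂ)) α t r r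

theorem integrableOn_comp_add_iff {F : Type*} [NormedAddCommGroup F] {G : ℝ → F} {s t : ℝ} :
    IntegrableOn (fun τ => G (s + τ)) (Ioo 0 t) ↔ IntegrableOn G (Ioo s (s + t)) := by
  have := (measurePreserving_add_left volume s).integrableOn_comp_preimage
    (measurableEmbedding_addLeft s) (f := G) (s := Ioo s (s + t))
  simpa [Function.comp_def] using this

theorem setIntegral_comp_add {F : Type*} [NormedAddCommGroup F] [NormedSpace ℝ F] (G : ℝ → F)
    (s t : ℝ) : ∫ τ in Ioo 0 t, G (s + τ) = ∫ τ in Ioo s (s + t), G τ := by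
  have := (measurePreserving_add_left volume s).setIntegral_preimage_emb
    (measurableEmbedding_addLeft s) G (Ioo s (s + t))
  simpa using this

theorem setIntegral_Ioo_add {F : Type*} [NormedAddCommGroup F] [NormedSpace ℝ F] {G : ℝ → F}
    {s t : ℝ} (hs : 0 < s) (ht : s < t) (h1 : IntegrableOn G (Ioo 0 s))
        (h2 : IntegrableOn G (Ioo s t)) :
    IntegrableOn G (Ioo 0 t) ∧
      ∫ τ in Ioo 0 t, G τ = (∫ τ in Ioo 0 s, G τ) + ∫ τ in Ioo s t, G τ := by
  have e1 : IntegrableOn G (Ioc 0 s) := (integrableOn_Ioc_iff_integrableOn_Ioo).2 h1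
  have hU : Ioc 0 s ∪ Ioo s t = Ioo 0 t := Ioc_union_Ioo_eq_Ioo hs.le ht
  refine ⟨hU ▸ e1.union h2, ?_⟩
  rw [← hU, setIntegral_union _ measurableSet_Ioo e1 h2, integral_Ioc_eq_integral_Ioo]
  rw [Set.disjoint_left]
  intro x hx hx'
  exact absurd hx.2 (not_le.2 hx'.1)

section IsDuhamel

variable {𝕜 : Type*} [RCLike 𝕜] {n : ℕ} {α b₁ b₂ ε₁ ε₂ : ℝ} {P : HigherOrderTerm n} {r : ℝ≥0∞}

theorem duhamelFactor_nonneg {t K : ℝ} (ht : 0 ≤ t) (hK : 0 ≤ K) :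
    0 ≤ duhamelFactor α b₁ b₂ P r t K := by
  unfold duhamelFactor; positivity

theorem duhamelFactor_mono (h : IsSubcritical α b₁ b₂ ε₁ ε₂ P r) {t t' K K' : ℝ} (ht : 0 ≤ t)
    (htt' : t ≤ t') (hK : 0 ≤ K) (hKK' : K ≤ K') :
    duhamelFactor α b₁ b₂ P r t K ≤ duhamelFactor α b₁ b₂ P r t' K' := by
  have h1 := h.lt_one₁
  have h2 := h.lt_one₂
  have h3 := h.b₂_pos
  have h4 := h3.trans h.b₂_lt
  unfold duhamelFactor
  have h5 : 0 ≤ t' := ht.trans htt'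
  gcongr
  linarith

theorem tendsto_duhamelFactor (h : IsSubcritical α b₁ b₂ ε₁ ε₂ P r) (K : ℝ) :
    Tendsto (fun t => duhamelFactor α b₁ b₂ P r t K) (𝓝[>] 0) (𝓝 0) := by
  have h1 := h.lt_one₁
  have h2 := h.lt_one₂
  have key : ∀ η : ℝ, 0 < η → Tendsto (fun t : ℝ => t ^ η) (𝓝[>] 0) (𝓝 0) := by
    intro η hη
    have := (Real.continuousAt_rpow_const 0 η (Or.inr hη.le)).tendsto
    rw [Real.zero_rpow hη.ne'] at this
    exact this.mono_left nhdsWithin_le_nhds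
  have := ((key _ (show 0 < 1 - n / (2 * α) * b₁ / r.toReal by linarith)).mul_const (K ^ b₁)).add
    ((key _ (show 0 < 1 - P.degree / (2 * α) - n / (2 * α) * b₂ / r.toReal by linarith)).mul_const
      (K ^ b₂))
  simpa [duhamelFactor] using this

/-- The weight t^(−σ) is decreasing, so the bound at time s + t is stronger than the one required at
time t. -/
theorem KatoBound.shift {σ K T : ℝ} {u : ℝ → LpRn 𝕜 n r} {M : ℝ≥0∞} (hσ : 0 ≤ σ) (hK : 0 ≤ K)
    (hu : KatoBound σ M K T u)
    {s : ℝ} (hs : 0 ≤ s) : KatoBound σ M K (T - s) (fun τ => u (s + τ)) := by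
  intro t ht
  obtain ⟨h1, h2⟩ := hu (s + t) ⟨by linarith [ht.1], by linarith [ht.2]⟩
  refine ⟨h1, h2.trans (ENNReal.ofReal_le_ofReal ?_)⟩
  have := Real.rpow_le_rpow_of_nonpos ht.1 (show t ≤ s + t by linarith) (neg_nonpos.2 hσ)
  gcongr

variable [Fact (1 ≤ r)]

/-- The curve `w` is given by Duhamel's formula with datum `φ` and source `f₁(u) + P f₂(u)`. -/
def IsDuhamel (α b₁ b₂ ε₁ ε₂ : ℝ) (P : HigherOrderTerm n) (φ : LpRn 𝕜 n r) (T : ℝ)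
    (u w : ℝ → LpRn 𝕜 n r) : Prop :=
  ∀ t ∈ Ioo 0 T, IntegrableOn (fun τ => duhamelLp α b₁ b₂ ε₁ ε₂ P (t - τ) (u τ)) (Ioo 0 t) ∧
    w t = dissipativeSemigroup 𝕜 n α r t φ +
      ∫ τ in Ioo 0 t, duhamelLp α b₁ b₂ ε₁ ε₂ P (t - τ) (u τ)

variable {φ : LpRn 𝕜 n r} {T : ℝ} {u w : ℝ → LpRn 𝕜 n r}

theorem IsDuhamel.mono {T' : ℝ} (hd : IsDuhamel α b₁ b₂ ε₁ ε₂ P φ T u w) (hT : T' ≤ T) :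
    IsDuhamel α b₁ b₂ ε₁ ε₂ P φ T' u w :=
  fun t ht => hd t ⟨ht.1, ht.2.trans_le hT⟩

theorem IsDuhamel.congr {u' w' : ℝ → LpRn 𝕜 n r} (hd : IsDuhamel α b₁ b₂ ε₁ ε₂ P φ T u w)
    (hu : EqOn u u' (Ioo 0 T)) (hw : EqOn w w' (Ioo 0 T)) :
    IsDuhamel α b₁ b₂ ε₁ ε₂ P φ T u' w' := by
  intro t ht
  have : EqOn (fun τ => duhamelLp α b₁ b₂ ε₁ ε₂ P (t - τ) (u τ))
      (fun τ => duhamelLp α b₁ b₂ ε₁ ε₂ P (t - τ) (u' τ)) (Ioo 0 t) := fun τ hτ => by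
    simp only [hu ⟨hτ.1, hτ.2.trans ht.2⟩]
  obtain ⟨h1, h2⟩ := hd t ht
  exact ⟨h1.congr_fun this measurableSet_Ioo, by
    rw [← hw ht, h2, setIntegral_congr_fun measurableSet_Ioo this]⟩

theorem dissipativeSemigroup_add (h : IsSubcritical α b₁ b₂ ε₁ ε₂ P r) {s t : ℝ} (hs : 0 < s)
    (ht : 0 < t) (φ : LpRn 𝕜 n r) :
    dissipativeSemigroup 𝕜 n α r t (dissipativeSemigroup 𝕜 n α r s φ) =
      dissipativeSemigroup 𝕜 n α r (t + s) φ := by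
  have : NeZero n := ⟨h.ne_zero⟩
  have : Nonempty (Fin n) := ⟨0⟩
  exact heatOp_heatOp isHomogeneousSymbol_one h.alpha_pos ht hs le_rfl h.ne_top φ

/-- The semigroup maps the Duhamel integral at time `s` to the part over `(0, s)` of the Duhamel
integral at time `t + s`. -/
theorem dissipativeSemigroup_integral (h : IsSubcritical α b₁ b₂ ε₁ ε₂ P r) {M : ℝ≥0∞}
    (hM : IsKatoExponent n α b₁ r M) {s t : ℝ} (ht : 0 < t)
    (hu : ∀ τ ∈ Ioo 0 s, MemLp (u τ) M)
    (hi : IntegrableOn (fun τ => duhamelLp α b₁ b₂ ε₁ ε₂ P (s - τ) (u τ)) (Ioo 0 s)) :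
    IntegrableOn (fun τ => duhamelLp α b₁ b₂ ε₁ ε₂ P (s + t - τ) (u τ)) (Ioo 0 s) ∧
      dissipativeSemigroup 𝕜 n α r t (∫ τ in Ioo 0 s, duhamelLp α b₁ b₂ ε₁ ε₂ P (s - τ) (u τ)) =
        ∫ τ in Ioo 0 s, duhamelLp α b₁ b₂ ε₁ ε₂ P (s + t - τ) (u τ) := by
  have key : EqOn (fun τ => dissipativeSemigroup 𝕜 n α r t
      (duhamelLp α b₁ b₂ ε₁ ε₂ P (s - τ) (u τ)))
      (fun τ => duhamelLp α b₁ b₂ ε₁ ε₂ P (s + t - τ) (u τ)) (Ioo 0 s) := by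
    intro τ hτ
    have := heatOp_duhamelLp h hM ht (sub_pos.2 hτ.2) (hu τ hτ)
    simp only [this]
    congr 1
    ring
  refine ⟨IntegrableOn.congr_fun ((dissipativeSemigroup 𝕜 n α r t).integrable_comp hi) key
    measurableSet_Ioo, ?_⟩
  rw [← ContinuousLinearMap.integral_comp_comm _ hi]
  exact setIntegral_congr_fun measurableSet_Ioo key

/-- The Duhamel integral at time s + t is split at s. The part over (0,s) combines with the free
evolution of the datum into S_α(t)w(s), and the remainder is a translated Duhamel integral. -/
theorem IsDuhamel.shift (h : IsSubcritical α b₁ b₂ ε₁ ε₂ P r) {M : ℝ≥0∞}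
    (hM : IsKatoExponent n α b₁ r M) (hd : IsDuhamel α b₁ b₂ ε₁ ε₂ P φ T u w)
    (hu : ∀ τ ∈ Ioo 0 T, MemLp (u τ) M) {s : ℝ} (hs : 0 < s) (hsT : s < T) :
    IsDuhamel α b₁ b₂ ε₁ ε₂ P (w s) (T - s) (fun τ => u (s + τ)) (fun τ => w (s + τ)) := by
  intro t ht
  obtain ⟨i1, e1⟩ := hd s ⟨hs, hsT⟩
  obtain ⟨i2, e2⟩ := hd (s + t) ⟨by linarith [ht.1], by linarith [ht.2]⟩
  obtain ⟨i3, e3⟩ := dissipativeSemigroup_integral h hM ht.1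
    (fun τ hτ => hu τ ⟨hτ.1, hτ.2.trans hsT⟩) i1
  have i4 : IntegrableOn (fun τ => duhamelLp α b₁ b₂ ε₁ ε₂ P (s + t - τ) (u τ)) (Ioo s (s + t)) :=
    i2.mono_set (Ioo_subset_Ioo_left hs.le)
  have e4 := (setIntegral_Ioo_add hs (by linarith [ht.1]) i3 i4).2
  have e5 := setIntegral_comp_add (fun τ => duhamelLp α b₁ b₂ ε₁ ε₂ P (s + t - τ) (u τ)) s t
  simp only [show ∀ τ, s + t - (s + τ) = t - τ from fun τ => by ring] at e5
  refine ⟨?_, ?_⟩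
  · have := integrableOn_comp_add_iff.2 i4
    simpa only [show ∀ τ, s + t - (s + τ) = t - τ from fun τ => by ring] using this
  · beta_reduce
    rw [e2, e1, e4, e5, map_add, e3, dissipativeSemigroup_add h hs ht.1, add_assoc, add_comm t s]

/-- The splitting behind `IsDuhamel.shift`, read backwards. -/
theorem IsDuhamel.glue (h : IsSubcritical α b₁ b₂ ε₁ ε₂ P r) {M : ℝ≥0∞}
    (hM : IsKatoExponent n α b₁ r M) {s T' : ℝ} (hs : 0 < s) (hsT : s < T)
    {v z : ℝ → LpRn 𝕜 n r} (hd : IsDuhamel α b₁ b₂ ε₁ ε₂ P φ T u u)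
    (hu : ∀ τ ∈ Ioo 0 T, MemLp (u τ) M) (hd' : IsDuhamel α b₁ b₂ ε₁ ε₂ P (u s) T' v v)
    (hz : EqOn z u (Ioc 0 s)) (hz' : ∀ t ∈ Ioo 0 T', z (s + t) = v t) :
    IsDuhamel α b₁ b₂ ε₁ ε₂ P φ (s + T') z z := by
  intro t ht
  obtain ⟨i1, e1⟩ := hd s ⟨hs, hsT⟩
  rcases le_or_gt t s with hts | hts
  · exact (hd.mono hsT.le).congr (fun x hx => (hz ⟨hx.1, hx.2.le⟩).symm)
      (fun x hx => (hz ⟨hx.1, hx.2.le⟩).symm) |> fun H => by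
        -- The time t = s is treated separately, since `H` covers only the open interval (0,s).
        rcases hts.eq_or_lt with rfl | hlt
        · have : EqOn (fun τ => duhamelLp α b₁ b₂ ε₁ ε₂ P (t - τ) (u τ))
              (fun τ => duhamelLp α b₁ b₂ ε₁ ε₂ P (t - τ) (z τ)) (Ioo 0 t) := fun τ hτ => by
            simp only [hz ⟨hτ.1, hτ.2.le⟩]
          exact ⟨i1.congr_fun this measurableSet_Ioo, by
            rw [hz ⟨hs, le_rfl⟩, e1, setIntegral_congr_fun measurableSet_Ioo this]⟩
        · exact H t ⟨ht.1, hlt⟩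
  · obtain ⟨t', rfl⟩ : ∃ t', t = s + t' := ⟨t - s, by ring⟩
    have ht' : t' ∈ Ioo 0 T' := ⟨by linarith, by linarith [ht.2]⟩
    obtain ⟨i2, e2⟩ := hd' t' ht'
    obtain ⟨i3, e3⟩ := dissipativeSemigroup_integral h hM ht'.1
      (fun τ hτ => hu τ ⟨hτ.1, hτ.2.trans hsT⟩) i1
    have c1 : EqOn (fun τ => duhamelLp α b₁ b₂ ε₁ ε₂ P (s + t' - τ) (u τ))
        (fun τ => duhamelLp α b₁ b₂ ε₁ ε₂ P (s + t' - τ) (z τ)) (Ioo 0 s) := fun τ hτ => by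
      simp only [hz ⟨hτ.1, hτ.2.le⟩]
    have c2 : EqOn (fun τ => duhamelLp α b₁ b₂ ε₁ ε₂ P (t' - τ) (v τ))
        (fun τ => duhamelLp α b₁ b₂ ε₁ ε₂ P (s + t' - (s + τ)) (z (s + τ))) (Ioo 0 t') :=
      fun τ hτ => by
        simp only [hz' τ ⟨hτ.1, hτ.2.trans ht'.2⟩]
        congr 1
        ring
    have i3' := i3.congr_fun c1 measurableSet_Ioo
    have i2' := (integrableOn_comp_add_iff
      (G := fun τ => duhamelLp α b₁ b₂ ε₁ ε₂ P (s + t' - τ) (z τ))).1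
      (i2.congr_fun c2 measurableSet_Ioo)
    obtain ⟨i4, e4⟩ := setIntegral_Ioo_add hs hts i3' i2'
    refine ⟨i4, ?_⟩
    rw [e4, hz' t' ht', e2, e1, map_add, e3, dissipativeSemigroup_add h hs ht'.1,
      setIntegral_congr_fun measurableSet_Ioo c1, setIntegral_congr_fun measurableSet_Ioo c2,
      setIntegral_comp_add (fun τ => duhamelLp α b₁ b₂ ε₁ ε₂ P (s + t' - τ) (z τ)), add_assoc,
      add_comm t' s]

/-- The difference between a curve given by Duhamel's formula and the free evolution. -/
theorem exists_katoAt_sub_dissipativeSemigroup (h : IsSubcritical α b₁ b₂ ε₁ ε₂ P r) {M : ℝ≥0∞}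
    (hM : IsKatoExponent n α b₁ r M) : ∃ C > 0, ∀ (φ : LpRn 𝕜 n r) (K T : ℝ)
      (u w : ℝ → LpRn 𝕜 n r), 0 ≤ K → KatoBound (katoExponent n α r M) M K T u →
      IsDuhamel α b₁ b₂ ε₁ ε₂ P φ T u w → ∀ t ∈ Ioo 0 T,
      KatoAt (katoExponent n α r M) M (C * duhamelFactor α b₁ b₂ P r t K * K) t
        (w t - dissipativeSemigroup 𝕜 n α r t φ) := by
  obtain ⟨C, hC, H⟩ := exists_katoAt_integral_sub (𝕜 := 𝕜) h hM
  refine ⟨C, hC, fun φ K T u w hK hu hd t ht => ?_⟩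
  obtain ⟨i, e⟩ := hd t ht
  have hz : EqOn (fun _ => (0 : LpRn 𝕜 n r)) (fun τ => duhamelLp α b₁ b₂ ε₁ ε₂ P (t - τ) 0)
      (Ioo 0 t) := fun τ hτ => (duhamelLp_zero h (sub_pos.2 hτ.2)).symm
  have := H K hK K hK t ht.1 u (fun _ => 0) (hu.mono le_rfl ht.2.le) (fun _ _ => KatoAt.zero hK)
    (by simpa only [sub_zero] using hu.mono le_rfl ht.2.le) i
    ((integrableOn_zero : IntegrableOn (fun _ : ℝ => (0 : LpRn 𝕜 n r)) _ volume).congr_fun hz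
        measurableSet_Ioo)
  rw [← setIntegral_congr_fun measurableSet_Ioo hz, integral_zero, sub_zero] at this
  rwa [e, add_sub_cancel_left]

/-- Curves given by Duhamel's formula are continuous in `L^r`. -/
theorem IsDuhamel.continuousOn (h : IsSubcritical α b₁ b₂ ε₁ ε₂ P r) {M : ℝ≥0∞}
    (hM : IsKatoExponent n α b₁ r M) (hT : 0 < T) {K : ℝ} (hK : 0 ≤ K)
    (hu : KatoBound (katoExponent n α r M) M K T u) (hd : IsDuhamel α b₁ b₂ ε₁ ε₂ P φ T u w) :
    ContinuousOn w (Ioo 0 T) ∧ Tendsto w (𝓝[>] 0) (𝓝 φ) := by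
  have : NeZero n := ⟨h.ne_zero⟩
  have : Nonempty (Fin n) := ⟨0⟩
  have hσ := katoExponent_nonneg (n := n) h.alpha_pos hM.le hM.ne_top
  obtain ⟨C, hC, H⟩ := exists_katoAt_sub_dissipativeSemigroup (𝕜 := 𝕜) h hM
  have hω : Tendsto (fun t => C * duhamelFactor α b₁ b₂ P r t K * K) (𝓝[>] 0) (𝓝 0) := by
    have := ((tendsto_duhamelFactor h K).const_mul C).mul_const K
    simpa using this
  constructor
  · intro t₀ ht₀
    refine ContinuousAt.continuousWithinAt ?_
    rw [Metric.continuousAt_iff']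
    intro ε hε
    obtain ⟨δ₀, hδ₀, hδ₀'⟩ := (mem_nhdsGT_iff_exists_Ioo_subset).1 (hω.eventually_lt_const
      (show 0 < ε / 3 by linarith))
    obtain ⟨δ, hδ, hδ1, hδ2, hδ3⟩ : ∃ δ > 0, 2 * δ < δ₀ ∧ δ < t₀ ∧ t₀ + δ < T := by
      have h1 : 0 < δ₀ := hδ₀
      have h2 := ht₀.1
      have h3 : 0 < T - t₀ := sub_pos.2 ht₀.2
      refine ⟨min (δ₀ / 3) (min (t₀ / 2) ((T - t₀) / 2)), by positivity, ?_, ?_, ?_⟩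
      · linarith [min_le_left (δ₀ / 3) (min (t₀ / 2) ((T - t₀) / 2))]
      · linarith [(min_le_right (δ₀ / 3) (min (t₀ / 2) ((T - t₀) / 2))).trans (min_le_left _ _)]
      · linarith [(min_le_right (δ₀ / 3) (min (t₀ / 2) ((T - t₀) / 2))).trans (min_le_right _ _)]
    -- The curve is restarted shortly before t₀. On (s, s + 2δ) it stays within ε/3 of the free
    -- evolution of w(s), which is strongly continuous; continuity of u is not involved.
    set s := t₀ - δ with hs
    have hs0 : 0 < s := by linarith
    have herr : ∀ t ∈ Ioo 0 (2 * δ), ‖w (s + t) - dissipativeSemigroup 𝕜 n α r t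
        (w s)‖ < ε / 3 := by
      intro t ht
      have := (H (w s) K (T - s) _ _ hK (hu.shift hσ hK hs0.le)
        (hd.shift h hM (fun τ hτ => (hu τ hτ).memLp) hs0 (by linarith)) t
        ⟨ht.1, by linarith [ht.2]⟩).1
      exact this.trans_lt (hδ₀' ⟨ht.1, ht.2.trans hδ1⟩)
    have hc := (tendsto_heatOp_one h.alpha_pos h.ne_top (w s) hδ)
    have hc2 : Tendsto (fun t => dissipativeSemigroup 𝕜 n α r (t - s) (w s)) (𝓝 t₀)
        (𝓝 (dissipativeSemigroup 𝕜 n α r δ (w s))) := by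
      refine hc.comp ?_
      have : δ = t₀ - s := by simp [hs]
      rw [this]
      exact (continuous_id.sub continuous_const).tendsto t₀
    filter_upwards [Metric.tendsto_nhds.1 hc2 (ε / 3) (by linarith), Ioo_mem_nhds
      (show t₀ - δ < t₀ by linarith) (show t₀ < t₀ + δ by linarith)] with t h1 h2
    have e1 := herr (t - s) ⟨by linarith [h2.1], by linarith [h2.2]⟩
    have e2 := herr δ ⟨hδ, by linarith⟩
    rw [show s + (t - s) = t by ring] at e1
    rw [show s + δ = t₀ by simp [hs]] at e2
    rw [dist_eq_norm] at h1 ⊢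
    calc _ = ‖(w t - dissipativeSemigroup 𝕜 n α r (t - s) (w s)) +
          (dissipativeSemigroup 𝕜 n α r (t - s) (w s) - dissipativeSemigroup 𝕜 n α r δ (w s)) -
          (w t₀ - dissipativeSemigroup 𝕜 n α r δ (w s))‖ := by congr 1; abel
      _ ≤ _ := (norm_sub_le _ _).trans (add_le_add_left (norm_add_le _ _) _)
      _ < ε := by linarith
  · have h1 := tendsto_heatOp_zero h.alpha_pos h.ne_top φ
    have h2 : Tendsto (fun t => w t - dissipativeSemigroup 𝕜 n α r t φ) (𝓝[>] 0) (𝓝 0) := by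
      refine squeeze_zero_norm' ?_ hω
      filter_upwards [Ioo_mem_nhdsGT hT] with t ht
      exact (H φ K T u w hK hu hd t ht).1
    have := h2.add h1
    simpa using this

end IsDuhamel

/-! ### Local existence by iteration -/

section katoAt

variable {V : Type*} [NormedAddCommGroup V] [InnerProductSpace ℝ V] [FiniteDimensional ℝ V]
  [MeasurableSpace V] [BorelSpace V] {𝕜 : Type*} [RCLike 𝕜] {r M : ℝ≥0∞} {σ K K' t : ℝ}
  {w w' : Lp 𝕜 r (volume : Measure V)}

theorem KatoAt.mono (h : KatoAt σ M K t w) (ht : 0 < t) (hK : K ≤ K') : KatoAt σ M K' t w := by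
  refine ⟨h.1.trans hK, h.2.trans (ENNReal.ofReal_le_ofReal ?_)⟩
  gcongr

variable [Fact (1 ≤ r)]

theorem KatoAt.add (h : KatoAt σ M K t w) (h' : KatoAt σ M K' t w') (hM : 1 ≤ M) (ht : 0 < t) :
    KatoAt σ M (K + K') t (w + w') := by
  have hK : 0 ≤ K := (norm_nonneg _).trans h.1
  have hK' : 0 ≤ K' := (norm_nonneg _).trans h'.1
  refine ⟨(norm_add_le _ _).trans (add_le_add h.1 h'.1), ?_⟩
  rw [eLpNorm_congr_ae (Lp.coeFn_add _ _), add_mul, ENNReal.ofReal_add (by positivity)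
      (by positivity)]
  exact (eLpNorm_add_le (Lp.memLp w).1 (Lp.memLp w').1 hM).trans (add_le_add h.2 h'.2)

theorem isClosed_katoAt : IsClosed {w : Lp 𝕜 r (volume : Measure V) | KatoAt σ M K t w} := by
  have : {w : Lp 𝕜 r (volume : Measure V) | KatoAt σ M K t w} =
    {w : Lp 𝕜 r (volume : Measure V) | ‖w‖ ≤ K} ∩
      {w | eLpNorm w M volume ≤ ENNReal.ofReal (K * t ^ (-σ))} := rfl
  rw [this]
  exact (isClosed_le continuous_norm continuous_const).inter (isClosed_eLpNorm_le _)

end katoAt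

section existence

variable {𝕜 : Type*} [RCLike 𝕜] {n : ℕ} {α b₁ b₂ ε₁ ε₂ : ℝ} {P : HigherOrderTerm n} {r : ℝ≥0∞}

/-- Used to pass from the radius of the contraction ball, a fixed multiple of R, to R itself. -/
theorem duhamelFactor_mul_le {t K c : ℝ} (ht : 0 ≤ t) (hK : 0 ≤ K) (hc : 0 ≤ c) :
    duhamelFactor α b₁ b₂ P r t (c * K) ≤ (c ^ b₁ + c ^ b₂) * duhamelFactor α b₁ b₂ P r t K := by
  unfold duhamelFactor
  rw [Real.mul_rpow hc hK, Real.mul_rpow hc hK]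
  set x := t ^ (1 - n / (2 * α) * b₁ / r.toReal) * K ^ b₁ with hx
  set y := t ^ (1 - P.degree / (2 * α) - n / (2 * α) * b₂ / r.toReal) * K ^ b₂ with hy
  have hx0 : 0 ≤ x := by positivity
  have hy0 : 0 ≤ y := by positivity
  have h1 : 0 ≤ c ^ b₁ * y := by positivity
  have h2 : 0 ≤ c ^ b₂ * x := by positivity
  calc _ = c ^ b₁ * x + c ^ b₂ * y := by rw [hx, hy]; ring
    _ ≤ _ := by linarith

variable [Fact (1 ≤ r)]

theorem exists_katoAt_dissipativeSemigroup (h : IsSubcritical α b₁ b₂ ε₁ ε₂ P r) {M : ℝ≥0∞}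
    (hM : IsKatoExponent n α b₁ r M) :
    ∃ A > 0, ∀ (φ : LpRn 𝕜 n r), ∀ t > 0,
      KatoAt (katoExponent n α r M) M (A * ‖φ‖) t (dissipativeSemigroup 𝕜 n α r t φ) := by
  have : NeZero n := ⟨h.ne_zero⟩
  have : Nonempty (Fin n) := ⟨0⟩
  have hr1 : (1:ℝ≥0∞) ≤ r := Fact.out
  have : Fact (1 ≤ M) := ⟨hr1.trans hM.le⟩
  have h1 := isHomogeneousSymbol_one (V := EuclideanSpace ℝ (Fin n))
  obtain ⟨A, hA, H⟩ := exists_norm_heatOp_le (F := 𝕜) h1 h.alpha_pos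
  refine ⟨A, hA, fun φ t ht => ⟨?_, ?_⟩⟩
  · have := H t ht r r le_rfl h.ne_top φ
    simpa using this
  · have e : dissipativeSemigroup 𝕜 n α r t φ =ᵐ[volume]
        heatOp 𝕜 (fun _ : EuclideanSpace ℝ (Fin n) => (1:ℂ)) α t r M φ :=
      (heatOp_coeFn h1 h.alpha_pos ht le_rfl h.ne_top φ).trans
        (heatOp_coeFn h1 h.alpha_pos ht hM.le hM.ne_top φ).symm
    rw [eLpNorm_congr_ae e, ← Lp.enorm_def, ← ofReal_norm]
    refine ENNReal.ofReal_le_ofReal ((H t ht r M hM.le hM.ne_top φ).trans (le_of_eq ?_))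
    rw [finrank_euclideanSpace_fin, katoExponent]
    simp only [Nat.cast_zero, zero_div, zero_add]
    ring

/-- Local existence, with an existence time determined by the size of the datum. -/
theorem exists_isDuhamel (h : IsSubcritical α b₁ b₂ ε₁ ε₂ P r) {M : ℝ≥0∞}
    (hM : IsKatoExponent n α b₁ r M) (hrM : r < M) (hbM : b₁ + 1 < M.toReal) :
    ∃ A > 0, ∃ C > 0, ∀ R ≥ 0, ∀ T > 0, C * duhamelFactor α b₁ b₂ P r T R ≤ 1 →
      ∀ φ : LpRn 𝕜 n r, ‖φ‖ ≤ R → ∃ u : ℝ → LpRn 𝕜 n r,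
        IsDuhamel α b₁ b₂ ε₁ ε₂ P φ T u u ∧ KatoBound (katoExponent n α r M) M (A * R) T u ∧
        ContinuousOn u (Ioo 0 T) ∧ Tendsto u (𝓝[>] 0) (𝓝 φ) := by
  have : NeZero n := ⟨h.ne_zero⟩
  have : Nonempty (Fin n) := ⟨0⟩
  have hr1 : (1:ℝ≥0∞) ≤ r := Fact.out
  have hM1 := hr1.trans hM.le
  obtain ⟨A, hA, HA⟩ := exists_katoAt_dissipativeSemigroup (𝕜 := 𝕜) h hM
  obtain ⟨C₁, hC₁, H₁⟩ := exists_katoAt_integral_sub (𝕜 := 𝕜) h hM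
  obtain ⟨C₂, hC₂, H₂⟩ := exists_katoAt_sub_dissipativeSemigroup (𝕜 := 𝕜) h hM
  -- The ball has radius K = 2AR: the free evolution uses half of it and the Duhamel term the other
  -- half. The second constant makes the contraction factor at most 1/2 on this ball.
  refine ⟨2 * A, by positivity, 2 * max C₁ C₂ * ((2 * A) ^ b₁ + (2 * A) ^ b₂), by positivity, ?_⟩
  intro R hR T hT hfac φ hφ
  set K := 2 * A * R with hKdef
  have hK : 0 ≤ K := by positivity
  have hsmall : ∀ t ∈ Ioo 0 T, max C₁ C₂ * duhamelFactor α b₁ b₂ P r t K ≤ 1 / 2 := by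
    intro t ht
    have h1 := duhamelFactor_mono h ht.1.le ht.2.le hK le_rfl
    have h2 := duhamelFactor_mul_le (α := α) (b₁ := b₁) (b₂ := b₂) (P := P) (r := r) hT.le hR
      (show 0 ≤ 2 * A by positivity)
    have h3 : max C₁ C₂ * duhamelFactor α b₁ b₂ P r t K ≤ max C₁ C₂ *
        (((2 * A) ^ b₁ + (2 * A) ^ b₂) * duhamelFactor α b₁ b₂ P r T R) := by
      gcongr
      exact h1.trans h2
    linarith
  have hsmall' : ∀ {D : ℝ}, 0 ≤ D → ∀ t ∈ Ioo 0 T,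
      C₁ * duhamelFactor α b₁ b₂ P r t K * D ≤ D / 2 ∧
      C₂ * duhamelFactor α b₁ b₂ P r t K * D ≤ D / 2 := by
    intro D hD t ht
    have h1 := hsmall t ht
    have h0 := duhamelFactor_nonneg (α := α) (b₁ := b₁) (b₂ := b₂) (P := P) (r := r) ht.1.le hK
    have h2 := mul_le_mul_of_nonneg_right (le_max_left C₁ C₂) h0
    have h3 := mul_le_mul_of_nonneg_right (le_max_right C₁ C₂) h0
    constructor <;> nlinarith
  set σ := katoExponent n α r M with hσdef
  set Φ : (ℝ → LpRn 𝕜 n r) → ℝ → LpRn 𝕜 n r := fun u t => dissipativeSemigroup 𝕜 n α r t φ +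
    ∫ τ in Ioo 0 t, duhamelLp α b₁ b₂ ε₁ ε₂ P (t - τ) (u τ) with hΦ
  set S : ℝ → LpRn 𝕜 n r := fun t => dissipativeSemigroup 𝕜 n α r t φ with hS
  have hSK : KatoBound σ M (K / 2) T S := fun t ht => (HA φ t ht.1).mono ht.1 (by
    have : K / 2 = A * R := by rw [hKdef]; ring
    rw [this]; gcongr)
  have hduh : ∀ {u : ℝ → LpRn 𝕜 n r}, KatoBound σ M K T u → ContinuousOn u (Ioo 0 T) →
      IsDuhamel α b₁ b₂ ε₁ ε₂ P φ T u (Φ u) := fun {u} hu hc t ht =>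
    ⟨integrableOn_duhamelLp h hM hrM hbM hK ht.1 (hu.mono le_rfl ht.2.le)
      (hc.mono (Ioo_subset_Ioo_right ht.2.le)), rfl⟩
  have hsub : ∀ {u : ℝ → LpRn 𝕜 n r}, KatoBound σ M K T u → ContinuousOn u (Ioo 0 T) →
      KatoBound σ M (K / 2) T (fun t => Φ u t - S t) := fun {u} hu hc t ht =>
    (H₂ φ K T u (Φ u) hK hu (hduh hu hc) t ht).mono ht.1 (hsmall' hK t ht).2
  have hinv : ∀ {u : ℝ → LpRn 𝕜 n r}, KatoBound σ M K T u ∧ ContinuousOn u (Ioo 0 T) →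
      KatoBound σ M K T (Φ u) ∧ ContinuousOn (Φ u) (Ioo 0 T) := by
    rintro u ⟨hu, hc⟩
    refine ⟨fun t ht => ?_, ((hduh hu hc).continuousOn h hM hT hK hu).1⟩
    have := (hsub hu hc t ht).add (hSK t ht) hM1 ht.1
    rwa [sub_add_cancel, add_halves] at this
  have hcontr : ∀ {D : ℝ} {u v : ℝ → LpRn 𝕜 n r}, 0 ≤ D →
      KatoBound σ M K T u ∧ ContinuousOn u (Ioo 0 T) →
      KatoBound σ M K T v ∧ ContinuousOn v (Ioo 0 T) → KatoBound σ M D T (fun t => u t - v t) →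
      KatoBound σ M (D / 2) T (fun t => Φ u t - Φ v t) := by
    rintro D u v hD ⟨hu, hcu⟩ ⟨hv, hcv⟩ huv t ht
    have := (H₁ K hK D hD t ht.1 u v (hu.mono le_rfl ht.2.le) (hv.mono le_rfl ht.2.le)
      (huv.mono le_rfl ht.2.le) (hduh hu hcu t ht).1 (hduh hv hcv t ht).1).mono ht.1
      (hsmall' hD t ht).1
    simpa only [hΦ, add_sub_add_left_eq_sub] using this
  have hS0 : KatoBound σ M K T S ∧ ContinuousOn S (Ioo 0 T) := by
    refine ⟨hSK.mono (by linarith) le_rfl, fun t ht => ?_⟩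
    exact (tendsto_heatOp_one h.alpha_pos h.ne_top φ ht.1).mono_left nhdsWithin_le_nhds
  -- Picard iteration from the free evolution. Differences are bounded by K/2^k in both components
  -- of the Kato bound.
  set U : ℕ → ℝ → LpRn 𝕜 n r := fun k => Φ^[k] S with hU
  have hUs : ∀ k, U (k + 1) = Φ (U k) := fun k => Function.iterate_succ_apply' _ _ _
  have hUinv : ∀ k, KatoBound σ M K T (U k) ∧ ContinuousOn (U k) (Ioo 0 T) := by
    intro k
    induction k with
    | zero => exact hS0
    | succ k ih => rw [hUs]; exact hinv ih
  have hUdiff : ∀ m k, KatoBound σ M (K / 2 ^ k) T (fun t => U (m + k) t - U k t) := by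
    intro m k
    induction k with
    | zero =>
      rcases m with - | m
      · intro t ht
        simp only [sub_self]
        exact KatoAt.zero (by positivity)
      · rw [add_zero, hUs]
        exact (hsub (hUinv m).1 (hUinv m).2).mono (by simp; linarith) le_rfl
    | succ k ih =>
      have := hcontr (by positivity) (hUinv (m + k)) (hUinv k) ih
      rw [← add_assoc, hUs, hUs, pow_succ, ← div_div]
      exact this
  have hlim : ∀ t, ∃ l, t ∈ Ioo 0 T → Tendsto (fun k => U k t) atTop (𝓝 l) := by
    intro t
    by_cases ht : t ∈ Ioo 0 T
    · have : CauchySeq (fun k => U k t) := by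
        refine cauchySeq_of_le_geometric_two (C := 2 * K) fun k => ?_
        rw [dist_comm, dist_eq_norm, mul_div_cancel_left₀ _ two_ne_zero, add_comm k 1]
        exact (hUdiff 1 k t ht).1
      obtain ⟨l, hl⟩ := cauchySeq_tendsto_of_complete this
      exact ⟨l, fun _ => hl⟩
    · exact ⟨0, fun h => absurd h ht⟩
  choose u hu using hlim
  -- The limit is taken in L^r only; the L^M bounds survive because `KatoAt` is closed under L^r
  -- convergence.
  have huU : ∀ k, KatoBound σ M (K / 2 ^ k) T (fun t => u t - U k t) := by
    intro k t ht
    refine isClosed_katoAt.mem_of_tendsto (((tendsto_add_atTop_iff_nat k).2 (hu t ht)).sub_const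
      (U k t)) (Eventually.of_forall fun m => hUdiff m k t ht)
  have hgeom : Tendsto (fun k : ℕ => K / 2 ^ k) atTop (𝓝 0) := by
    have := (tendsto_pow_atTop_nhds_zero_of_lt_one (r := (1/2:ℝ)) (by norm_num)
        (by norm_num)).const_mul K
    simpa [div_eq_mul_inv] using this
  have huK : KatoBound σ M K T u := fun t ht =>
    isClosed_katoAt.mem_of_tendsto (hu t ht) (Eventually.of_forall fun k => (hUinv k).1 t ht)
  have huc : ContinuousOn u (Ioo 0 T) := by
    refine TendstoUniformlyOn.continuousOn (F := U) (p := atTop) ?_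
      (Eventually.of_forall fun k => (hUinv k).2).frequently
    rw [Metric.tendstoUniformlyOn_iff]
    intro ε hε
    filter_upwards [hgeom.eventually_lt_const hε] with k hk t ht
    rw [dist_eq_norm]
    exact ((huU k t ht).1).trans_lt hk
  have hfix : EqOn (Φ u) u (Ioo 0 T) := by
    intro t ht
    refine tendsto_nhds_unique ?_ ((tendsto_add_atTop_iff_nat 1).2 (hu t ht))
    rw [tendsto_iff_norm_sub_tendsto_zero]
    refine squeeze_zero (fun _ => norm_nonneg _) (fun k => ?_) hgeom
    have := (hcontr (by positivity) ⟨huK, huc⟩ (hUinv k) (huU k) t ht).1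
    rw [hUs, norm_sub_rev]
    have h0 : 0 ≤ K / 2 ^ k := by positivity
    linarith
  have hd := (hduh huK huc).congr (fun _ _ => rfl) hfix
  exact ⟨u, hd, huK, huc, (hd.continuousOn h hM hT hK huK).2⟩

end existence

/-! ### Uniqueness for the integral equation -/

section uniqueness

variable {𝕜 : Type*} [RCLike 𝕜] {n : ℕ} {α b₁ b₂ ε₁ ε₂ : ℝ} {P : HigherOrderTerm n} {r : ℝ≥0∞}

/-- Boundedness in `L^r` and `L^M` on compact subintervals of `(0, T)`. -/
def IsLocallyBounded (M : ℝ≥0∞) (T : ℝ) (u : ℝ → LpRn 𝕜 n r) : Prop :=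
  ∀ a b, 0 < a → b < T → ∃ K : ℝ, ∀ t ∈ Icc a b,
    ‖u t‖ ≤ K ∧ eLpNorm (u t) M volume ≤ ENNReal.ofReal K

variable {φ : LpRn 𝕜 n r} {T σ K : ℝ} {M : ℝ≥0∞} {u v : ℝ → LpRn 𝕜 n r}

theorem IsLocallyBounded.memLp (hu : IsLocallyBounded M T u) {t : ℝ} (ht : t ∈ Ioo 0 T) :
    MemLp (u t) M := by
  obtain ⟨K, hK⟩ := hu t t ht.1 ht.2
  exact ⟨(Lp.memLp _).1, (hK t ⟨le_rfl, le_rfl⟩).2.trans_lt ENNReal.ofReal_lt_top⟩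

theorem IsLocallyBounded.shift (hu : IsLocallyBounded M T u) {s : ℝ} (hs : 0 ≤ s) :
    IsLocallyBounded M (T - s) (fun τ => u (s + τ)) := by
  intro a b ha hb
  obtain ⟨K, hK⟩ := hu (s + a) (s + b) (by linarith) (by linarith)
  exact ⟨K, fun t ht => hK (s + t) ⟨by linarith [ht.1], by linarith [ht.2]⟩⟩

theorem IsLocallyBounded.mono {T' : ℝ} (hu : IsLocallyBounded M T u) (hT : T' ≤ T) :
    IsLocallyBounded M T' u :=
  fun a b ha hb => hu a b ha (hb.trans_le hT)

/-- For t ≤ 1 the weight t^(−σ) is at least 1, so unweighted bounds after a restart yield Kato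
bounds. -/
theorem KatoAt.of_le_one (hσ : 0 ≤ σ) (hK : 0 ≤ K) {t : ℝ} (ht : 0 < t) (ht1 : t ≤ 1)
    {w : LpRn 𝕜 n r} (h1 : ‖w‖ ≤ K) (h2 : eLpNorm w M volume ≤ ENNReal.ofReal K) :
    KatoAt σ M K t w := by
  refine ⟨h1, h2.trans (ENNReal.ofReal_le_ofReal ?_)⟩
  have := Real.one_le_rpow_of_pos_of_le_one_of_nonpos ht ht1 (neg_nonpos.2 hσ)
  nlinarith

theorem KatoBound.isLocallyBounded (hσ : 0 ≤ σ) (hK : 0 ≤ K) (hu : KatoBound σ M K T u) :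
    IsLocallyBounded M T u := by
  intro a b ha hb
  refine ⟨max K (K * a ^ (-σ)), fun t ht => ?_⟩
  obtain ⟨h1, h2⟩ := hu t ⟨ha.trans_le ht.1, ht.2.trans_lt hb⟩
  refine ⟨h1.trans (le_max_left _ _), h2.trans (ENNReal.ofReal_le_ofReal (le_max_of_le_right ?_))⟩
  have := Real.rpow_le_rpow_of_nonpos ha ht.1 (neg_nonpos.2 hσ)
  gcongr

variable [Fact (1 ≤ r)]

theorem KatoAt.sub {t K' : ℝ} {w w' : LpRn 𝕜 n r} (h : KatoAt σ M K t w) (h' : KatoAt σ M K' t w')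
    (hM : 1 ≤ M) (ht : 0 < t) : KatoAt σ M (K + K') t (w - w') := by
  rw [sub_eq_add_neg]
  refine h.add ⟨by rw [norm_neg]; exact h'.1, ?_⟩ hM ht
  rw [eLpNorm_congr_ae (Lp.coeFn_neg _), eLpNorm_neg]
  exact h'.2

/-- Uniqueness on short time intervals. -/
theorem exists_eqOn_of_katoBound (h : IsSubcritical α b₁ b₂ ε₁ ε₂ P r)
    (hM : IsKatoExponent n α b₁ r M) :
    ∃ C > 0, ∀ (φ : LpRn 𝕜 n r) (K T : ℝ) (u v : ℝ → LpRn 𝕜 n r), 0 ≤ K → 0 < T →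
      C * duhamelFactor α b₁ b₂ P r T K ≤ 1 → KatoBound (katoExponent n α r M) M K T u →
      KatoBound (katoExponent n α r M) M K T v → IsDuhamel α b₁ b₂ ε₁ ε₂ P φ T u u →
      IsDuhamel α b₁ b₂ ε₁ ε₂ P φ T v v → EqOn u v (Ioo 0 T) := by
  have hM1 : 1 ≤ M := le_trans Fact.out hM.le
  obtain ⟨C, hC, H⟩ := exists_katoAt_integral_sub (𝕜 := 𝕜) h hM
  refine ⟨2 * C, by positivity, ?_⟩
  intro φ K T u v hK hT hfac hu hv hdu hdv
  -- Each substitution into the integral equation halves the bound for the difference, starting from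
  -- 2K by the triangle inequality.
  have key : ∀ k : ℕ, KatoBound (katoExponent n α r M) M (2 * K / 2 ^ k) T
      (fun t => u t - v t) := by
    intro k
    induction k with
    | zero =>
      intro t ht
      have := (hu t ht).sub (hv t ht) hM1 ht.1
      rw [pow_zero, div_one, two_mul]
      exact this
    | succ k ih =>
      intro t ht
      obtain ⟨i1, e1⟩ := hdu t ht
      obtain ⟨i2, e2⟩ := hdv t ht
      have hD : 0 ≤ 2 * K / 2 ^ k := by positivity
      have := H K hK _ hD t ht.1 u v (hu.mono le_rfl ht.2.le) (hv.mono le_rfl ht.2.le)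
        (ih.mono le_rfl ht.2.le) i1 i2
      beta_reduce
      rw [e1, e2, add_sub_add_left_eq_sub]
      refine this.mono ht.1 ?_
      have h1 := duhamelFactor_mono h ht.1.le ht.2.le hK le_rfl
      have h2 := mul_le_mul_of_nonneg_left h1 hC.le
      have h3 : C * duhamelFactor α b₁ b₂ P r t K ≤ 1 / 2 := by linarith
      have h4 := mul_le_mul_of_nonneg_right h3 hD
      rw [pow_succ, ← div_div]
      linarith
  intro t ht
  have hgeom : Tendsto (fun k : ℕ => 2 * K / 2 ^ k) atTop (𝓝 0) := by
    have := (tendsto_pow_atTop_nhds_zero_of_lt_one (r := (1/2:ℝ)) (by norm_num)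
      (by norm_num)).const_mul (2 * K)
    simpa [div_eq_mul_inv] using this
  have : ‖u t - v t‖ ≤ 0 := ge_of_tendsto' hgeom fun k => (key k t ht).1
  exact sub_eq_zero.1 (norm_le_zero_iff.1 this)

/-- Uniqueness in the class of locally bounded curves with a weighted bound near `0`. -/
theorem IsDuhamel.eqOn (h : IsSubcritical α b₁ b₂ ε₁ ε₂ P r) (hM : IsKatoExponent n α b₁ r M)
    {T₁ : ℝ} (hT₁ : 0 < T₁) (hK : 0 ≤ K)
    (hdu : IsDuhamel α b₁ b₂ ε₁ ε₂ P φ T u u) (hdv : IsDuhamel α b₁ b₂ ε₁ ε₂ P φ T v v)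
    (hu : IsLocallyBounded M T u) (hv : IsLocallyBounded M T v)
    (hu' : KatoBound (katoExponent n α r M) M K T₁ u)
    (hv' : KatoBound (katoExponent n α r M) M K T₁ v) : EqOn u v (Ioo 0 T) := by
  have hσ := katoExponent_nonneg (n := n) h.alpha_pos hM.le hM.ne_top
  obtain ⟨C, hC, H⟩ := exists_eqOn_of_katoBound (𝕜 := 𝕜) h hM
  have hδ : ∀ K : ℝ, ∀ T > 0, ∃ δ > 0, δ ≤ T ∧ C * duhamelFactor α b₁ b₂ P r δ K ≤ 1 := by
    intro K T hT
    have h1 := (tendsto_duhamelFactor h K).const_mul C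
    rw [mul_zero] at h1
    obtain ⟨δ, h2, h3⟩ := ((h1.eventually_le_const one_pos).and (Ioo_mem_nhdsGT hT)).exists
    exact ⟨δ, h3.1, h3.2.le, h2⟩
  intro t ht
  have hT : 0 < T := ht.1.trans ht.2
  obtain ⟨a, ha, haT, hafac⟩ := hδ K (min T T₁) (lt_min hT hT₁)
  have haT' := haT.trans (min_le_left _ _)
  have hbase : EqOn u v (Ioo 0 a) := H φ K a u v hK ha hafac
    (hu'.mono le_rfl (haT.trans (min_le_right _ _))) (hv'.mono le_rfl
        (haT.trans (min_le_right _ _)))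
    (hdu.mono haT') (hdv.mono haT')
  obtain ⟨b, hbt, hbT⟩ := exists_between ht.2
  obtain ⟨K₁, hK₁⟩ := hu (a / 2) b (by positivity) hbT
  obtain ⟨K₂, hK₂⟩ := hv (a / 2) b (by positivity) hbT
  -- K' bounds both curves on [a/2, b], so one step length δ serves for every restart.
  set K' := max 0 (max K₁ K₂) with hK'
  have hK'0 : 0 ≤ K' := le_max_left _ _
  have hK'1 : K₁ ≤ K' := (le_max_left _ _).trans (le_max_right _ _)
  have hK'2 : K₂ ≤ K' := (le_max_right _ _).trans (le_max_right _ _)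
  obtain ⟨δ, hδ0, hδ1, hδfac⟩ := hδ K' 1 one_pos
  have step : ∀ k : ℕ, ∀ x, 0 < x → x < b → x < a + k * (δ / 2) → u x = v x := by
    intro k
    induction k with
    | zero =>
      intro x hx0 _ hxa
      exact hbase ⟨hx0, by simpa using hxa⟩
    | succ k ih =>
      intro x hx0 hxb hxa
      rcases lt_or_ge x (a + k * (δ / 2)) with hlt | hge
      · exact ih x hx0 hxb hlt
      push_cast at hxa
      have hk0 : 0 ≤ k * (δ / 2) := by positivity
      -- The restart time s is at least a/2, where K' applies, lies in the range where agreement is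
      -- known, and is within 3δ/4 < δ of x. Each restart advances the agreement by δ/2.
      set s := max (a / 2) (x - 3 * δ / 4) with hs
      have hsa : a / 2 ≤ s := le_max_left _ _
      have hsx : x - 3 * δ / 4 ≤ s := le_max_right _ _
      have hs0 : 0 < s := by linarith
      have hsx' : s < x := max_lt (by linarith) (by linarith)
      have hsk : s < a + k * (δ / 2) := max_lt (by linarith) (by linarith)
      have heq := ih s hs0 (hsx'.trans hxb) hsk
      have hsT : s < T := by linarith
      set T' := min δ (b - s) with hT'
      have hT'0 : 0 < T' := lt_min hδ0 (by linarith)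
      have hT'δ : T' ≤ δ := min_le_left _ _
      have hT'b : T' ≤ b - s := min_le_right _ _
      have hdu1 := (hdu.shift h hM (fun τ hτ => hu.memLp hτ) hs0 hsT).mono
        (show T' ≤ T - s by linarith)
      have hdv1 := (hdv.shift h hM (fun τ hτ => hv.memLp hτ) hs0 hsT).mono
        (show T' ≤ T - s by linarith)
      rw [← heq] at hdv1
      have kb : ∀ {w : ℝ → LpRn 𝕜 n r} {k : ℝ}, k ≤ K' → (∀ t ∈ Icc (a / 2) b,
          ‖w t‖ ≤ k ∧ eLpNorm (w t) M volume ≤ ENNReal.ofReal k) →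
          KatoBound (katoExponent n α r M) M K' T' (fun τ => w (s + τ)) := by
        intro w k hk hw τ hτ
        obtain ⟨q1, q2⟩ := hw (s + τ) ⟨by linarith [hτ.1], by linarith [hτ.2]⟩
        exact KatoAt.of_le_one hσ hK'0 hτ.1 (by linarith [hτ.2]) (q1.trans hk)
          (q2.trans (ENNReal.ofReal_le_ofReal hk))
      have := H (u s) K' T' _ _ hK'0 hT'0 (le_trans (by
        have := duhamelFactor_mono h hT'0.le hT'δ hK'0 le_rfl
        gcongr) hδfac) (kb hK'1 hK₁) (kb hK'2 hK₂) hdu1 hdv1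
        (show x - s ∈ Ioo 0 T' from ⟨by linarith, lt_min (by linarith) (by linarith)⟩)
      simpa using this
  obtain ⟨k, hk⟩ := exists_nat_gt ((t - a) / (δ / 2))
  rw [div_lt_iff₀ (by positivity)] at hk
  exact step k t ht.1 hbt (by linarith)

theorem KatoBound.of_le (hr : r ≤ M) {M' : ℝ≥0∞} (hMM' : M ≤ M') (hM' : M' ≠ ⊤) (hK : 0 ≤ K)
    (hu : KatoBound (katoExponent n α r M') M' K T u) :
    KatoBound (katoExponent n α r M) M K T u := fun t ht =>
  ⟨(hu t ht).1, eLpNorm_le_of_interpolation hr hMM' hM' ht.1 hK (hu t ht).1 (hu t ht).2⟩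

/-- Locally bounded solutions that are bounded in `L^r` near `0` obey a weighted bound near `0`. -/
theorem IsDuhamel.exists_katoBound (h : IsSubcritical α b₁ b₂ ε₁ ε₂ P r)
    (hM : IsKatoExponent n α b₁ r M) {M' : ℝ≥0∞} (hM' : IsKatoExponent n α b₁ r M')
    (hMM' : M ≤ M') (hrM' : r < M') (hbM' : b₁ + 1 < M'.toReal) (hT : 0 < T)
    (hd : IsDuhamel α b₁ b₂ ε₁ ε₂ P φ T u u) (hu : IsLocallyBounded M T u)
    {R T₁ : ℝ} (hT₁ : 0 < T₁) (hR : ∀ t ∈ Ioo 0 T₁, ‖u t‖ ≤ R) :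
    ∃ K ≥ 0, ∃ T₂ > 0, KatoBound (katoExponent n α r M) M K T₂ u := by
  have hσ := katoExponent_nonneg (n := n) h.alpha_pos hM.le hM.ne_top
  have hR0 : 0 ≤ R := (norm_nonneg _).trans (hR (T₁ / 2) ⟨by linarith, by linarith⟩)
  obtain ⟨A, hA, C, hC, H⟩ := exists_isDuhamel (𝕜 := 𝕜) h hM' hrM' hbM'
  obtain ⟨T₂, hfac, hT₂0, hT₂⟩ : ∃ δ, C * duhamelFactor α b₁ b₂ P r δ R ≤ 1 ∧ 0 < δ ∧
      δ < min (T / 2) T₁ := by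
    have h1 := (tendsto_duhamelFactor h R).const_mul C
    rw [mul_zero] at h1
    exact ((h1.eventually_le_const one_pos).and
      (Ioo_mem_nhdsGT (lt_min (half_pos hT) hT₁))).exists
  have hT₂T := hT₂.trans_le (min_le_left _ _)
  have hT₂T₁ := hT₂.trans_le (min_le_right _ _)
  have hAR : 0 ≤ A * R := by positivity
  have h2σ : (1:ℝ) ≤ 2 ^ katoExponent n α r M := Real.one_le_rpow one_le_two hσ
  refine ⟨A * R * 2 ^ katoExponent n α r M, by positivity, T₂, hT₂0, ?_⟩
  -- The solution v restarted from u(s) has a bound AR and a lifetime T₂ independent of s.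
  -- Uniqueness after time s, where u is already bounded in L^M, identifies it with u.
  have key : ∀ s ∈ Ioo 0 T₂, ∀ τ ∈ Ioo 0 T₂, KatoAt (katoExponent n α r M) M (A * R) τ
      (u (s + τ)) := by
    intro s hs τ hτ
    have hsT : s < T := by linarith [hs.2]
    obtain ⟨v, hdv, hv, -, -⟩ := H R hR0 T₂ hT₂0 hfac (u s) (hR s ⟨hs.1, hs.2.trans hT₂T₁⟩)
    have hv1 := KatoBound.of_le hM.le hMM' hM'.ne_top hAR hv
    have hdu := (hd.shift h hM (fun τ hτ => hu.memLp hτ) hs.1 hsT).mono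
      (show T₂ ≤ T - s by linarith [hs.2])
    -- This K depends on s, but it serves only to verify the hypotheses of uniqueness and does not
    -- enter the resulting bound.
    obtain ⟨K, hK⟩ := hu s ((s + T) / 2) hs.1 (by linarith)
    set T' := min T₂ (min 1 ((T - s) / 2)) with hT'
    have hT'0 : 0 < T' := lt_min hT₂0 (lt_min one_pos (by linarith))
    have hT'1 : T' ≤ 1 := (min_le_right _ _).trans (min_le_left _ _)
    have hT'2 : T' ≤ (T - s) / 2 := (min_le_right _ _).trans (min_le_right _ _)
    have hK0 : 0 ≤ max K (A * R) := le_max_of_le_right hAR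
    have hku : KatoBound (katoExponent n α r M) M (max K (A * R)) T' (fun τ => u (s + τ)) := by
      intro t ht
      obtain ⟨q1, q2⟩ := hK (s + t) ⟨by linarith [ht.1], by linarith [ht.2]⟩
      exact KatoAt.of_le_one hσ hK0 ht.1 (by linarith [ht.2]) (q1.trans (le_max_left _ _))
        (q2.trans (ENNReal.ofReal_le_ofReal (le_max_left _ _)))
    have := IsDuhamel.eqOn h hM hT'0 hK0 hdu hdv
      ((hu.shift hs.1.le).mono (by linarith [hs.2])) (hv1.isLocallyBounded hσ hAR) hku
      (hv1.mono (le_max_right _ _) (min_le_left _ _)) hτ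
    beta_reduce at this
    rw [this]
    exact hv1 τ hτ
  intro t ht
  -- Restart at t/2 and run for time t/2; halving the time in the weight costs the factor 2^σ.
  have ht2 : t / 2 ∈ Ioo 0 T₂ := ⟨by linarith [ht.1], by linarith [ht.1, ht.2]⟩
  obtain ⟨q1, q2⟩ := key (t / 2) ht2 (t / 2) ht2
  rw [add_halves] at q1 q2
  refine ⟨q1.trans (le_mul_of_one_le_right hAR h2σ), q2.trans (le_of_eq ?_)⟩
  rw [Real.div_rpow ht.1.le zero_le_two, Real.rpow_neg zero_le_two, div_inv_eq_mul]
  congr 1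
  ring

end uniqueness

/-! ### Exponents: subcriticality and admissibility -/

section exponents

variable {n : ℕ} {α b₁ b₂ ε₁ ε₂ : ℝ} {P : HigherOrderTerm n} {q p r : ℝ≥0∞}

/-- The hypothesis r ≥ r_d reads d·r + n·b₁ ≤ 2α·r. Dropping d·r > 0 gives the first strict
inequality, replacing b₁ by b₂ < b₁ the second, so the endpoint r = r_d is included. -/
theorem isSubcritical_of_le (hb₂ : 0 < b₂) (hb : b₂ < b₁) (hε₁ : ε₁ = 1 ∨ ε₁ = -1)
    (hε₂ : ε₂ = 1 ∨ ε₂ = -1) (hα : P.order < 2 * α) (hr' : r ≠ ⊤)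
    (hrd : 1 < n * b₁ / (2 * α - P.order)) (hr : n * b₁ / (2 * α - P.order) ≤ r.toReal) :
    IsSubcritical α b₁ b₂ ε₁ ε₂ P r := by
  rw [P.order_eq] at *
  have hd : (0:ℝ) ≤ P.degree := Nat.cast_nonneg _
  have hα0 : 0 < α := by linarith
  have hρ : 0 < r.toReal := by linarith
  have hαd : 0 < 2 * α - P.degree := by linarith
  have hn : n ≠ 0 := by
    rintro rfl
    norm_num at hrd
  have hn0 : (0:ℝ) < n := by positivity
  rw [div_le_iff₀ hαd] at hr
  refine ⟨hn, hα0, hb₂, hb, hε₁, hε₂, hr', ?_, ?_⟩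
  · rcases P.degree.eq_zero_or_pos with h0 | h0
    · cases P <;> simp [HigherOrderTerm.degree] at h0
    · have h0' : (0:ℝ) < P.degree := by exact_mod_cast h0
      rw [div_lt_one hρ, div_mul_eq_mul_div, div_lt_iff₀ (by positivity)]
      nlinarith
  · have e : P.degree / (2 * α) + n / (2 * α) * b₂ / r.toReal =
        (P.degree * r.toReal + n * b₂) / (2 * α * r.toReal) := by field_simp
    rw [e, div_lt_one (by positivity)]
    nlinarith

theorem one_le_toReal [hr : Fact (1 ≤ r)] (hr' : r ≠ ⊤) : 1 ≤ r.toReal := by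
  rw [← ENNReal.toReal_one]; exact ENNReal.toReal_mono hr' hr.out

/-- The smallest usable exponent M. In the case M = b₁ + 1 the weight condition follows from
subcriticality and 1/r − 1/(b₁+1) ≤ b₁/r, which holds since r ≥ 1. -/
theorem isKatoExponent_max [hr : Fact (1 ≤ r)] (h : IsSubcritical α b₁ b₂ ε₁ ε₂ P r) :
    IsKatoExponent n α b₁ r (max r (ENNReal.ofReal (b₁ + 1))) := by
  have hb := h.b₂_pos.trans h.b₂_lt
  have hρ := one_le_toReal h.ne_top
  have hα := h.alpha_pos
  have htop : max r (ENNReal.ofReal (b₁ + 1)) ≠ ⊤ := by simp [h.ne_top]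
  have e : (ENNReal.ofReal (b₁ + 1)).toReal = b₁ + 1 := ENNReal.toReal_ofReal (by linarith)
  refine ⟨le_max_left _ _, htop, ?_, ?_⟩
  · exact e.symm.le.trans (ENNReal.toReal_mono htop (le_max_right _ _))
  · rcases le_total (ENNReal.ofReal (b₁ + 1)) r with h1 | h1
    · rw [max_eq_left h1, katoExponent_self]; exact one_pos
    · rw [max_eq_right h1, katoExponent, e]
      refine lt_of_le_of_lt ?_ h.lt_one₁
      rw [mul_div_assoc]
      gcongr
      rw [div_sub_div _ _ (by positivity) (by positivity), div_le_div_iff₀ (by positivity)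
        (by positivity)]
      nlinarith [mul_nonneg (mul_nonneg hb.le (sub_nonneg.2 hρ)) (sub_nonneg.2 hρ),
        mul_nonneg hb.le (sub_nonneg.2 hρ), mul_pos hb hb, sq_nonneg (r.toReal - 1)]

/-- The upper bound on p in the definition of a generalized admissible triplet is exactly this
inequality, cleared of denominators. -/
theorem GeneralizedAdmissible.katoExponent_lt_one (ht : GeneralizedAdmissible n α q p r)
    (hα : 0 < α) (hn : n ≠ 0) : katoExponent n α r p < 1 := by
  have hn0 : (0:ℝ) < n := by positivity
  have hr0 : r ≠ 0 := (one_pos.trans ht.one_lt).ne'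
  have hrp := ht.le
  have hp := ht.lt_top.ne
  have hρ : 0 < r.toReal := ENNReal.toReal_pos hr0 (ne_top_of_le_ne_top hp hrp)
  have hπ : 0 < p.toReal := ENNReal.toReal_pos (hr0.bot_lt.trans_le hrp).ne' hp
  have e : katoExponent n α r p = n * (p.toReal - r.toReal) / (2 * α * (r.toReal * p.toReal)) := by
    rw [katoExponent]; field_simp
  rw [e, div_lt_one (by positivity)]
  rcases lt_or_ge (2 * α * r.toReal) n with h1 | h1
  · have := ht.lt_bound h1
    rw [lt_div_iff₀ (by linarith)] at this
    nlinarith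
  · nlinarith [mul_pos hn0 hρ]

/-- The condition σ < 1 is open in M and holds at max(r, b₁+1, p), so M can be moved slightly above.
The strict inequalities gained are those needed for time continuity. -/
theorem GeneralizedAdmissible.exists_isKatoExponent [hr : Fact (1 ≤ r)]
    (ht : GeneralizedAdmissible n α q p r) (h : IsSubcritical α b₁ b₂ ε₁ ε₂ P r) :
    ∃ M, IsKatoExponent n α b₁ r M ∧ max r (ENNReal.ofReal (b₁ + 1)) ≤ M ∧ r < M ∧
      b₁ + 1 < M.toReal ∧ p < M := by
  have hb := h.b₂_pos.trans h.b₂_lt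
  have hmax := isKatoExponent_max h
  set X := max (max r (ENNReal.ofReal (b₁ + 1))) p with hX
  have hp := ht.lt_top.ne
  have hXtop : X ≠ ⊤ := by simp [hX, hp, h.ne_top]
  have hXσ : katoExponent n α r X < 1 := by
    rcases le_total (max r (ENNReal.ofReal (b₁ + 1))) p with h1 | h1
    · rw [hX, max_eq_right h1]; exact ht.katoExponent_lt_one h.alpha_pos h.ne_zero
    · rw [hX, max_eq_left h1]; exact hmax.lt_one
  have hrX : r ≤ X := hmax.le.trans (le_max_left _ _)
  have hbX : b₁ + 1 ≤ X.toReal := hmax.b_le.trans (ENNReal.toReal_mono hXtop (le_max_left _ _))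
  have hX0 : 0 < X.toReal := by linarith
  have hcont : ContinuousAt (fun y : ℝ => n / (2 * α) * (1 / r.toReal - 1 / y)) X.toReal := by
    have := hX0.ne'
    fun_prop (disch := assumption)
  have hev := (hcont.eventually_lt_const hXσ).filter_mono (nhdsWithin_le_nhds (s := Ioi X.toReal))
  obtain ⟨y, hy1, hy2⟩ := (hev.and self_mem_nhdsWithin).exists
  have hy2 : X.toReal < y := hy2
  have hXy : X < ENNReal.ofReal y := (ENNReal.lt_ofReal_iff_toReal_lt hXtop).2 hy2
  have hye : (ENNReal.ofReal y).toReal = y := ENNReal.toReal_ofReal (by linarith)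
  refine ⟨ENNReal.ofReal y, ⟨hrX.trans hXy.le, ENNReal.ofReal_ne_top, ?_, ?_⟩,
    (le_max_left _ _).trans hXy.le, hrX.trans_lt hXy, ?_, (le_max_right _ _).trans_lt hXy⟩
  · rw [hye]; linarith
  · rw [katoExponent, hye]; exact hy1
  · rw [hye]; linarith

theorem GeneralizedAdmissible.toReal_inv [Fact (1 ≤ r)] (ht : GeneralizedAdmissible n α q p r)
    (hα : 0 < α) :
    (q⁻¹).toReal = katoExponent n α r p := by
  rw [ht.inv_eq, ENNReal.toReal_ofReal]
  · rfl
  · exact katoExponent_nonneg hα ht.le ht.lt_top.ne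

end exponents

/-! ### Mild solutions: comparison with the integral equation, existence, uniqueness -/

section mildSolution

variable {𝕜 : Type*} [RCLike 𝕜] {n : ℕ} {α b₁ b₂ ε₁ ε₂ : ℝ} {P : HigherOrderTerm n} {q p r : ℝ≥0∞}
  [hp1 : Fact (1 ≤ p)] [hr1 : Fact (1 ≤ r)] {φ : LpRn 𝕜 n r} {T : ℝ} {u : ℝ → LpRn 𝕜 n r}

/-- The unspecified exponent m of the definition is interpolated down, against continuity in L^r, to
the fixed exponent max(r, b₁+1). Solutions with different m thereby fall into one uniqueness class.
-/
theorem IsMildSolution.isLocallyBounded (h : IsSubcritical α b₁ b₂ ε₁ ε₂ P r)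
    (hu : IsMildSolution α b₁ b₂ ε₁ ε₂ P q p φ T u) :
    IsLocallyBounded (max r (ENNReal.ofReal (b₁ + 1))) T u := by
  intro a b ha hb
  have hr0 : r ≠ 0 := (one_pos.trans_le hr1.out).ne'
  obtain ⟨m, hm, hmb⟩ := hu.nonlinearity
  obtain ⟨B, hB⟩ := hmb a b ha hb
  obtain ⟨K, hK⟩ : ∃ K, ∀ t ∈ Icc a b, ‖u t‖ ≤ K := isCompact_Icc.exists_bound_of_continuousOn
    (hu.memY.1.mono (fun t ht => ⟨ha.le.trans ht.1, ht.2.trans_lt hb⟩))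
  set M := max r (ENNReal.ofReal (b₁ + 1)) with hM
  have hMtop : M ≠ ⊤ := by simp [hM, h.ne_top]
  suffices ∃ c : ℝ≥0∞, c ≠ ⊤ ∧ ∀ t ∈ Icc a b, eLpNorm (u t) M volume ≤ c by
    obtain ⟨c, hc, hc'⟩ := this
    exact ⟨max K c.toReal, fun t ht => ⟨(hK t ht).trans (le_max_left _ _), (hc' t ht).trans
      (ENNReal.le_ofReal_iff_toReal_le hc (le_max_of_le_right ENNReal.toReal_nonneg)|>.2
        (le_max_right _ _))⟩⟩
  have hKr : ∀ t ∈ Icc a b, eLpNorm (u t) r volume ≤ ENNReal.ofReal K := fun t ht => by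
    rw [← Lp.enorm_def, ← ofReal_norm]; exact ENNReal.ofReal_le_ofReal (hK t ht)
  have hMr : r ≤ M := le_max_left _ _
  have hM0 : M ≠ 0 := (hr0.bot_lt.trans_le hMr).ne'
  rcases eq_or_ne m ⊤ with rfl | hmtop
  · have hexp : 0 ≤ 1 - r.toReal / M.toReal := by
      have h1 := ENNReal.toReal_mono hMtop hMr
      have h2 := ENNReal.toReal_pos hM0 hMtop
      rw [sub_nonneg, div_le_one h2]
      exact h1
    have hexp' : 0 ≤ r.toReal / M.toReal := by positivity
    refine ⟨ENNReal.ofReal K ^ (r.toReal / M.toReal) * (B:ℝ≥0∞) ^ (1 - r.toReal / M.toReal),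
      ENNReal.mul_ne_top (ENNReal.rpow_ne_top_of_nonneg hexp' ENNReal.ofReal_ne_top)
        (ENNReal.rpow_ne_top_of_nonneg hexp ENNReal.coe_ne_top), fun t ht => ?_⟩
    refine (eLpNorm_le_of_top hr0 hMr hMtop ((hB t ht).trans_lt ENNReal.coe_lt_top).ne).trans ?_
    have h1 := hKr t ht
    have h2 := hB t ht
    gcongr
  · rcases le_total (ENNReal.ofReal (b₁ + 1)) r with h1 | h1
    · refine ⟨ENNReal.ofReal K, ENNReal.ofReal_ne_top, fun t ht => ?_⟩
      rw [hM, max_eq_left h1]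
      exact hKr t ht
    · have hMm : M ≤ m := by rw [hM, max_eq_right h1]; exact hm
      refine ⟨ENNReal.ofReal (max K B), ENNReal.ofReal_ne_top, fun t ht => ?_⟩
      have := eLpNorm_le_of_interpolation hMr hMm hmtop (ν := 0) (t := 1) one_pos
        (K := max K B) (le_max_of_le_right B.2) (u := u t) ((hK t ht).trans (le_max_left _ _))
        ((hB t ht).trans (by
          rw [zero_mul, neg_zero, Real.rpow_zero, mul_one, ← ENNReal.ofReal_coe_nnreal]
          exact ENNReal.ofReal_le_ofReal (le_max_right _ _)))
      simpa using this

theorem IsMildSolution.isDuhamel (h : IsSubcritical α b₁ b₂ ε₁ ε₂ P r)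
    (hu : IsMildSolution α b₁ b₂ ε₁ ε₂ P q p φ T u) : IsDuhamel α b₁ b₂ ε₁ ε₂ P φ T u u := by
  have : NeZero n := ⟨h.ne_zero⟩
  have : Nonempty (Fin n) := ⟨0⟩
  have hM := isKatoExponent_max h
  have hb := hu.isLocallyBounded h
  intro t ht
  obtain ⟨G, hG, hGi, hGe⟩ := hu.duhamel t ht
  have hEq : EqOn G (fun τ => duhamelLp α b₁ b₂ ε₁ ε₂ P (t - τ) (u τ)) (Ioo 0 t) := fun τ hτ =>
    Lp.ext ((hG τ hτ).trans (duhamelLp_coeFn h hM (sub_pos.2 hτ.2)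
      (hb.memLp ⟨hτ.1, hτ.2.trans ht.2⟩)).symm)
  refine ⟨hGi.congr_fun hEq measurableSet_Ioo, ?_⟩
  rw [← setIntegral_congr_fun measurableSet_Ioo hEq]
  refine Lp.ext (hGe.trans ?_)
  filter_upwards [heatOp_coeFn isHomogeneousSymbol_one h.alpha_pos ht.1 le_rfl h.ne_top φ,
    Lp.coeFn_add (dissipativeSemigroup 𝕜 n α r t φ) (∫ τ in Ioo 0 t, G τ)] with x h1 h2
  rw [h2, Pi.add_apply, h1, kernelConv_eq_heatKernel]

theorem IsDuhamel.isMildSolution (h : IsSubcritical α b₁ b₂ ε₁ ε₂ P r)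
    (hd : IsDuhamel α b₁ b₂ ε₁ ε₂ P φ T u u) (hY : MemY q p T u) (h0 : u 0 = φ)
    (hb : IsLocallyBounded (max r (ENNReal.ofReal (b₁ + 1))) T u) :
    IsMildSolution α b₁ b₂ ε₁ ε₂ P q p φ T u := by
  have : NeZero n := ⟨h.ne_zero⟩
  have : Nonempty (Fin n) := ⟨0⟩
  refine ⟨hY, ⟨_, le_max_right r _, fun a b ha hbT => ?_⟩, h0, fun t ht => ?_⟩
  · obtain ⟨K, hK⟩ := hb a b ha hbT
    exact ⟨K.toNNReal, fun t ht => (hK t ht).2⟩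
  · obtain ⟨i, e⟩ := hd t ht
    refine ⟨_, fun τ hτ => duhamelLp_coeFn h (isKatoExponent_max h) (sub_pos.2 hτ.2)
      (hb.memLp ⟨hτ.1, hτ.2.trans ht.2⟩), i, ?_⟩
    rw [e]
    filter_upwards [heatOp_coeFn isHomogeneousSymbol_one h.alpha_pos ht.1 le_rfl h.ne_top φ,
      Lp.coeFn_add (dissipativeSemigroup 𝕜 n α r t φ)
        (∫ τ in Ioo 0 t, duhamelLp α b₁ b₂ ε₁ ε₂ P (t - τ) (u τ))] with x h1 h2
    rw [h2, Pi.add_apply, h1, kernelConv_eq_heatKernel]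

/-- Since p < M, both the weight 1/q and the continuity in L^p follow by interpolating between L^r
and L^M. -/
theorem memY_of_katoBound (ht : GeneralizedAdmissible n α q p r) (hα : 0 < α) {M : ℝ≥0∞}
    (hpM : p < M) (hM : M ≠ ⊤) {K : ℝ} (hK : 0 ≤ K)
    (hu : KatoBound (katoExponent n α r M) M K T u) (hc : ContinuousOn u (Ico 0 T)) :
    MemY q p T u := by
  have hrM := ht.le.trans hpM.le
  have hp0 : p ≠ 0 := (one_pos.trans_le hp1.out).ne'
  have hmem : ∀ t ∈ Ioo 0 T, MemLp (u t) p := fun t htt =>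
    memLp_of_le_of_le ht.le hpM.le hM (hu t htt).memLp
  have hup := KatoBound.of_le ht.le hpM.le hM hK hu
  refine ⟨hc, fun t => lpOf p volume (u t), fun t htt => lpOf_coeFn (hmem t htt), ?_, K, ?_⟩
  · intro t htt
    rw [ContinuousWithinAt, Lp.tendsto_Lp_iff_tendsto_eLpNorm']
    obtain ⟨c, hc'⟩ := hu.isLocallyBounded (katoExponent_nonneg hα hrM hM) hK (t / 2)
      ((t + T) / 2) (by linarith [htt.1]) (by linarith [htt.2])
    have h1 : 0 < t := htt.1
    have h2 : t < T := htt.2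
    have hev : ∀ᶠ x in 𝓝[Ioo 0 T] t, x ∈ Icc (t / 2) ((t + T) / 2) :=
      mem_nhdsWithin_of_mem_nhds (Icc_mem_nhds (by linarith) (by linarith))
    have := tendsto_eLpNorm_sub_of_bounded ht.le hpM hM ((hc.mono Ioo_subset_Ico_self) t htt)
      ENNReal.ofReal_ne_top (hev.mono fun x hx => (hc' x hx).2)
      (hc' t ⟨by linarith, by linarith⟩).2
    refine this.congr' ?_
    filter_upwards [self_mem_nhdsWithin] with x hx
    refine eLpNorm_congr_ae ?_
    filter_upwards [lpOf_coeFn (hmem x hx), lpOf_coeFn (hmem t htt)] with y h1 h2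
    rw [Pi.sub_apply, h1, h2]
  · intro t htt
    rw [ht.toReal_inv hα]
    have h1 : ‖lpOf p volume (u t)‖ ≤ K * t ^ (-katoExponent n α r p) := by
      have := htt.1
      rw [Lp.norm_def, eLpNorm_congr_ae (lpOf_coeFn (hmem t htt))]
      exact ENNReal.toReal_le_of_le_ofReal (by positivity) (hup t htt).2
    calc _ ≤ t ^ katoExponent n α r p * (K * t ^ (-katoExponent n α r p)) := by
          have := htt.1
          gcongr
      _ = K * (t ^ katoExponent n α r p * t ^ (-katoExponent n α r p)) := by ring
      _ = K := by rw [← Real.rpow_add htt.1, add_neg_cancel, Real.rpow_zero, mul_one]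

/-- Local existence of mild solutions. -/
theorem exists_isMildSolution (h : IsSubcritical α b₁ b₂ ε₁ ε₂ P r)
    (ht : GeneralizedAdmissible n α q p r) :
    ∃ C > 0, ∀ R ≥ 0, ∀ T > 0, C * duhamelFactor α b₁ b₂ P r T R ≤ 1 →
      ∀ φ : LpRn 𝕜 n r, ‖φ‖ ≤ R → ∃ u, IsMildSolution α b₁ b₂ ε₁ ε₂ P q p φ T u := by
  obtain ⟨M, hM, hmax, hrM, hbM, hpM⟩ := ht.exists_isKatoExponent h
  obtain ⟨A, hA, C, hC, H⟩ := exists_isDuhamel (𝕜 := 𝕜) h hM hrM hbM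
  have hσ := katoExponent_nonneg (n := n) h.alpha_pos hM.le hM.ne_top
  refine ⟨C, hC, fun R hR T hT hfac φ hφ => ?_⟩
  obtain ⟨u, hd, hu, hc, h0⟩ := H R hR T hT hfac φ hφ
  have hAR : 0 ≤ A * R := by positivity
  -- The fixed-point argument determines u only for t > 0, with limit φ at 0; the value at 0 has to
  -- be set by hand.
  set w := Function.update u 0 φ with hw
  have hw0 : w 0 = φ := Function.update_self _ _ _
  have hwu : ∀ t ≠ 0, w t = u t := fun t ht => Function.update_of_ne ht _ _
  have hEq : EqOn u w (Ioo 0 T) := fun t ht => (hwu t ht.1.ne').symm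
  have hwK : KatoBound (katoExponent n α r M) M (A * R) T w := fun t htt => by
    rw [← hEq htt]; exact hu t htt
  have hwc : ContinuousOn w (Ico 0 T) := by
    intro t htt
    rcases htt.1.eq_or_lt with rfl | h1
    · rw [ContinuousWithinAt, hw0]
      have : 𝓝[Ico 0 T] (0:ℝ) = 𝓝[≥] 0 := nhdsWithin_Ico_eq_nhdsGE hT
      rw [this, ← Ioi_insert, nhdsWithin_insert, tendsto_sup]
      constructor
      · rw [← hw0]; exact tendsto_pure_nhds _ _
      · refine h0.congr' ?_
        filter_upwards [self_mem_nhdsWithin] with x hx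
        exact (hwu x (ne_of_gt hx)).symm
    · have := (hc.congr hEq.symm) t ⟨h1, htt.2⟩
      exact (this.continuousAt (Ioo_mem_nhds h1 htt.2)).continuousWithinAt
  exact ⟨w, (hd.congr hEq hEq).isMildSolution h
    (memY_of_katoBound ht h.alpha_pos hpM hM.ne_top hAR hwK hwc) hw0
    ((hwK.of_le (le_max_left _ _) hmax hM.ne_top hAR).isLocallyBounded
      (katoExponent_nonneg h.alpha_pos (le_max_left _ _) (isKatoExponent_max h).ne_top) hAR)⟩

/-- Uniqueness of mild solutions. -/
theorem IsMildSolution.eqOn (h : IsSubcritical α b₁ b₂ ε₁ ε₂ P r)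
    (ht : GeneralizedAdmissible n α q p r) {v : ℝ → LpRn 𝕜 n r}
    (hu : IsMildSolution α b₁ b₂ ε₁ ε₂ P q p φ T u)
    (hv : IsMildSolution α b₁ b₂ ε₁ ε₂ P q p φ T v) : EqOn u v (Ico 0 T) := by
  obtain ⟨M, hM, hmax, hrM, hbM, hpM⟩ := ht.exists_isKatoExponent h
  have hM₀ := isKatoExponent_max h
  intro t htt
  have hT : 0 < T := htt.1.trans_lt htt.2
  -- Continuity in L^r down to t = 0 bounds the norm there, and restarting upgrades this to the
  -- weighted bound that uniqueness needs.
  have key : ∀ {w : ℝ → LpRn 𝕜 n r}, IsMildSolution α b₁ b₂ ε₁ ε₂ P q p φ T w →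
      ∃ K ≥ 0, ∃ T₂ > 0, KatoBound (katoExponent n α r (max r (ENNReal.ofReal (b₁ + 1))))
        (max r (ENNReal.ofReal (b₁ + 1))) K T₂ w := by
    intro w hw
    obtain ⟨R, hR⟩ : ∃ R, ∀ t ∈ Icc 0 (T / 2), ‖w t‖ ≤ R :=
      isCompact_Icc.exists_bound_of_continuousOn
        (hw.memY.1.mono (fun t ht => ⟨ht.1, by linarith [ht.2]⟩))
    exact (hw.isDuhamel h).exists_katoBound h hM₀ hM hmax hrM hbM hT (hw.isLocallyBounded h)
      (half_pos hT) (fun t ht => hR t (Ioo_subset_Icc_self ht))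
  obtain ⟨K₁, hK₁, T₁, hT₁, k₁⟩ := key hu
  obtain ⟨K₂, hK₂, T₂, hT₂, k₂⟩ := key hv
  rcases htt.1.eq_or_lt with rfl | h1
  · rw [hu.initial, hv.initial]
  · exact (hu.isDuhamel h).eqOn h hM₀ (lt_min hT₁ hT₂) (le_max_of_le_left hK₁) (hv.isDuhamel h)
      (hu.isLocallyBounded h) (hv.isLocallyBounded h)
      (k₁.mono (le_max_left _ _) (min_le_left _ _)) (k₂.mono (le_max_right _ _) (min_le_right _ _))
      ⟨h1, htt.2⟩

end mildSolution

/-! ### Continuation and maximal solutions -/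

/-- Agreement on the whole overlap (s,T) replaces a matching condition at the switching time: near
any t ≥ T the glued curve coincides with the shifted g. -/
theorem continuousOn_ite_comp_sub {B : Type*} [TopologicalSpace B] {A : Set ℝ} {s T T' : ℝ}
    {f g : ℝ → B} (hs : s < T) (hf : ContinuousOn f (A ∩ Iio T)) (hg : ContinuousOn g (Ioo 0 T'))
    (heq : ∀ τ ∈ Ioo s T, f τ = g (τ - s)) :
    ContinuousOn (fun t => if t < T then f t else g (t - s)) (A ∩ Iio (s + T')) := by
  rintro t ⟨htA, htT'⟩
  rw [mem_Iio] at htT'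
  rcases lt_or_ge t T with ht | ht
  · have h1 : ContinuousWithinAt f (A ∩ Iio (s + T')) t := by
      refine (hf t ⟨htA, ht⟩).mono_of_mem_nhdsWithin ?_
      filter_upwards [self_mem_nhdsWithin, mem_nhdsWithin_of_mem_nhds
          (Iio_mem_nhds ht)] with x hx hx'
      exact ⟨hx.1, hx'⟩
    refine h1.congr_of_eventuallyEq ?_ (by simp [ht])
    filter_upwards [mem_nhdsWithin_of_mem_nhds (Iio_mem_nhds ht)] with x hx
    simp [mem_Iio.1 hx]
  · have hts : s < t := hs.trans_le ht
    have h1 : ContinuousAt (fun x => g (x - s)) t :=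
      ContinuousAt.comp (f := fun x => x - s)
        (hg.continuousAt (Ioo_mem_nhds (by linarith) (by linarith)))
        (continuous_sub_right s).continuousAt
    refine (h1.congr ?_).continuousWithinAt
    filter_upwards [Ioi_mem_nhds hts] with x hx
    split_ifs with hxT
    · exact (heq x ⟨hx, hxT⟩).symm
    · rfl

section continuation

variable {𝕜 : Type*} [RCLike 𝕜] {n : ℕ} {α b₁ b₂ ε₁ ε₂ : ℝ} {P : HigherOrderTerm n} {q p r : ℝ≥0∞}
  [hp1 : Fact (1 ≤ p)] [hr1 : Fact (1 ≤ r)] {φ : LpRn 𝕜 n r} {T : ℝ} {u v : ℝ → LpRn 𝕜 n r}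

theorem IsMildSolution.mono {T' : ℝ} (hu : IsMildSolution α b₁ b₂ ε₁ ε₂ P q p φ T u)
    (hT : T' ≤ T) : IsMildSolution α b₁ b₂ ε₁ ε₂ P q p φ T' u := by
  obtain ⟨⟨hc, w, hw, hwc, M, hM⟩, ⟨m, hm, hmb⟩, h0, hd⟩ := hu
  have h1 : Ioo 0 T' ⊆ Ioo 0 T := Ioo_subset_Ioo_right hT
  exact ⟨⟨hc.mono (Ico_subset_Ico_right hT), w, fun t ht => hw t (h1 ht), hwc.mono h1, M,
    fun t ht => hM t (h1 ht)⟩, ⟨m, hm, fun a b ha hb => hmb a b ha (hb.trans_le hT)⟩, h0,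
    fun t ht => hd t (h1 ht)⟩

theorem IsMildSolution.congr (hu : IsMildSolution α b₁ b₂ ε₁ ε₂ P q p φ T u) (hT : 0 < T)
    (huv : EqOn v u (Ico 0 T)) : IsMildSolution α b₁ b₂ ε₁ ε₂ P q p φ T v := by
  obtain ⟨⟨hc, w, hw, hw'⟩, ⟨m, hm, hmb⟩, h0, hd⟩ := hu
  have h1 : ∀ t ∈ Ioo 0 T, v t = u t := fun t ht => huv (Ioo_subset_Ico_self ht)
  refine ⟨⟨hc.congr huv, w, fun t ht => by rw [h1 t ht]; exact hw t ht, hw'⟩,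
    ⟨m, hm, fun a b ha hb => ?_⟩, by rw [huv ⟨le_rfl, hT⟩, h0], fun t ht => ?_⟩
  · obtain ⟨M, hM⟩ := hmb a b ha hb
    exact ⟨M, fun t ht => by
      rw [h1 t ⟨ha.trans_le ht.1, ht.2.trans_lt hb⟩]; exact hM t ht⟩
  · obtain ⟨G, hG, hi, he⟩ := hd t ht
    exact ⟨G, fun τ hτ => by rw [h1 τ ⟨hτ.1, hτ.2.trans ht.2⟩]; exact hG τ hτ, hi, by
      rw [h1 t ht]; exact he⟩

theorem IsMildSolution.shift (h : IsSubcritical α b₁ b₂ ε₁ ε₂ P r)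
    (hu : IsMildSolution α b₁ b₂ ε₁ ε₂ P q p φ T u) {s : ℝ} (hs : 0 < s) (hsT : s < T) :
    IsMildSolution α b₁ b₂ ε₁ ε₂ P q p (u s) (T - s) (fun τ => u (s + τ)) := by
  have hb := hu.isLocallyBounded h
  refine ((hu.isDuhamel h).shift h (isKatoExponent_max h) (fun τ hτ => hb.memLp hτ) hs
    hsT).isMildSolution h ?_ (by rw [add_zero]) (hb.shift hs.le)
  obtain ⟨hc, w, hw, hwc, M, hM⟩ := hu.memY
  have m1 : ∀ t ∈ Ioo 0 (T - s), s + t ∈ Ioo 0 T := fun t ht =>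
    ⟨by linarith [ht.1], by linarith [ht.2]⟩
  refine ⟨hc.comp (continuous_const.add continuous_id).continuousOn fun t ht =>
    ⟨by linarith [ht.1, hs], by linarith [ht.2]⟩,
    fun τ => w (s + τ), fun t ht => hw _ (m1 t ht),
    hwc.comp (continuous_const.add continuous_id).continuousOn m1, M, fun t ht => ?_⟩
  refine le_trans ?_ (hM _ (m1 t ht))
  have := ht.1.le
  gcongr
  linarith

/-- Continuation of a mild solution by a mild solution that starts from one of its values. -/
theorem IsMildSolution.glue (h : IsSubcritical α b₁ b₂ ε₁ ε₂ P r)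
    (ht : GeneralizedAdmissible n α q p r) (hu : IsMildSolution α b₁ b₂ ε₁ ε₂ P q p φ
        T u) {s T' : ℝ}
    (hs : 0 < s) (hsT : s < T) (hv : IsMildSolution α b₁ b₂ ε₁ ε₂ P q p (u s) T' v)
    (hT' : T ≤ s + T') :
    IsMildSolution α b₁ b₂ ε₁ ε₂ P q p φ (s + T') (fun t => if t < T then u t else v (t - s)) := by
  have heq : ∀ t ∈ Ico s T, u t = v (t - s) := by
    intro t htt
    have := (hu.shift h hs hsT).eqOn h ht (hv.mono (by linarith))
      (show t - s ∈ Ico 0 (T - s) from ⟨by linarith [htt.1], by linarith [htt.2]⟩)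
    simpa using this
  set z : ℝ → LpRn 𝕜 n r := fun t => if t < T then u t else v (t - s) with hz
  have hzu : ∀ t < T, z t = u t := fun t ht => by simp [hz, ht]
  have hzv : ∀ t ≥ s, z t = v (t - s) := by
    intro t hts
    rcases lt_or_ge t T with h1 | h1
    · rw [hzu t h1, heq t ⟨hts, h1⟩]
    · simp [hz, h1]
  have hub := hu.isLocallyBounded h
  have hvb := hv.isLocallyBounded h
  have hzb : IsLocallyBounded (max r (ENNReal.ofReal (b₁ + 1))) (s + T') z := by
    intro a b ha hb
    -- Nothing bounds u up to T itself, so the bound for v takes over at an intermediate time c in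
    -- (s,T).
    obtain ⟨c, hsc, hcT⟩ := exists_between hsT
    obtain ⟨K₁, hK₁⟩ := hub a c ha hcT
    obtain ⟨K₂, hK₂⟩ := hvb (c - s) (b - s) (by linarith) (by linarith)
    refine ⟨max K₁ K₂, fun t htt => ?_⟩
    rcases le_total t c with h1 | h1
    · rw [hzu t (h1.trans_lt hcT)]
      obtain ⟨q1, q2⟩ := hK₁ t ⟨htt.1, h1⟩
      exact ⟨q1.trans (le_max_left _ _), q2.trans (ENNReal.ofReal_le_ofReal (le_max_left _ _))⟩
    · rw [hzv t (hsc.le.trans h1)]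
      obtain ⟨q1, q2⟩ := hK₂ (t - s) ⟨by linarith, by linarith [htt.2]⟩
      exact ⟨q1.trans (le_max_right _ _), q2.trans (ENNReal.ofReal_le_ofReal (le_max_right _ _))⟩
  refine ((hu.isDuhamel h).glue h (isKatoExponent_max h) hs hsT (fun τ hτ => hub.memLp hτ)
    (hv.isDuhamel h) (fun t ht => hzu t (ht.2.trans_lt hsT))
    (fun t ht => by rw [hzv _ (by linarith [ht.1]), add_sub_cancel_left])).isMildSolution h ?_
    (by rw [hzu 0 (hs.trans hsT), hu.initial]) hzb
  obtain ⟨huc, U, hU, hUc, A, hA⟩ := hu.memY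
  obtain ⟨hvc, W, hW, hWc, B, hB⟩ := hv.memY
  have hTs : 0 < T - s := by linarith
  have hUW : ∀ τ ∈ Ioo s T, U τ = W (τ - s) := fun τ hτ => by
    refine Lp.ext ((hU τ ⟨hs.trans hτ.1, hτ.2⟩).trans ?_)
    rw [heq τ ⟨hτ.1.le, hτ.2⟩]
    exact (hW (τ - s) ⟨by linarith [hτ.1], by linarith [hτ.2]⟩).symm
  refine ⟨?_, fun t => if t < T then U t else W (t - s), fun t htt => ?_, ?_,
    -- For t ≥ T the shifted time t − s is at least T − s > 0, so the weighted bound for v gives an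
    -- unweighted one there.
    max A ((s + T') ^ (q⁻¹).toReal * (B / (T - s) ^ (q⁻¹).toReal)), fun t htt => ?_⟩
  · rw [← Ici_inter_Iio] at huc ⊢
    exact continuousOn_ite_comp_sub hsT huc (hvc.mono Ioo_subset_Ico_self)
      (fun τ hτ => heq τ ⟨hτ.1.le, hτ.2⟩)
  · beta_reduce
    rcases lt_or_ge t T with h1 | h1
    · rw [hzu t h1, if_pos h1]; exact hU t ⟨htt.1, h1⟩
    · rw [hzv t (hsT.le.trans h1), if_neg (not_lt.2 h1)]
      exact hW _ ⟨by linarith, by linarith [htt.2]⟩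
  · rw [← Ioi_inter_Iio] at hUc ⊢
    exact continuousOn_ite_comp_sub hsT hUc hWc hUW
  · beta_reduce
    rcases lt_or_ge t T with h1 | h1
    · rw [if_pos h1]; exact (hA t ⟨htt.1, h1⟩).trans (le_max_left _ _)
    · rw [if_neg (not_lt.2 h1)]
      have hts : 0 < t - s := by linarith
      have h2 := hB (t - s) ⟨hts, by linarith [htt.2]⟩
      have h3 : (T - s) ^ (q⁻¹).toReal * ‖W (t - s)‖ ≤ B := by
        refine le_trans ?_ h2
        gcongr
      have h4 : ‖W (t - s)‖ ≤ B / (T - s) ^ (q⁻¹).toReal := by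
        rw [le_div_iff₀ (by positivity), mul_comm]; exact h3
      refine le_trans ?_ (le_max_right _ _)
      have h5 := htt.1.le
      have h6 := htt.2.le
      have h7 : 0 ≤ s + T' := h5.trans h6
      gcongr

/-- A solution is global or has a maximal existence interval. -/
theorem exists_global_or_isMaximalSolution (h : IsSubcritical α b₁ b₂ ε₁ ε₂ P r)
    (ht : GeneralizedAdmissible n α q p r)
    (hloc : ∃ T > 0, ∃ u, IsMildSolution α b₁ b₂ ε₁ ε₂ P q p φ T u) :
    ∃ u, (∀ T > 0, IsMildSolution α b₁ b₂ ε₁ ε₂ P q p φ T u) ∨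
      ∃ Tₘ, IsMaximalSolution α b₁ b₂ ε₁ ε₂ P q p φ Tₘ u := by
  classical
  obtain ⟨u, hu⟩ : ∃ u : ℝ → LpRn 𝕜 n r, ∀ T v, IsMildSolution α b₁ b₂ ε₁ ε₂ P q p φ T v →
      EqOn u v (Ico 0 T) := by
    -- By uniqueness all mild solutions defined at t share one value, so a single curve u extends
    -- them all.
    have : ∀ t, ∃ l, ∀ T v, IsMildSolution α b₁ b₂ ε₁ ε₂ P q p φ T v → t ∈ Ico 0 T → l = v t := by
      intro t
      by_cases hex : ∃ T v, IsMildSolution α b₁ b₂ ε₁ ε₂ P q p φ T v ∧ t ∈ Ico 0 T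
      · obtain ⟨T, v, hv, htT⟩ := hex
        refine ⟨v t, fun T' v' hv' htT' => ?_⟩
        exact (hv.mono (min_le_left T T')).eqOn h ht (hv'.mono (min_le_right T T'))
          ⟨htT.1, lt_min htT.2 htT'.2⟩
      · exact ⟨0, fun T v hv htT => absurd ⟨T, v, hv, htT⟩ hex⟩
    choose u hu using this
    exact ⟨u, fun T v hv t htT => hu t T v hv htT⟩
  have hmild : ∀ T > 0, (∃ v, IsMildSolution α b₁ b₂ ε₁ ε₂ P q p φ T v) →
      IsMildSolution α b₁ b₂ ε₁ ε₂ P q p φ T u := fun T hT ⟨v, hv⟩ => hv.congr hT (hu T v hv)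
  set S : Set ℝ := {T | 0 < T ∧ ∃ v, IsMildSolution α b₁ b₂ ε₁ ε₂ P q p φ T v} with hS
  have hSne : S.Nonempty := by
    obtain ⟨T, hT, v, hv⟩ := hloc
    exact ⟨T, hT, v, hv⟩
  refine ⟨u, ?_⟩
  by_cases hbdd : BddAbove S
  · refine Or.inr ⟨sSup S, ?_, fun T hT hTS => ?_, ?_⟩
    · obtain ⟨T, hT⟩ := hSne
      exact hT.1.trans_le (le_csSup hbdd hT)
    · obtain ⟨T', hT'S, hT'⟩ := exists_lt_of_lt_csSup hSne hTS
      exact (hmild T' hT'S.1 hT'S.2).mono hT'.le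
    · rintro ⟨T, hT, v, hv, -⟩
      have hT0 : 0 < T := by
        obtain ⟨T', hT'⟩ := hSne
        exact (hT'.1.trans_le (le_csSup hbdd hT')).trans hT
      exact absurd (le_csSup hbdd ⟨hT0, v, hv⟩) (not_le.2 hT)
  · refine Or.inl fun T _ => ?_
    rw [not_bddAbove_iff] at hbdd
    obtain ⟨T', hT'S, hT'⟩ := hbdd T
    exact (hmild T' hT'S.1 hT'S.2).mono hT'.le

/-- A maximal solution cannot be continued from any of its values beyond the maximal time. -/
theorem IsMaximalSolution.not_exists (h : IsSubcritical α b₁ b₂ ε₁ ε₂ P r)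
    (ht : GeneralizedAdmissible n α q p r) {Tₘ : ℝ}
    (hu : IsMaximalSolution α b₁ b₂ ε₁ ε₂ P q p φ Tₘ u) {s T' : ℝ} (hs : s ∈ Ico 0 Tₘ)
    (hT' : Tₘ < s + T') : ¬ ∃ v, IsMildSolution α b₁ b₂ ε₁ ε₂ P q p (u s) T' v := by
  rintro ⟨v, hv⟩
  obtain ⟨hTₘ, hmild, hmax⟩ := hu
  have key : ¬ ∃ z, IsMildSolution α b₁ b₂ ε₁ ε₂ P q p φ (s + T') z := by
    rintro ⟨z, hz⟩
    refine hmax ⟨s + T', hT', z, hz, fun t htt => ?_⟩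
    obtain ⟨c, htc, hcT⟩ := exists_between htt.2
    exact (hz.mono (hcT.trans hT').le).eqOn h ht (hmild c (htt.1.trans_lt htc) hcT) ⟨htt.1, htc⟩
  obtain ⟨c, hsc, hcT⟩ := exists_between hs.2
  have hc := hmild c (hs.1.trans_lt hsc) hcT
  -- At s = 0 the new solution itself contradicts maximality; for s > 0 it is first glued to u.
  rcases hs.1.eq_or_lt with rfl | hs0
  · rw [zero_add] at key
    rw [hc.initial] at hv
    exact key ⟨v, hv⟩
  · exact key ⟨_, hc.glue h ht hs0 hsc hv (hcT.trans hT').le⟩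

end continuation

/-! ### The blow-up rate -/

section blowUp

variable {n : ℕ} {α b₁ b₂ ε₁ ε₂ : ℝ} {P : HigherOrderTerm n} {r : ℝ≥0∞}

/-- The size of the Duhamel factor along the blow-up rate. -/
theorem exists_duhamelFactor_le (h : IsSubcritical α b₁ b₂ ε₁ ε₂ P r)
    (hd : P.degree / (2 * α) ≤ 1) {C : ℝ} (hC : 0 < C) (T₀ : ℝ) :
    ∃ c > 0, ∀ x > 0, x ≤ T₀ → C * duhamelFactor α b₁ b₂ P r (2 * x)
      (c / x ^ (1 / b₁ - P.degree / (2 * b₁ * α) - n / (2 * r.toReal * α))) ≤ 1 := by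
  have hα := h.alpha_pos
  have hb₂ := h.b₂_pos
  have hb₁ := hb₂.trans h.b₂_lt
  have h1 := h.lt_one₁
  have h2 := h.lt_one₂
  set L := max T₀ 1 with hL
  have hL1 : 1 ≤ L := le_max_right _ _
  have hL0 : 0 < L := by linarith
  set δ := P.degree / (2 * α) with hδ
  have hδ0 : 0 ≤ δ := by positivity
  set κ := n / (2 * α) / r.toReal with hκ
  have hκ0 : 0 ≤ κ := by positivity
  have e1 : n / (2 * α) * b₁ / r.toReal = κ * b₁ := by rw [hκ]; ring
  have e2 : n / (2 * α) * b₂ / r.toReal = κ * b₂ := by rw [hκ]; ring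
  have e3 : 1 / b₁ - P.degree / (2 * b₁ * α) - n / (2 * r.toReal * α) = (1 - δ) / b₁ - κ := by
    have : n / (2 * r.toReal * α) = κ := by rw [hκ, div_div]; ring_nf
    rw [this, hδ]
    congr 1
    field_simp
  rw [e1] at h1
  rw [e2] at h2
  have hκb₁ := mul_nonneg hκ0 hb₁.le
  have hκb₂ := mul_nonneg hκ0 hb₂.le
  -- The factor 4 counts two terms, each with a power of 2 that is at most 2. With c ≤ 1 and c^b₂ =
  -- y, both c^b₁ and c^b₂ are at most y.
  set y := 1 / (1 + 4 * C * L) with hy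
  have hy0 : 0 < y := by positivity
  have hy1 : y ≤ 1 := by
    rw [hy, div_le_one (by positivity)]
    have : 0 < 4 * C * L := by positivity
    linarith
  set c := y ^ (1 / b₂) with hc
  have hc0 : 0 < c := by positivity
  have hc1 : c ≤ 1 := Real.rpow_le_one hy0.le hy1 (by positivity)
  have hcb : c ^ b₂ = y := by
    rw [hc, ← Real.rpow_mul hy0.le, one_div_mul_cancel hb₂.ne', Real.rpow_one]
  refine ⟨c, hc0, fun x hx hxT => ?_⟩
  have hxL : x ≤ L := hxT.trans (le_max_left _ _)
  rw [e3, duhamelFactor, e1, e2, ← hδ]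
  -- At norm c·x^(−θ) the remaining powers of x are δ and (1−δ)(1 − b₂/b₁). They lie in [0,1], so
  -- each is at most L; this is where the upper bound on the blow-up time enters.
  have term : ∀ {η b : ℝ}, 0 ≤ η → η ≤ 1 → b₂ ≤ b → 0 ≤ η - ((1 - δ) / b₁ - κ) * b →
      η - ((1 - δ) / b₁ - κ) * b ≤ 1 →
      (2 * x) ^ η * (c / x ^ ((1 - δ) / b₁ - κ)) ^ b ≤ 2 * L * y := by
    intro η b hη0 hη1 hb hζ0 hζ1
    have hb0 : 0 ≤ b := hb₂.le.trans hb
    rw [Real.mul_rpow zero_le_two hx.le, Real.div_rpow hc0.le (by positivity), ←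
        Real.rpow_mul hx.le]
    have f1 : (2:ℝ) ^ η ≤ 2 := by
      calc (2:ℝ) ^ η ≤ 2 ^ (1:ℝ) := Real.rpow_le_rpow_of_exponent_le one_le_two hη1
        _ = 2 := Real.rpow_one 2
    have f2 : c ^ b ≤ y := by
      rw [← hcb]; exact Real.rpow_le_rpow_of_exponent_ge hc0 hc1 hb
    have f3 : x ^ (η - ((1 - δ) / b₁ - κ) * b) ≤ L := by
      calc _ ≤ L ^ (η - ((1 - δ) / b₁ - κ) * b) := Real.rpow_le_rpow hx.le hxL hζ0
        _ ≤ L ^ (1:ℝ) := Real.rpow_le_rpow_of_exponent_le hL1 hζ1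
        _ = L := Real.rpow_one L
    calc _ = 2 ^ η * x ^ (η - ((1 - δ) / b₁ - κ) * b) * c ^ b := by
          rw [Real.rpow_sub hx]; ring
      _ ≤ 2 * L * y := by gcongr
  have hq : b₂ / b₁ ≤ 1 := (div_le_one hb₁).2 h.b₂_lt.le
  have hq0 : 0 ≤ b₂ / b₁ := by positivity
  have t1 := term (η := 1 - κ * b₁) (b := b₁) (by linarith) (by linarith) h.b₂_lt.le
    (by
      have : 1 - κ * b₁ - ((1 - δ) / b₁ - κ) * b₁ = δ := by field_simp; ring
      rw [this]; exact hδ0)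
    (by
      have : 1 - κ * b₁ - ((1 - δ) / b₁ - κ) * b₁ = δ := by field_simp; ring
      rw [this]; exact hd)
  have hζ : 1 - δ - κ * b₂ - ((1 - δ) / b₁ - κ) * b₂ = (1 - δ) * (1 - b₂ / b₁) := by
    field_simp; ring
  have t2 := term (η := 1 - δ - κ * b₂) (b := b₂) (by linarith) (by linarith) le_rfl
    (by rw [hζ]; exact mul_nonneg (by linarith) (by linarith))
    (by rw [hζ]; exact mul_le_one₀ (by linarith) (by linarith) (by linarith))
  calc _ ≤ C * (2 * L * y + 2 * L * y) := by gcongr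
    _ = 4 * C * L / (1 + 4 * C * L) := by rw [hy]; ring
    _ ≤ 1 := by
      rw [div_le_one (by positivity)]
      linarith

end blowUp

/-! ### The main theorem -/

theorem theorem5p4 {𝕜 : Type*} [RCLike 𝕜] (n : ℕ) (α b₁ b₂ ε₁ ε₂ : ℝ)
    (hb₂ : 0 < b₂) (hb : b₂ < b₁)
    (hε₁ : ε₁ = 1 ∨ ε₁ = -1) (hε₂ : ε₂ = 1 ∨ ε₂ = -1)
    (P : HigherOrderTerm n) (hα : P.order < 2 * α)
    (q p r : ℝ≥0∞) [Fact (1 ≤ p)] [Fact (1 ≤ r)]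
    (htriplet : GeneralizedAdmissible n α q p r)
    (hrd : 1 < n * b₁ / (2 * α - P.order))
    (hr : n * b₁ / (2 * α - P.order) ≤ r.toReal) :
    -- local existence
    (∀ φ : Lp 𝕜 r (volume : Measure (EuclideanSpace ℝ (Fin n))), ∃ T > 0, ∃ u,
        IsMildSolution α b₁ b₂ ε₁ ε₂ P q p φ T u) ∧
    -- if `r > r_d`, the existence time depends only on the norm of the datum
    (n * b₁ / (2 * α - P.order) < r.toReal → ∀ R : ℝ, ∃ T > 0,
      ∀ φ : Lp 𝕜 r (volume : Measure (EuclideanSpace ℝ (Fin n))), ‖φ‖ ≤ R →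
        ∃ u, IsMildSolution α b₁ b₂ ε₁ ε₂ P q p φ T u) ∧
    -- uniqueness in `Y([0,T))`, for every `T`
    (∀ (φ : Lp 𝕜 r (volume : Measure (EuclideanSpace ℝ (Fin n)))) (T : ℝ)
      (u v : ℝ → Lp 𝕜 r (volume : Measure (EuclideanSpace ℝ (Fin n)))),
        IsMildSolution α b₁ b₂ ε₁ ε₂ P q p φ T u → IsMildSolution α b₁ b₂ ε₁ ε₂ P q p φ T v →
          EqOn u v (Ico 0 T)) ∧
    -- the solution is global or has a finite maximal existence interval
    (∀ φ : Lp 𝕜 r (volume : Measure (EuclideanSpace ℝ (Fin n))), ∃ u,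
      (∀ T > 0, IsMildSolution α b₁ b₂ ε₁ ε₂ P q p φ T u) ∨
        ∃ Tₘ, IsMaximalSolution α b₁ b₂ ε₁ ε₂ P q p φ Tₘ u) ∧
    -- blow-up rate and blow-up
    (n * b₁ / (2 * α - P.order) < r.toReal → ∀ T₀ : ℝ, ∃ C > 0,
      ∀ (φ : Lp 𝕜 r (volume : Measure (EuclideanSpace ℝ (Fin n)))) (Tₘ : ℝ)
        (u : ℝ → Lp 𝕜 r (volume : Measure (EuclideanSpace ℝ (Fin n)))),
        Tₘ ≤ T₀ → IsMaximalSolution α b₁ b₂ ε₁ ε₂ P q p φ Tₘ u →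
          (∀ s ∈ Ico 0 Tₘ,
            C / (Tₘ - s) ^ (1 / b₁ - P.order / (2 * b₁ * α) - n / (2 * r.toReal * α)) ≤ ‖u s‖) ∧
          Tendsto (fun t => ‖u t‖) (𝓝[<] Tₘ) atTop) := by
  have h : IsSubcritical α b₁ b₂ ε₁ ε₂ P r := isSubcritical_of_le hb₂ hb hε₁ hε₂ hα
    (ne_top_of_le_ne_top htriplet.lt_top.ne htriplet.le) hrd hr
  obtain ⟨C, hC, hex⟩ := exists_isMildSolution (𝕜 := 𝕜) h htriplet
  have hunif : ∀ R : ℝ, ∃ T > 0, ∀ φ : LpRn 𝕜 n r, ‖φ‖ ≤ R →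
      ∃ u, IsMildSolution α b₁ b₂ ε₁ ε₂ P q p φ T u := by
    intro R
    have h1 := (tendsto_duhamelFactor h (max R 0)).const_mul C
    rw [mul_zero] at h1
    obtain ⟨T, hT, hT0⟩ := ((h1.eventually_le_const one_pos).and self_mem_nhdsWithin).exists
    exact ⟨T, hT0, fun φ hφ => hex _ (le_max_right _ _) T hT0 hT φ (hφ.trans (le_max_left _ _))⟩
  have hloc : ∀ φ : LpRn 𝕜 n r, ∃ T > 0, ∃ u, IsMildSolution α b₁ b₂ ε₁ ε₂ P q p φ T u := by
    intro φ
    obtain ⟨T, hT, H⟩ := hunif ‖φ‖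
    exact ⟨T, hT, H φ le_rfl⟩
  refine ⟨hloc, fun _ => hunif, fun φ T u v hu hv => hu.eqOn h htriplet hv,
    fun φ => exists_global_or_isMaximalSolution h htriplet (hloc φ), fun hr T₀ => ?_⟩
  rw [P.order_eq] at hα hr ⊢
  have hα0 := h.alpha_pos
  obtain ⟨c, hc, hcT⟩ := exists_duhamelFactor_le h
    (by rw [div_le_one (by positivity)]; exact hα.le) hC T₀
  refine ⟨c, hc, fun φ Tₘ u hTₘ hu => ?_⟩
  have hrate : ∀ s ∈ Ico 0 Tₘ,
      c / (Tₘ - s) ^ (1 / b₁ - P.degree / (2 * b₁ * α) - n / (2 * r.toReal * α)) ≤ ‖u s‖ := by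
    intro s hs
    -- A smaller norm at s would give a solution from u(s) of lifetime 2(Tₘ − s), which overshoots
    -- Tₘ.
    by_contra! hlt
    have hTs : 0 < Tₘ - s := sub_pos.2 hs.2
    exact hu.not_exists h htriplet hs (T' := 2 * (Tₘ - s)) (by linarith)
      (hex _ (by positivity) _ (by positivity) (hcT _ hTs (by linarith [hs.1])) _ hlt.le)
  refine ⟨hrate, ?_⟩
  have hb₁ := hb₂.trans hb
  have hρ : 0 < r.toReal := zero_lt_one.trans_le (one_le_toReal h.ne_top)
  -- The exponent of the rate is positive exactly because r > r_d, so the lower bound tends to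
  -- infinity at Tₘ.
  have hθ : 0 < 1 / b₁ - P.degree / (2 * b₁ * α) - n / (2 * r.toReal * α) := by
    have e : 1 / b₁ - P.degree / (2 * b₁ * α) - n / (2 * r.toReal * α) =
        ((2 * α - P.degree) * r.toReal - n * b₁) / (2 * α * b₁ * r.toReal) := by field_simp
    rw [e]
    rw [div_lt_iff₀ (by linarith)] at hr
    exact div_pos (by linarith) (by positivity)
  have hlim : Tendsto (fun s => c / (Tₘ - s) ^
      (1 / b₁ - P.degree / (2 * b₁ * α) - n / (2 * r.toReal * α))) (𝓝[<] Tₘ) atTop := by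
    refine Tendsto.const_mul_atTop hc (tendsto_inv_nhdsGT_zero.comp ?_)
    refine tendsto_nhdsWithin_iff.2 ⟨?_, ?_⟩
    · have h1 : Tendsto (fun s => Tₘ - s) (𝓝[<] Tₘ) (𝓝 0) := by
        have := (continuous_sub_left Tₘ).tendsto Tₘ
        rw [sub_self] at this
        exact this.mono_left nhdsWithin_le_nhds
      have h2 := (Real.continuousAt_rpow_const 0 _ (Or.inr hθ.le)).tendsto.comp h1
      rwa [Real.zero_rpow hθ.ne'] at h2
    · filter_upwards [self_mem_nhdsWithin] with s hs
      exact Real.rpow_pos_of_pos (sub_pos.2 hs) _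
  refine tendsto_atTop_mono' _ ?_ hlim
  filter_upwards [Ico_mem_nhdsLT hu.1] with s hs
  exact hrate s hs
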